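/- Let $M$ be a smooth (Hausdorff) Riemannian manifold of dimension $n\ge 3$ with metric $\mathbf g=(\,\cdot\mid\cdot\,)$ and Levi-Civita connection $\Gamma^k_{ij}$, and let $\mathbf F=\mathbf F(p,\mathbf v)\in T_pM$ be a force field on $TM$, smooth at all points $(p,\mathbf v)$ with $\mathbf v\neq 0$. Consider the Newtonian dynamical system $\dot x^k=v^k$, $\nabla_t v^k=F^k$ on $M$. *Definitions.* A hypersurface is an embedded smooth submanifold of codimension $1$ without boundary, not necessarily closed in $M$. A hypersurface $S$ belongs to the transformation class if it is connected and simply connected, and has compact closure contained in some other hypersurface. A function $\nu$ on such an $S$ belongs to the transformation class if it extends to a smooth function on some hypersurface containing $\overline S$ and does not vanish on $\overline S$. Given a smooth unit normal field $\mathbf n$ on $S$, the shift of $S$ defined by $\nu$ is the smooth map $(p,t)\mapsto f_t(p)$, $p\in S$, $|t|<\varepsilon$, such that $t\mapsto f_t(p)$ is the trajectory of the system starting at $t=0$ from $p$ with velocity $\nu(p)\,\mathbf n(p)$. For local coordinates $u^1,\dots,u^{n-1}$ on $S$, put $\boldsymbol\tau_k=\partial f_t(p(u))/\partial u^k$, $\mathbf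 v=\partial f_t(p(u))/\partial t$ and $\varphi_k(t)=(\boldsymbol\tau_k\mid\mathbf v)$. The system satisfies the *additional normality condition* if for every hypersurface $S$ in $M$, every $p_0\in S$, either choice of the unit normal vector $\mathbf n_0$ to $S$ at $p_0$, and every real $\nu_0\ne0$, there are a relatively open piece $S'\subset S$ of transformation class with $p_0\in S'$, a smooth unit normal field $\mathbf n$ on $S'$ with $\mathbf n(p_0)=\mathbf n_0$, and a function $\nu$ of transformation class on $S'$ with $\nu(p_0)=\nu_0$, which for some $\varepsilon>0$ define a shift $f_t$ of $S'$ such that, for all local coordinates on $S'$ and at all points of $S'$, $\dot\varphi_k(0)=0$ for $k=1,\dots,n-1$. In local coordinates $x^1,\dots,x^n$ on $M$ and the associated coordinates $x^i,v^i$ on $TM$, let $v=|\mathbf v|$, $N^i=v^i/v$, $P^i_j=\delta^i_j-N^iN_j$, $\tilde\nabla_jF^i=\partial F^i/\partial v^j$ and $$\nabla_jF^i=\frac{\partial F^i}{\partial x^j}+\sum_a\Gamma^i_{ja}F^a-\sum_{a,b}v^a\,\Gamma^b_{ja}\,\frac{\partial F^i}{\partial v^b},$$ indices being lowered with $\mathbf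 g$. **Theorem 9.5.** The system satisfies the additional normality condition if and only if at every point $(p,\mathbf v)$ of $TM$ with $\mathbf v\neq0$, in all local coordinates near $p$ and for all indices $\varepsilon,\sigma$, $$\sum_{i,j}P^i_\varepsilon P^j_\sigma\Big(\sum_m N^m\frac{F_i\,\tilde\nabla_mF_j}{v}-\nabla_iF_j\Big)=\sum_{i,j}P^i_\varepsilon P^j_\sigma\Big(\sum_m N^m\frac{F_j\,\tilde\nabla_mF_i}{v}-\nabla_jF_i\Big)\tag{9.20}$$ and $$\sum_{i,j}P^j_\sigma\,\tilde\nabla_jF^i\,P^\varepsilon_i=\sum_{i,j,m}\frac{P^j_m\,\tilde\nabla_jF^i\,P^m_i}{n-1}\;P^\varepsilon_\sigma.\tag{9.42}$$ -/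

import Mathlib

open scoped Manifold ContDiff
open Set

noncomputable section

namespace NormalShift

/-- The coordinate space of dimension `n`. -/
abbrev Coord (n : ℕ) : Type := EuclideanSpace ℝ (Fin n)

/-- A smooth Riemannian metric on an `n`-dimensional manifold. -/
abbrev RiemMetric (n : ℕ) (M : Type*) [TopologicalSpace M] [ChartedSpace (Coord n) M]
    [IsManifold (𝓡 n) ∞ M] :=
  Bundle.ContMDiffRiemannianMetric (IB := 𝓡 n) ∞ (Coord n)
    (fun p : M => TangentSpace (𝓡 n) p)

/-- A force field: to a point `p` and a velocity `v ∈ T_p M` it assigns a vector of `T_p M`. -/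
abbrev ForceField (n : ℕ) (M : Type*) [TopologicalSpace M] [ChartedSpace (Coord n) M] :=
  (p : M) → TangentSpace (𝓡 n) p → TangentSpace (𝓡 n) p

variable {n : ℕ} {M : Type*} [TopologicalSpace M] [ChartedSpace (Coord n) M]

/-- The force field is smooth at all `(p, v)` with `v ≠ 0`. -/
def SmoothForce [IsManifold (𝓡 n) ∞ M] (F : ForceField n M) : Prop :=
  ContMDiffOn (𝓡 n).tangent (𝓡 n).tangent ∞
    (fun q : TangentBundle (𝓡 n) M => (⟨q.1, F q.1 q.2⟩ : TangentBundle (𝓡 n) M))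
    {q | q.2 ≠ 0}

/-! ### Components in a local chart `φ`, at `x` in the target of `φ` -/

section Components

/-- The tangent vector at `φ⁻¹ x` with components `w` in the chart `φ`. -/
def vecOf (φ : OpenPartialHomeomorph M (Coord n)) (x w : Coord n) :
    TangentSpace (𝓡 n) (φ.symm x) :=
  mfderiv (𝓡 n) (𝓡 n) φ.symm x w

/-- The components in the chart `φ` of a tangent vector `w` at `p`. -/
def compOf (φ : OpenPartialHomeomorph M (Coord n)) (p : M) (w : TangentSpace (𝓡 n) p) :
    Coord n :=
  mfderiv (𝓡 n) (𝓡 n) φ p w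

/-- The partial derivative `∂h/∂x^i` at `x`. -/
def pd (h : Coord n → ℝ) (i : Fin n) (x : Coord n) : ℝ :=
  fderiv ℝ h x (EuclideanSpace.single i 1)

/-- The components `F^k(x, v)` of the force field. -/
def FUp (F : ForceField n M) (φ : OpenPartialHomeomorph M (Coord n)) (x v : Coord n)
    (k : Fin n) : ℝ :=
  compOf φ (φ.symm x) (F (φ.symm x) (vecOf φ x v)) k

variable [IsManifold (𝓡 n) ∞ M] (g : RiemMetric n M) (F : ForceField n M)
  (φ : OpenPartialHomeomorph M (Coord n))

/-- The components `g_{ij}(x)` of the metric. -/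
def gLow (x : Coord n) (i j : Fin n) : ℝ :=
  g.inner (φ.symm x) (vecOf φ x (EuclideanSpace.single i 1))
    (vecOf φ x (EuclideanSpace.single j 1))

/-- The components `g^{ij}(x)` of the inverse matrix. -/
def gUp (x : Coord n) (i j : Fin n) : ℝ :=
  (Matrix.of (gLow g φ x))⁻¹ i j

/-- The Christoffel symbols `Γ^k_{ij}(x)` of the Levi-Civita connection. -/
def Gam (x : Coord n) (k i j : Fin n) : ℝ :=
  (1 / 2) * ∑ s, gUp g φ x k s *
    (pd (fun y => gLow g φ y s j) i x + pd (fun y => gLow g φ y i s) j x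
      - pd (fun y => gLow g φ y i j) s x)

/-- The covariant components `F_i = g_{ij} F^j`. -/
def FLow (x v : Coord n) (i : Fin n) : ℝ :=
  ∑ j, gLow g φ x i j * FUp F φ x v j

/-- The velocity gradient of the force: `velGrad j i` is `∂F^i/∂v^j`. -/
def velGrad (x v : Coord n) (j i : Fin n) : ℝ :=
  pd (fun w => FUp F φ x w i) j v

/-- The velocity gradient with lowered index: `∂F_i/∂v^j = g_{ik} ∂F^k/∂v^j`. -/
def velGradLow (x v : Coord n) (j i : Fin n) : ℝ :=
  ∑ k, gLow g φ x i k * velGrad F φ x v j k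

/-- The spatial gradient of the force:
`∇_j F^i = ∂F^i/∂x^j + Γ^i_{ja} F^a - v^a Γ^b_{ja} ∂F^i/∂v^b`. -/
def spGrad (x v : Coord n) (j i : Fin n) : ℝ :=
  pd (fun y => FUp F φ y v i) j x + ∑ a, Gam g φ x i j a * FUp F φ x v a
    - ∑ a, ∑ b, v a * Gam g φ x b j a * velGrad F φ x v b i

/-- The spatial gradient with lowered index: `∇_j F_i = g_{ik} ∇_j F^k`. -/
def spGradLow (x v : Coord n) (j i : Fin n) : ℝ :=
  ∑ k, gLow g φ x i k * spGrad g F φ x v j k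

/-- The modulus `|v|` of a velocity vector. -/
def speed (x v : Coord n) : ℝ :=
  Real.sqrt (∑ i, ∑ j, gLow g φ x i j * v i * v j)

/-- The components `N^i` of the unit vector `N = v / |v|`. -/
def NUp (x v : Coord n) (i : Fin n) : ℝ :=
  v i / speed g φ x v

/-- The covariant components `N_i = g_{ij} N^j`. -/
def NLow (x v : Coord n) (i : Fin n) : ℝ :=
  ∑ j, gLow g φ x i j * NUp g φ x v j

/-- The components `P^i_j = δ^i_j - N^i N_j` of the orthogonal projector onto the hyperplane
perpendicular to `v`. -/
def Proj (x v : Coord n) (i j : Fin n) : ℝ :=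
  (if i = j then 1 else 0) - NUp g φ x v i * NLow g φ x v j

/-- One side of the first equation:
`P^i_ε P^j_σ (N^m F_i ∂F_j/∂v^m / |v| - ∇_i F_j)`, summed over `i`, `j`, `m`. -/
def symmSide (x v : Coord n) (ε σ : Fin n) : ℝ :=
  ∑ i, ∑ j, Proj g φ x v i ε * Proj g φ x v j σ *
    ((∑ m, NUp g φ x v m * (FLow g F φ x v i * velGradLow g F φ x v m j / speed g φ x v))
      - spGradLow g F φ x v i j)

/-- The first equation at the point with coordinates `(x, v)`: `symmSide` is symmetric. -/
def SymmEquation (x v : Coord n) : Prop :=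
  ∀ ε σ : Fin n, symmSide g F φ x v ε σ = symmSide g F φ x v σ ε

/-- The second equation at the point with coordinates `(x, v)`: the projected velocity gradient
is the multiple of the projector prescribed by the trace. -/
def ScalarEquation (x v : Coord n) : Prop :=
  ∀ σ ε : Fin n,
    ∑ i, ∑ j, Proj g φ x v j σ * velGrad F φ x v j i * Proj g φ x v ε i =
      (∑ i, ∑ j, ∑ m,
        Proj g φ x v j m * velGrad F φ x v j i * Proj g φ x v m i / ((n : ℝ) - 1))
        * Proj g φ x v ε σ

/-- The curve `γ` satisfies the equations of motion `ẋ^k = v^k`, `∇_t v^k = F^k` at time `t`, in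
the chart `φ`, whose domain contains `γ t`. -/
def MotionEquation (γ : ℝ → M) (t : ℝ) : Prop :=
  ∀ k : Fin n,
    deriv (deriv fun s => φ (γ s)) t k
      + ∑ i, ∑ j, Gam g φ (φ (γ t)) k i j * deriv (fun s => φ (γ s)) t i
          * deriv (fun s => φ (γ s)) t j
      = FUp F φ (φ (γ t)) (deriv (fun s => φ (γ s)) t) k

end Components

/-! ### Hypersurfaces -/

/-- `σ`, restricted to the open set `U`, is the inverse of a system of local coordinates
`u^1, …, u^{n-1}` on the subset `S` of `M`: it is a smooth immersion and a homeomorphism of `U`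
onto a relatively open subset of `S`. -/
structure IsLocalParam (S : Set M) (U : Set (Coord (n - 1))) (σ : Coord (n - 1) → M) : Prop where
  isOpen : IsOpen U
  smooth : ContMDiffOn (𝓡 (n - 1)) (𝓡 n) ∞ σ U
  immersive : ∀ u ∈ U, Function.Injective (mfderiv (𝓡 (n - 1)) (𝓡 n) σ u)
  injOn : InjOn σ U
  isOpenMap : ∀ V ⊆ U, IsOpen V → ∃ W : Set M, IsOpen W ∧ σ '' V = S ∩ W

/-- A hypersurface: a (not necessarily closed) embedded submanifold of codimension one, without
boundary. -/
def IsHypersurface (S : Set M) : Prop :=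
  ∀ p ∈ S, ∃ U : Set (Coord (n - 1)), ∃ σ : Coord (n - 1) → M,
    IsLocalParam (n := n) S U σ ∧ p ∈ σ '' U

/-- The tangent vectors to the hypersurface `S`. -/
def tangentTo (S : Set M) : Set (TangentBundle (𝓡 n) M) :=
  {w | ∃ (U : Set (Coord (n - 1))) (σ : Coord (n - 1) → M), IsLocalParam (n := n) S U σ ∧
    ∃ u ∈ U, ∃ a : Coord (n - 1),
      w = (⟨σ u, mfderiv (𝓡 (n - 1)) (𝓡 n) σ u a⟩ : TangentBundle (𝓡 n) M)}

/-- The hypersurface `S` belongs to the transformation class. -/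
structure HypersurfaceTransformationClass (S : Set M) : Prop where
  hypersurface : IsHypersurface (n := n) S
  connected : IsConnected S
  simplyConnected : SimplyConnectedSpace S
  compact_closure : IsCompact (closure S)
  bigger : ∃ S' : Set M, IsHypersurface (n := n) S' ∧ closure S ⊆ S'

/-- The function `ν` on `S` belongs to the transformation class: it extends smoothly to a bigger
hypersurface containing the closure of `S`, and it does not vanish on this closure. (Only the values
of `ν` on the bigger hypersurface matter.) -/
structure FunctionTransformationClass (S : Set M) (ν : M → ℝ) : Prop where
  smooth_bigger : ∃ S' : Set M, IsHypersurface (n := n) S' ∧ closure S ⊆ S' ∧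
    ContMDiffOn (𝓡 n) 𝓘(ℝ, ℝ) ∞ ν S'
  ne_zero : ∀ p ∈ closure S, ν p ≠ 0

/-! ### Shift and deviation -/

variable [IsManifold (𝓡 n) ∞ M] (g : RiemMetric n M) (F : ForceField n M)

/-- `N` is a unit normal vector to `S` at `p`. -/
def IsUnitNormal (S : Set M) (p : M) (N : TangentSpace (𝓡 n) p) : Prop :=
  g.inner p N N = 1 ∧
    ∀ w : TangentSpace (𝓡 n) p, (⟨p, w⟩ : TangentBundle (𝓡 n) M) ∈ tangentTo (n := n) S →
      g.inner p N w = 0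

/-- `N` is a smooth field of unit normal vectors on `S`. -/
structure IsUnitNormalField (S : Set M) (N : (p : M) → TangentSpace (𝓡 n) p) : Prop where
  smooth : ContMDiffOn (𝓡 n) (𝓡 n).tangent ∞
    (fun p => (⟨p, N p⟩ : TangentBundle (𝓡 n) M)) S
  normal : ∀ p ∈ S, IsUnitNormal g S p (N p)

/-- The velocity vector of a curve. -/
def velocity (γ : ℝ → M) (t : ℝ) : TangentSpace (𝓡 n) (γ t) :=
  mfderiv 𝓘(ℝ, ℝ) (𝓡 n) γ t (1 : ℝ)

/-- On the open set `J` of times, `γ` is a trajectory of the Newtonian dynamical system with force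
field `F`. -/
structure IsTrajectory (γ : ℝ → M) (J : Set ℝ) : Prop where
  smooth : ContMDiffOn 𝓘(ℝ, ℝ) (𝓡 n) ∞ γ J
  motion : ∀ t ∈ J, ∀ φ ∈ IsManifold.maximalAtlas (𝓡 n) ∞ M, γ t ∈ φ.source →
    MotionEquation g F φ γ t

/-- The maps `f t`, `|t| < ε`, are the shift of `S` along trajectories of the dynamical system, where
the trajectory of `p ∈ S` starts at `p` with the velocity `ν(p) N(p)`. -/
structure IsShift (S : Set M) (N : (p : M) → TangentSpace (𝓡 n) p) (ν : M → ℝ) (ε : ℝ)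
    (f : ℝ → M → M) : Prop where
  smooth : ContMDiffOn ((𝓡 n).prod 𝓘(ℝ, ℝ)) (𝓡 n) ∞ (fun q : M × ℝ => f q.2 q.1)
    (S ×ˢ Ioo (-ε) ε)
  trajectory : ∀ p ∈ S, IsTrajectory g F (fun t => f t p) (Ioo (-ε) ε)
  initial : ∀ p ∈ S,
    (⟨f 0 p, velocity (n := n) (fun t => f t p) 0⟩ : TangentBundle (𝓡 n) M) = ⟨p, ν p • N p⟩

/-- The vector of variation `τ_k(t) = ∂x/∂u^k`, where `x(u, t) = f t (σ u)`. -/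
def variationVector (f : ℝ → M → M) (σ : Coord (n - 1) → M) (u : Coord (n - 1))
    (k : Fin (n - 1)) (t : ℝ) : TangentSpace (𝓡 n) (f t (σ u)) :=
  mfderiv (𝓡 (n - 1)) (𝓡 n) (fun w => f t (σ w)) u (EuclideanSpace.single k 1 : Coord (n - 1))

/-- The function of deviation `φ_k(t) = (τ_k | v)` on the trajectory starting at `σ u`. -/
def deviation (f : ℝ → M → M) (σ : Coord (n - 1) → M) (u : Coord (n - 1))
    (k : Fin (n - 1)) (t : ℝ) : ℝ :=
  g.inner (f t (σ u)) (variationVector f σ u k t) (velocity (n := n) (fun s => f s (σ u)) t)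

/-- The additional normality condition. The unit normal `N₀` at `p₀` fixes which of the two
opposite fields of unit normals is used. -/
def AdditionalNormality : Prop :=
  ∀ S : Set M, IsHypersurface (n := n) S → ∀ p₀ ∈ S,
    ∀ N₀ : TangentSpace (𝓡 n) p₀, IsUnitNormal g S p₀ N₀ → ∀ ν₀ : ℝ, ν₀ ≠ 0 →
      ∃ S' : Set M, (∃ W : Set M, IsOpen W ∧ S' = S ∩ W) ∧ p₀ ∈ S' ∧
        HypersurfaceTransformationClass (n := n) S' ∧
        ∃ N : (p : M) → TangentSpace (𝓡 n) p, IsUnitNormalField g S' N ∧ N p₀ = N₀ ∧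
        ∃ ν : M → ℝ, FunctionTransformationClass (n := n) S' ν ∧ ν p₀ = ν₀ ∧
        ∃ ε > 0, ∃ f : ℝ → M → M, IsShift g F S' N ν ε f ∧
          ∀ (U : Set (Coord (n - 1))) (σ : Coord (n - 1) → M), IsLocalParam (n := n) S' U σ →
            ∀ u ∈ U, ∀ k : Fin (n - 1), HasDerivAt (deviation g f σ u k) 0 0

end NormalShift

end

/-! Let `ψ` parametrize a hypersurface with unit normal `N`, and put `v = νN`. Write `A` for the
velocity gradient of the force at `v` and `S(a, b)` for `symmForm`. Differentiating `(τ_k | v)` in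
time, and the identity `|v|² = ν²` along the surface, gives `φ̇_k(0) = ν ∂_kν + (F | τ_k)` at `t =
0` (`hasDerivAt_deviation`). Hence `φ̇_k(0) = 0` is the Pfaff equation `dν = θ(u, ν)` with `θ = -ν⁻¹
(F | dψ)` (`pfaffForm`), and additional normality asks that this equation be solvable near each
point of each hypersurface, with each nonzero initial value.

The derivative of `θ` along its own graph (`fderiv_pfaffForm`) consists of terms symmetric in the
two directions `h`, `k` and of `ν⁻¹ S(h, k) - (k | A ∇_hN)`. The Frobenius compatibility condition
is therefore `ν⁻¹ (S(h, k) - S(k, h)) = (k | A ∇_hN) - (h | A ∇_kN)`. In invariant terms, the first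
normality equation says that `S` is symmetric on the orthogonal complement of `v`, and the second
says that the compression of `A` to this complement is a scalar (`symmEquation_iff`,
`scalarEquation_iff`).

Sufficiency: under the two equations the left side vanishes, and the right side is a multiple of the
antisymmetric part of the second fundamental form, which is zero (`pfaffForm_compat`). A compatible
Pfaff equation is solved by integrating along rays (`exists_solution_pfaff`). The solution gives
initial data whose trajectories, smooth in the data, form the shift
(`additionalNormality_of_conditions`).

Necessity: through each point, with each unit normal and each tangent vector `c`, there passes a
hypersurface with `∇_hN = (h | c) c` at that point (`exists_surface_of_second_form`,
`relation_of_compat`). A solution `ν` has symmetric second derivatives, so compatibility holds there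
and becomes a relation between `S`, `A` and `c`. Taking `c = 0` gives the symmetry of `S`. What
remains says that the compression of `A` sends every `c` to a multiple of `c`, so it is a scalar
(`scalarCondition_of_relation`).

Smooth dependence of trajectories on initial data is obtained from the implicit function theorem in
`C([0, 1], E)`, applied to the Picard equation. -/

set_option linter.unusedSectionVars false

noncomputable section

namespace NormalShift

/-! ### Smooth dependence of solutions of ordinary differential equations on initial data -/

section Flow

open Topology Filter

universe u

variable {E F : Type u} [NormedAddCommGroup E] [NormedSpace ℝ E]
  [NormedAddCommGroup F] [NormedSpace ℝ F] {K : Type*} [TopologicalSpace K] [CompactSpace K]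

/-- Pointwise application of a continuous family of linear maps, as a bounded bilinear map. -/
def clmApplyCM (E F : Type u) [NormedAddCommGroup E] [NormedSpace ℝ E]
    [NormedAddCommGroup F] [NormedSpace ℝ F] (K : Type*) [TopologicalSpace K] [CompactSpace K] :
    C(K, E →L[ℝ] F) →L[ℝ] C(K, E) →L[ℝ] C(K, F) :=
  LinearMap.mkContinuous₂
    (LinearMap.mk₂ ℝ
      (fun (A : C(K, E →L[ℝ] F)) (h : C(K, E)) =>
        (⟨fun t => A t (h t), A.continuous.clm_apply h.continuous⟩ : C(K, F)))
      (fun _ _ _ => by ext; simp) (fun _ _ _ => by ext; simp)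
      (fun _ _ _ => by ext; simp) (fun _ _ _ => by ext; simp)) 1
    (fun A h => by
      rw [one_mul, ContinuousMap.norm_le _ (by positivity)]
      intro t
      exact (A t).le_of_opNorm_le_of_le (A.norm_coe_le_norm t) (h.norm_coe_le_norm t))

@[simp]
lemma clmApplyCM_apply (A : C(K, E →L[ℝ] F)) (h : C(K, E)) (t : K) :
    clmApplyCM E F K A h t = A t (h t) := rfl

/-- Composition with a fixed continuous map, as a self map of spaces of continuous functions. -/
def compCM {E F K : Type*} [NormedAddCommGroup E] [NormedAddCommGroup F]
    [TopologicalSpace K] (f : E → F) (hf : Continuous f) (γ : C(K, E)) : C(K, F) :=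
  ContinuousMap.comp ⟨f, hf⟩ γ

@[simp]
lemma compCM_apply {E F K : Type*} [NormedAddCommGroup E] [NormedAddCommGroup F]
    [TopologicalSpace K] (f : E → F) (hf : Continuous f) (γ : C(K, E)) (t : K) :
    compCM f hf γ t = f (γ t) := rfl

/-- The mean value inequality on the segment, with a remainder constant independent of `x` and `y`.
This uniformity is what makes the estimate usable in the sup norm. -/
lemma norm_sub_sub_le_of_lipschitz_fderiv {f : E → F} (hf : Differentiable ℝ f) {C : NNReal}
    (hC : LipschitzWith C (fderiv ℝ f)) (x y : E) :
    ‖f y - f x - fderiv ℝ f x (y - x)‖ ≤ C * ‖y - x‖ * ‖y - x‖ := by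
  refine (convex_segment x y).norm_image_sub_le_of_norm_hasFDerivWithin_le'
    (f' := fderiv ℝ f) (fun z _ => (hf z).hasFDerivAt.hasFDerivWithinAt) (fun z hz => ?_)
    (left_mem_segment ℝ x y) (right_mem_segment ℝ x y)
  calc ‖fderiv ℝ f z - fderiv ℝ f x‖ ≤ C * ‖z - x‖ := by
        simpa [dist_eq_norm] using hC.dist_le_mul z x
    _ ≤ C * ‖y - x‖ := by
        gcongr
        exact norm_sub_le_of_mem_segment hz

/-- Compact support makes `fderiv ℝ f` globally Lipschitz, so the quadratic Taylor remainder is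
bounded uniformly in the point of `K`, which is differentiability for the sup norm. -/
lemma hasFDerivAt_compCM {f : E → F} (hf : ContDiff ℝ ∞ f) (hs : HasCompactSupport f)
    (γ : C(K, E)) :
    HasFDerivAt (compCM (K := K) f hf.continuous)
      (clmApplyCM E F K (compCM (fderiv ℝ f) (hf.continuous_fderiv (by simp)) γ)) γ := by
  obtain ⟨C, hC⟩ := ContDiff.lipschitzWith_of_hasCompactSupport (𝕂 := ℝ) (n := ∞) (hs.fderiv ℝ)
    (hf.fderiv_right (by simp)) (by simp)
  have key : ∀ δ : C(K, E), ‖compCM f hf.continuous δ - compCM f hf.continuous γ -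
      clmApplyCM E F K (compCM (fderiv ℝ f) (hf.continuous_fderiv (by simp)) γ) (δ - γ)‖
      ≤ C * ‖δ - γ‖ * ‖δ - γ‖ := by
    intro δ
    rw [ContinuousMap.norm_le _ (by positivity)]
    intro t
    refine (norm_sub_sub_le_of_lipschitz_fderiv (hf.differentiable (by simp)) hC (γ t) (δ t)).trans
      ?_
    have : ‖δ t - γ t‖ ≤ ‖δ - γ‖ := (δ - γ).norm_coe_le_norm t
    gcongr
  rw [hasFDerivAt_iff_isLittleO]
  refine (Asymptotics.IsBigO.of_bound' (Eventually.of_forall fun δ => ?_)).trans_isLittleO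
    (g := fun δ : C(K, E) => (C * ‖δ - γ‖) * ‖δ - γ‖) ?_
  · refine (key δ).trans (le_abs_self _)
  · have h : Tendsto (fun δ : C(K, E) => (C : ℝ) * ‖δ - γ‖) (𝓝 γ) (𝓝 0) := by
      have : Continuous fun δ : C(K, E) => (C : ℝ) * ‖δ - γ‖ := by fun_prop
      simpa using this.tendsto γ
    have := (Asymptotics.isLittleO_one_iff ℝ).2 h |>.mul_isBigO
      (Asymptotics.isBigO_refl (fun δ : C(K, E) => ‖δ - γ‖) (𝓝 γ))
    simpa using this

/-- The derivative is the bounded linear `clmApplyCM` applied to the composition operator of `fderiv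
ℝ f`, which is again smooth and compactly supported. The induction must range over all targets
because `fderiv ℝ f` takes values in `E →L[ℝ] F`, and this is why both spaces share one universe. -/
lemma contDiff_nat_compCM (m : ℕ) : ∀ {F : Type u} [NormedAddCommGroup F] [NormedSpace ℝ F]
    {f : E → F} (hf : ContDiff ℝ ∞ f), HasCompactSupport f →
    ContDiff ℝ m (compCM (K := K) f hf.continuous) := by
  induction m with
  | zero =>
    intro F _ _ f hf hs
    rw [Nat.cast_zero, contDiff_zero]
    exact continuous_iff_continuousAt.2 fun γ => (hasFDerivAt_compCM hf hs γ).continuousAt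
  | succ m ih =>
    intro F _ _ f hf hs
    rw [Nat.cast_succ, contDiff_succ_iff_hasFDerivAt]
    exact ⟨_, (clmApplyCM E F K).contDiff.comp (ih (hf.fderiv_right (m := ∞) (by simp))
      (hs.fderiv ℝ)), hasFDerivAt_compCM hf hs⟩

lemma contDiff_compCM {f : E → F} (hf : ContDiff ℝ ∞ f) (hs : HasCompactSupport f) :
    ContDiff ℝ ∞ (compCM (K := K) f hf.continuous) :=
  contDiff_infty.2 fun m => contDiff_nat_compCM m hf hs

/-- The primitive vanishing at `0`, as a bounded operator on `C([0, 1], E)`. -/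
def primitiveCM (E : Type u) [NormedAddCommGroup E] [NormedSpace ℝ E] :
    C(Icc (0 : ℝ) 1, E) →L[ℝ] C(Icc (0 : ℝ) 1, E) :=
  LinearMap.mkContinuous
    { toFun := fun γ => ⟨fun s => ∫ r in (0 : ℝ)..s, γ (projIcc 0 1 zero_le_one r), by
        have h : Continuous fun r : ℝ => γ (projIcc 0 1 zero_le_one r) :=
          γ.continuous.comp continuous_projIcc
        exact (intervalIntegral.continuous_primitive
          (fun a b => h.intervalIntegrable a b) 0).comp continuous_subtype_val⟩
      map_add' := fun γ δ => by
        ext s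
        have h : ∀ γ : C(Icc (0 : ℝ) 1, E),
            Continuous fun r : ℝ => γ (projIcc 0 1 zero_le_one r) :=
          fun γ => γ.continuous.comp continuous_projIcc
        simpa using intervalIntegral.integral_add ((h γ).intervalIntegrable 0 s)
          ((h δ).intervalIntegrable 0 s)
      map_smul' := fun c γ => by
        ext s
        simp [intervalIntegral.integral_smul] } 1
    (fun γ => by
      rw [ContinuousMap.norm_le _ (by positivity)]
      intro s
      refine (intervalIntegral.norm_integral_le_of_norm_le_const (C := ‖γ‖)
        (fun r _ => γ.norm_coe_le_norm _)).trans ?_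
      rw [sub_zero, abs_of_nonneg s.2.1, mul_comm]
      exact mul_le_mul_of_nonneg_right s.2.2 (norm_nonneg _))

lemma norm_primitiveCM_le (γ : C(Icc (0 : ℝ) 1, E)) : ‖primitiveCM E γ‖ ≤ ‖γ‖ := by
  simpa using (primitiveCM E).le_of_opNorm_le (LinearMap.mkContinuous_norm_le _ zero_le_one _) γ


/-- The equation for the rescaled trajectory: `γ` is the fixed point of
`γ ↦ x + τ ∫ f(γ)`. -/
def rescaledPicard (f : E → E) (hf : Continuous f) (q : E × ℝ) (γ : C(Icc (0 : ℝ) 1, E)) :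
    C(Icc (0 : ℝ) 1, E) :=
  ContinuousLinearMap.const ℝ (Icc (0 : ℝ) 1) q.1 + q.2 • primitiveCM E (compCM f hf γ)

lemma rescaledPicard_apply (f : E → E) (hf : Continuous f) (q : E × ℝ)
    (γ : C(Icc (0 : ℝ) 1, E)) (s : Icc (0 : ℝ) 1) :
    rescaledPicard f hf q γ s =
      q.1 + q.2 • ∫ r in (0 : ℝ)..s, f (γ (projIcc 0 1 zero_le_one r)) := rfl

/-- Rescaling time to `[0, 1]` makes the end time `q.2` a mere factor, so the Picard map is smooth
jointly in the initial point, the time and the curve, on one fixed function space. -/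
lemma contDiff_rescaledPicard {f : E → E} (hf : ContDiff ℝ ∞ f) (hs : HasCompactSupport f) :
    ContDiff ℝ ∞ (fun z : (E × ℝ) × C(Icc (0 : ℝ) 1, E) =>
      rescaledPicard f hf.continuous z.1 z.2) := by
  have h1 := contDiff_compCM (K := Icc (0 : ℝ) 1) hf hs
  unfold rescaledPicard
  have h2 : ContDiff ℝ ∞ (fun z : (E × ℝ) × C(Icc (0 : ℝ) 1, E) =>
      primitiveCM E (compCM f hf.continuous z.2)) :=
    (primitiveCM E).contDiff.comp (h1.comp contDiff_snd)
  exact (((ContinuousLinearMap.const ℝ (Icc (0 : ℝ) 1)).contDiff.comp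
    (contDiff_fst.comp contDiff_fst)).add ((contDiff_snd.comp contDiff_fst).smul h2))

lemma lipschitzWith_rescaledPicard {f : E → E} {C : NNReal} (hC : LipschitzWith C f) (q : E × ℝ) :
    LipschitzWith (‖q.2‖₊ * C) (rescaledPicard f hC.continuous q) := by
  refine LipschitzWith.of_dist_le_mul fun γ δ => ?_
  rw [dist_eq_norm, rescaledPicard, rescaledPicard, add_sub_add_left_eq_sub, ← smul_sub, ← map_sub,
    norm_smul]
  have : ‖compCM f hC.continuous γ - compCM f hC.continuous δ‖ ≤ C * ‖γ - δ‖ := by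
    rw [ContinuousMap.norm_le _ (by positivity)]
    intro t
    have := hC.dist_le_mul (γ t) (δ t)
    rw [dist_eq_norm, dist_eq_norm] at this
    refine this.trans ?_
    gcongr
    exact (γ - δ).norm_coe_le_norm t
  rw [dist_eq_norm, NNReal.coe_mul, coe_nnnorm, mul_assoc]
  gcongr
  exact (norm_primitiveCM_le _).trans this

lemma contractingWith_rescaledPicard {f : E → E} {C : NNReal} (hC : LipschitzWith C f) {q : E × ℝ}
    (hq : |q.2| * C < 1) :
    ContractingWith (‖q.2‖₊ * C) (rescaledPicard f hC.continuous q) :=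
  ⟨by rw [← NNReal.coe_lt_coe]; simpa using hq, lipschitzWith_rescaledPicard hC q⟩

open Classical in
/-- The trajectory `s ↦ x(τ s)`, `0 ≤ s ≤ 1`, starting at `x(0) = q.1`, with `τ = q.2`. -/
def rescaledSolution [CompleteSpace E] {f : E → E} {C : NNReal} (hC : LipschitzWith C f) (q : E × ℝ) :
    C(Icc (0 : ℝ) 1, E) :=
  if hq : |q.2| * C < 1 then (contractingWith_rescaledPicard hC hq).fixedPoint else 0

lemma rescaledPicard_rescaledSolution [CompleteSpace E] {f : E → E} {C : NNReal} (hC : LipschitzWith C f) {q : E × ℝ}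
    (hq : |q.2| * C < 1) :
    rescaledPicard f hC.continuous q (rescaledSolution hC q) = rescaledSolution hC q := by
  rw [rescaledSolution, dif_pos hq]
  exact (contractingWith_rescaledPicard hC hq).fixedPoint_isFixedPt

lemma eq_rescaledSolution [CompleteSpace E] {f : E → E} {C : NNReal} (hC : LipschitzWith C f) {q : E × ℝ}
    (hq : |q.2| * C < 1) {γ : C(Icc (0 : ℝ) 1, E)}
    (hγ : rescaledPicard f hC.continuous q γ = γ) : γ = rescaledSolution hC q := by
  rw [rescaledSolution, dif_pos hq]
  exact (contractingWith_rescaledPicard hC hq).fixedPoint_unique hγ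

/-- The implicit function theorem for `γ - rescaledPicard q γ = 0`. The partial derivative in `γ` is
`1 - A` with `‖A‖ ≤ |q.2| C < 1`, invertible by the Neumann series, and uniqueness of the fixed
point identifies the implicit function with the solution. -/
lemma contDiffAt_rescaledSolution [CompleteSpace E] {f : E → E} (hf : ContDiff ℝ ∞ f) (hs : HasCompactSupport f)
    {C : NNReal} (hC : LipschitzWith C f) {q : E × ℝ} (hq : |q.2| * C < 1) :
    ContDiffAt ℝ ∞ (rescaledSolution hC) q := by
  set Ψ : (E × ℝ) × C(Icc (0 : ℝ) 1, E) → C(Icc (0 : ℝ) 1, E) :=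
    fun z => z.2 - rescaledPicard f hf.continuous z.1 z.2 with hΨ
  have hΨc : ContDiff ℝ ∞ Ψ := contDiff_snd.sub (contDiff_rescaledPicard hf hs)
  set γ := rescaledSolution hC q with hγ
  set A : C(Icc (0 : ℝ) 1, E) →L[ℝ] C(Icc (0 : ℝ) 1, E) := q.2 • primitiveCM E ∘L
    clmApplyCM E E (Icc (0 : ℝ) 1) (compCM (fderiv ℝ f) (hf.continuous_fderiv (by simp)) γ) with hA
  have hAn : ‖A‖ < 1 := by
    refine lt_of_le_of_lt (ContinuousLinearMap.opNorm_le_bound _ (M := |q.2| * C) (by positivity)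
      fun h => ?_) hq
    rw [hA, smul_apply, norm_smul, Real.norm_eq_abs, mul_assoc]
    gcongr
    refine (norm_primitiveCM_le _).trans ?_
    rw [ContinuousMap.norm_le _ (by positivity)]
    intro t
    refine ContinuousLinearMap.le_of_opNorm_le_of_le _ ?_ (h.norm_coe_le_norm t)
    exact norm_fderiv_le_of_lipschitz ℝ hC
  have hd : fderiv ℝ Ψ (q, γ) ∘L .inr ℝ (E × ℝ) C(Icc (0 : ℝ) 1, E) = 1 - A := by
    have h1 : HasFDerivAt (fun δ => Ψ (q, δ))
        (fderiv ℝ Ψ (q, γ) ∘L .inr ℝ (E × ℝ) C(Icc (0 : ℝ) 1, E)) γ :=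
      ((hΨc.differentiable (by simp)) (q, γ)).hasFDerivAt.comp γ (hasFDerivAt_prodMk_right q γ)
    have h2 : HasFDerivAt (fun δ => Ψ (q, δ)) (1 - A) γ := by
      refine (hasFDerivAt_id γ).sub ?_
      simp only [rescaledPicard]
      refine HasFDerivAt.const_add _ ?_
      exact ((primitiveCM E).hasFDerivAt.comp γ (hasFDerivAt_compCM hf hs γ)).const_smul q.2
    exact h1.unique h2
  have hinv : (fderiv ℝ Ψ (q, γ) ∘L .inr ℝ (E × ℝ) C(Icc (0 : ℝ) 1, E)).IsInvertible := by
    rw [hd]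
    exact ⟨ContinuousLinearEquiv.ofUnit (Units.oneSub A hAn), rfl⟩
  have hΨat : ContDiffAt ℝ ∞ Ψ (q, γ) := hΨc.contDiffAt
  have hne : (∞ : WithTop ℕ∞) ≠ 0 := by simp
  refine (hΨat.contDiffAt_implicitFunction hne hinv).congr_of_eventuallyEq ?_
  have hopen : ∀ᶠ y : E × ℝ in 𝓝 q, |y.2| * C < 1 := by
    have : Continuous fun y : E × ℝ => |y.2| * C := by fun_prop
    exact this.continuousAt.eventually_lt continuousAt_const hq
  have h0 : Ψ (q, γ) = 0 := by
    simp only [hΨ]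
    rw [rescaledPicard_rescaledSolution hC hq, sub_self]
  filter_upwards [hopen, hΨat.eventually_apply_implicitFunction hne hinv] with y hy h
  rw [h0] at h
  exact (eq_rescaledSolution hC hy (sub_eq_zero.1 h).symm).symm

/-- The flow of a Lipschitz vector field, for small times. -/
def localFlow [CompleteSpace E] {f : E → E} {C : NNReal} (hC : LipschitzWith C f) (q : E × ℝ) : E :=
  rescaledSolution hC q 1

lemma contDiffAt_localFlow [CompleteSpace E] {f : E → E} (hf : ContDiff ℝ ∞ f) (hs : HasCompactSupport f)
    {C : NNReal} (hC : LipschitzWith C f) {q : E × ℝ} (hq : |q.2| * C < 1) :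
    ContDiffAt ℝ ∞ (localFlow hC) q :=
  (ContinuousMap.evalCLM ℝ (M := E) (1 : Icc (0 : ℝ) 1)).contDiff.contDiffAt.comp q
    (contDiffAt_rescaledSolution hf hs hC hq)

/-- A trajectory cut off at the fraction `s` of its time and stretched back to `[0, 1]` solves the
Picard equation with end time `q.2 * s`; uniqueness of the fixed point concludes. -/
lemma rescaledSolution_apply [CompleteSpace E] {f : E → E} {C : NNReal} (hC : LipschitzWith C f) {q : E × ℝ}
    (hq : |q.2| * C < 1) (s : Icc (0 : ℝ) 1) :
    rescaledSolution hC q s = localFlow hC (q.1, q.2 * s) := by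
  have hs : |q.2 * s| * C < 1 := by
    refine lt_of_le_of_lt ?_ hq
    rw [abs_mul, abs_of_nonneg s.2.1]
    have := mul_le_mul_of_nonneg_left s.2.2 (mul_nonneg (abs_nonneg q.2) C.2)
    simp only [NNReal.val_eq_coe] at this
    nlinarith
  let m : C(Icc (0 : ℝ) 1, Icc (0 : ℝ) 1) :=
    ⟨fun r => ⟨s * r, mul_nonneg s.2.1 r.2.1, mul_le_one₀ s.2.2 r.2.1 r.2.2⟩, by fun_prop⟩
  have key : (rescaledSolution hC q).comp m = rescaledSolution hC (q.1, q.2 * s) := by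
    refine eq_rescaledSolution hC hs ?_
    ext r
    have h1 := congrArg (fun γ => γ (m r)) (rescaledPicard_rescaledSolution hC hq)
    simp only [rescaledPicard_apply] at h1 ⊢
    rw [ContinuousMap.comp_apply, ← h1, mul_smul]
    congr 2
    have h2 := intervalIntegral.smul_integral_comp_mul_left (a := 0) (b := r)
      (fun t => f (rescaledSolution hC q (projIcc 0 1 zero_le_one t))) (s : ℝ)
    rw [mul_zero] at h2
    refine Eq.trans ?_ h2
    congr 1
    refine intervalIntegral.integral_congr fun t ht => ?_
    rw [uIcc_of_le r.2.1] at ht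
    have ht' : t ∈ Icc (0 : ℝ) 1 := ⟨ht.1, ht.2.trans r.2.2⟩
    have hst : (s : ℝ) * t ∈ Icc (0 : ℝ) 1 :=
      ⟨mul_nonneg s.2.1 ht'.1, mul_le_one₀ s.2.2 ht'.1 ht'.2⟩
    simp only [ContinuousMap.comp_apply]
    rw [projIcc_of_mem _ ht', projIcc_of_mem _ hst]
    rfl
  have h3 := congrArg (fun γ => γ 1) key
  rw [localFlow, ← h3]
  simp [m]

lemma localFlow_eq [CompleteSpace E] {f : E → E} {C : NNReal} (hC : LipschitzWith C f) {q : E × ℝ}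
    (hq : |q.2| * C < 1) :
    localFlow hC q = q.1 + ∫ r in (0 : ℝ)..q.2, f (localFlow hC (q.1, r)) := by
  have h1 := congrArg (fun γ => γ 1) (rescaledPicard_rescaledSolution hC hq)
  simp only [rescaledPicard_apply] at h1
  rw [localFlow, ← h1]
  congr 1
  have h2 := intervalIntegral.smul_integral_comp_mul_left (a := 0) (b := 1)
    (fun t => f (localFlow hC (q.1, t))) q.2
  rw [mul_zero, mul_one] at h2
  rw [← h2]
  congr 1
  refine intervalIntegral.integral_congr fun t ht => ?_
  rw [Icc.coe_one, uIcc_of_le zero_le_one] at ht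
  rw [projIcc_of_mem _ ht, rescaledSolution_apply hC hq]

lemma hasDerivAt_localFlow [CompleteSpace E] {f : E → E} (hf : ContDiff ℝ ∞ f) (hs : HasCompactSupport f)
    {C : NNReal} (hC : LipschitzWith C f) {x : E} {t : ℝ} (ht : |t| * C < 1) :
    HasDerivAt (fun s => localFlow hC (x, s)) (f (localFlow hC (x, t))) t := by
  have hcont : ∀ r : ℝ, |r| * C < 1 → ContinuousAt (fun r => f (localFlow hC (x, r))) r := by
    intro r hr
    have h1 := (contDiffAt_localFlow hf hs hC (q := (x, r)) hr).continuousAt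
    exact hf.continuous.continuousAt.comp (ContinuousAt.comp h1 (by fun_prop))
  have hopen : IsOpen {r : ℝ | |r| * C < 1} := isOpen_lt (by fun_prop) continuous_const
  have hsub : uIcc 0 t ⊆ {r : ℝ | |r| * C < 1} := by
    intro r hr
    refine lt_of_le_of_lt ?_ ht
    have := abs_sub_left_of_mem_uIcc hr
    rw [sub_zero, sub_zero] at this
    exact mul_le_mul_of_nonneg_right this C.2
  have hcOn : ContinuousOn (fun r => f (localFlow hC (x, r))) {r : ℝ | |r| * C < 1} :=
    fun r hr => (hcont r hr).continuousWithinAt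
  have hI := intervalIntegral.integral_hasDerivAt_right (a := 0) (b := t)
    ((hcOn.mono hsub).intervalIntegrable)
    (hcOn.stronglyMeasurableAtFilter hopen t ht) (hcont t ht)
  refine (hI.const_add x).congr_of_eventuallyEq ?_
  filter_upwards [hopen.mem_nhds ht] with s hs
  exact localFlow_eq hC (q := (x, s)) hs

/-- Multiplication by a bump function reduces a locally defined field to the globally Lipschitz
case. -/
lemma exists_contDiff_hasCompactSupport_eqOn [FiniteDimensional ℝ E] {f : E → F} {Ω : Set E}
    (hΩ : IsOpen Ω) (hf : ContDiffOn ℝ ∞ f Ω) {x₀ : E} (hx₀ : x₀ ∈ Ω) :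
    ∃ R > 0, ∃ f' : E → F, ContDiff ℝ ∞ f' ∧ HasCompactSupport f' ∧ Metric.ball x₀ R ⊆ Ω ∧
      EqOn f' f (Metric.ball x₀ R) := by
  obtain ⟨R, hR, hRΩ⟩ := Metric.nhds_basis_closedBall.mem_iff.1 (hΩ.mem_nhds hx₀)
  let c : ContDiffBump x₀ := ⟨R / 2, R, half_pos hR, half_lt_self hR⟩
  refine ⟨R / 2, half_pos hR, fun x => c x • f x, ?_, c.hasCompactSupport.smul_right,
    (Metric.ball_subset_closedBall.trans
      (Metric.closedBall_subset_closedBall (half_le_self hR.le))).trans hRΩ, fun x hx => ?_⟩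
  · rw [contDiff_iff_contDiffAt]
    intro x
    by_cases hx : x ∈ Metric.closedBall x₀ R
    · exact c.contDiff.contDiffAt.smul (hf.contDiffAt (hΩ.mem_nhds (hRΩ hx)))
    · have : (fun x => c x • f x) =ᶠ[𝓝 x] fun _ => 0 := by
        filter_upwards [Metric.isClosed_closedBall.isOpen_compl.mem_nhds hx] with y hy
        rw [c.zero_of_le_dist (le_of_lt (by simpa using hy)), zero_smul]
      exact contDiffAt_const.congr_of_eventuallyEq this
  · simp only
    rw [c.one_of_mem_closedBall (Metric.ball_subset_closedBall hx), one_smul]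

/-- A smooth vector field has a smooth local flow. -/
theorem exists_smooth_localFlow [FiniteDimensional ℝ E] {f : E → E} {Ω : Set E}
    (hΩ : IsOpen Ω) (hf : ContDiffOn ℝ ∞ f Ω) {x₀ : E} (hx₀ : x₀ ∈ Ω) :
    ∃ δ > 0, ∃ ε > 0, ∃ Φ : E × ℝ → E,
      ContDiffOn ℝ ∞ Φ (Metric.ball x₀ δ ×ˢ Ioo (-ε) ε) ∧
      ∀ x ∈ Metric.ball x₀ δ, Φ (x, 0) = x ∧ ∀ t ∈ Ioo (-ε) ε,
        Φ (x, t) ∈ Ω ∧ HasDerivAt (fun s => Φ (x, s)) (f (Φ (x, t))) t := by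
  have : CompleteSpace E := FiniteDimensional.complete ℝ E
  obtain ⟨R, hR, f', hf', hs, hRΩ, heq⟩ := exists_contDiff_hasCompactSupport_eqOn hΩ hf hx₀
  obtain ⟨C, hC⟩ := hf'.lipschitzWith_of_hasCompactSupport hs (by simp)
  have h0 : ∀ x, localFlow hC (x, 0) = x := fun x => by
    rw [localFlow_eq hC (q := (x, 0)) (by simp)]
    simp
  have hopen : IsOpen {q : E × ℝ | |q.2| * C < 1} := isOpen_lt (by fun_prop) continuous_const
  -- For short times the flow of the cut-off field stays in the ball where it agrees with `f`, so it
  -- is also a flow of `f`.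
  have hev : ∀ᶠ q : E × ℝ in 𝓝 (x₀, 0),
      |q.2| * C < 1 ∧ localFlow hC q ∈ Metric.ball x₀ R := by
    refine Filter.Eventually.and (hopen.mem_nhds (by simp)) ?_
    refine (contDiffAt_localFlow hf' hs hC (q := (x₀, 0)) (by simp)).continuousAt.eventually_mem ?_
    rw [h0]
    exact Metric.ball_mem_nhds x₀ hR
  obtain ⟨δ, hδ, hsub⟩ := Metric.nhds_basis_ball.mem_iff.1 hev
  have hmem : ∀ x ∈ Metric.ball x₀ δ, ∀ t ∈ Ioo (-δ) δ, |t| * C < 1 ∧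
      localFlow hC (x, t) ∈ Metric.ball x₀ R := by
    intro x hx t ht
    refine hsub (a := (x, t)) ?_
    rw [← ball_prod_same]
    exact ⟨hx, by simpa [abs_lt] using ht⟩
  refine ⟨δ, hδ, δ, hδ, localFlow hC, fun q hq => ?_, fun x hx => ⟨h0 x, fun t ht => ?_⟩⟩
  · exact (contDiffAt_localFlow hf' hs hC (hmem q.1 hq.1 q.2 hq.2).1).contDiffWithinAt
  · obtain ⟨h1, h2⟩ := hmem x hx t ht
    refine ⟨hRΩ h2, ?_⟩
    rw [← heq h2]
    exact hasDerivAt_localFlow hf' hs hC h1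

end Flow

/-! ### Completely integrable Pfaff equations for one unknown function -/

section Pfaff

open Topology Filter

lemma fderiv_fderiv_symm {V W : Type*} [NormedAddCommGroup V] [NormedSpace ℝ V]
    [NormedAddCommGroup W] [NormedSpace ℝ W] {f : V → W} {x : V} (hf : ContDiffAt ℝ ∞ f x)
    (a b : V) : fderiv ℝ (fderiv ℝ f) x a b = fderiv ℝ (fderiv ℝ f) x b a :=
  (hf.isSymmSndFDerivAt (by simpa using WithTop.coe_le_coe.2 (le_top (a := (2 : ℕ∞))))) a b

lemma contDiffAt_fderiv {V W : Type*} [NormedAddCommGroup V] [NormedSpace ℝ V]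
    [NormedAddCommGroup W] [NormedSpace ℝ W] {f : V → W} {x : V} (hf : ContDiffAt ℝ ∞ f x) :
    ContDiffAt ℝ ∞ (fderiv ℝ f) x :=
  hf.fderiv_right (by simp)

lemma hasFDerivAt_fderiv_apply {V W : Type*} [NormedAddCommGroup V] [NormedSpace ℝ V]
    [NormedAddCommGroup W] [NormedSpace ℝ W] {f : V → W} {x : V} (hf : ContDiffAt ℝ ∞ f x)
    (a : V) : HasFDerivAt (fun y => fderiv ℝ f y a) (fderiv ℝ (fderiv ℝ f) x a) x := by
  have h := ((contDiffAt_fderiv hf).differentiableAt (by simp)).hasFDerivAt.clm_apply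
    (hasFDerivAt_const a x)
  refine h.congr_fderiv ?_
  ext b
  simp [fderiv_fderiv_symm hf a b]

universe u

variable {E : Type u} [NormedAddCommGroup E] [NormedSpace ℝ E]

/-- The solution along rays of a Pfaff equation. -/
lemma exists_radial_solution [FiniteDimensional ℝ E] {θ : E × ℝ → E →L[ℝ] ℝ} {Ω : Set (E × ℝ)}
    (hΩ : IsOpen Ω) (hθ : ContDiffOn ℝ ∞ θ Ω) {u₀ : E} {ν₀ : ℝ} (h₀ : (u₀, ν₀) ∈ Ω) :
    ∃ δ > 0, ∃ ε > 0, ∃ Y : E × ℝ → ℝ,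
      ContDiffOn ℝ ∞ Y (Metric.ball 0 δ ×ˢ Ioo (-ε) ε) ∧
      ∀ h ∈ Metric.ball (0 : E) δ, Y (h, 0) = ν₀ ∧ ∀ t ∈ Ioo (-ε) ε,
        (u₀ + t • h, Y (h, t)) ∈ Ω ∧
        HasDerivAt (fun s => Y (h, s)) (θ (u₀ + t • h, Y (h, t)) h) t := by
  set Ω' : Set (E × E × ℝ) := {p | (p.1, p.2.2) ∈ Ω} with hΩ'
  set f : E × E × ℝ → E × E × ℝ := fun p => (p.2.1, 0, θ (p.1, p.2.2) p.2.1) with hf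
  have hΩ'o : IsOpen Ω' := hΩ.preimage (by fun_prop)
  have hfs : ContDiffOn ℝ ∞ f Ω' := by
    have h1 : ContDiffOn ℝ ∞ (fun p : E × E × ℝ => θ (p.1, p.2.2)) Ω' :=
      hθ.comp (t := Ω) (by fun_prop) (fun p hp => hp)
    exact ContDiffOn.prodMk (by fun_prop) (contDiffOn_const.prodMk (h1.clm_apply (by fun_prop)))
  obtain ⟨δ, hδ, ε, hε, Φ, hΦ, hsol⟩ := exists_smooth_localFlow (x₀ := (u₀, (0 : E), ν₀)) hΩ'o hfs h₀
  have hmem : ∀ h ∈ Metric.ball (0 : E) δ, ((u₀, h, ν₀) : E × E × ℝ) ∈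
      Metric.ball (u₀, (0 : E), ν₀) δ := by
    intro h hh
    rw [← ball_prod_same, ← ball_prod_same]
    exact ⟨Metric.mem_ball_self hδ, hh, Metric.mem_ball_self hδ⟩
  refine ⟨δ, hδ, ε, hε, fun q => (Φ ((u₀, q.1, ν₀), q.2)).2.2, ?_, fun h hh => ⟨?_, fun t ht => ?_⟩⟩
  · refine contDiff_snd.comp_contDiffOn (contDiff_snd.comp_contDiffOn
      (hΦ.comp (by fun_prop) fun q hq => ⟨hmem q.1 hq.1, hq.2⟩))
  · simp only [(hsol _ (hmem h hh)).1]
  · obtain ⟨hinit, hs⟩ := hsol _ (hmem h hh)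
    have h0 : (0 : ℝ) ∈ Ioo (-ε) ε := ⟨by linarith, hε⟩
    have hconst : ∀ {W : Type u} [NormedAddCommGroup W] [NormedSpace ℝ W] {c : ℝ → W},
        (∀ s ∈ Ioo (-ε) ε, HasDerivAt c 0 s) → ∀ s ∈ Ioo (-ε) ε, c s = c 0 := by
      intro W _ _ c hc s hs'
      refine isOpen_Ioo.is_const_of_deriv_eq_zero (convex_Ioo _ _).isPreconnected
        (fun r hr => (hc r hr).differentiableAt.differentiableWithinAt)
        (fun r hr => (hc r hr).deriv) hs' h0
    have hh2 : ∀ s ∈ Ioo (-ε) ε, (Φ ((u₀, h, ν₀), s)).2.1 = h := by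
      intro s hs'
      rw [hconst (c := fun s => (Φ ((u₀, h, ν₀), s)).2.1)
        (fun r hr => (hs r hr).2.snd.fst) s hs', hinit]
    have hh1 : ∀ s ∈ Ioo (-ε) ε, (Φ ((u₀, h, ν₀), s)).1 = u₀ + s • h := by
      intro s hs'
      have := hconst (c := fun s => (Φ ((u₀, h, ν₀), s)).1 - s • h) (fun r hr => by
        refine HasDerivAt.congr_deriv (HasDerivAt.fun_sub
          (f' := (f (Φ ((u₀, h, ν₀), r))).1) (hs r hr).2.fst
          (HasDerivAt.smul_const (hasDerivAt_id r) h)) ?_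
        simp [hf, hh2 r hr]) s hs'
      simp only [hinit, zero_smul, sub_zero] at this
      exact sub_eq_iff_eq_add.1 this
    obtain ⟨h4, h5⟩ := hs t ht
    refine ⟨?_, ?_⟩
    · have : ((Φ ((u₀, h, ν₀), t)).1, (Φ ((u₀, h, ν₀), t)).2.2) ∈ Ω := h4
      rwa [hh1 t ht] at this
    · have h6 := h5.snd.snd
      simp only [hf, hh2 t ht, hh1 t ht] at h6
      exact h6

/-- A Pfaff equation `dν = θ(u, ν)` satisfying the compatibility condition has a smooth local
solution through every point. -/
theorem exists_solution_pfaff [FiniteDimensional ℝ E] {θ : E × ℝ → E →L[ℝ] ℝ} {Ω : Set (E × ℝ)}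
    (hΩ : IsOpen Ω) (hθ : ContDiffOn ℝ ∞ θ Ω)
    (hcompat : ∀ q ∈ Ω, ∀ h k, fderiv ℝ θ q (h, θ q h) k = fderiv ℝ θ q (k, θ q k) h)
    {u₀ : E} {ν₀ : ℝ} (h₀ : (u₀, ν₀) ∈ Ω) :
    ∃ δ > 0, ∃ ν : E → ℝ, ContDiffOn ℝ ∞ ν (Metric.ball u₀ δ) ∧ ν u₀ = ν₀ ∧
      ∀ u ∈ Metric.ball u₀ δ, (u, ν u) ∈ Ω ∧ HasFDerivAt ν (θ (u, ν u)) u := by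
  obtain ⟨δ, hδ, ε, hε, Y, hY, hsol⟩ := exists_radial_solution hΩ hθ h₀
  have hopen : IsOpen (Metric.ball (0 : E) δ ×ˢ Ioo (-ε) ε) := Metric.isOpen_ball.prod isOpen_Ioo
  have hYat : ∀ h ∈ Metric.ball (0 : E) δ, ∀ t ∈ Ioo (-ε) ε, ContDiffAt ℝ ∞ Y (h, t) :=
    fun h hh t ht => hY.contDiffAt (hopen.mem_nhds ⟨hh, ht⟩)
  have hYt : ∀ h ∈ Metric.ball (0 : E) δ, ∀ t ∈ Ioo (-ε) ε,
      fderiv ℝ Y (h, t) (0, 1) = θ (u₀ + t • h, Y (h, t)) h := by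
    intro h hh t ht
    have h1 := ((hYat h hh t ht).differentiableAt (by simp)).hasFDerivAt.comp_hasDerivAt t
      ((hasDerivAt_const t h).prodMk (hasDerivAt_id t))
    exact h1.unique (hsol h hh |>.2 t ht).2
  -- This says that `u₀ + t • h ↦ Y (h, t)` has differential `θ`: a displacement `k` of the
  -- direction moves the point by `t • k`.
  have key : ∀ h ∈ Metric.ball (0 : E) δ, ∀ k, ∀ t ∈ Ico 0 ε,
      fderiv ℝ Y (h, t) (k, 0) = t • θ (u₀ + t • h, Y (h, t)) k := by
    intro h hh k T hT
    have hsub : Icc 0 T ⊆ Ioo (-ε) ε := fun t ht => ⟨by linarith [ht.1], ht.2.trans_lt hT.2⟩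
    -- The defect `z` of the claim satisfies the linear equation `z' = z · ∂_νθ(h)`: mixed partials
    -- of `Y` commute, and compatibility exchanges `h` and `k` in the derivative of `θ`. As `z 0 =
    -- 0`, the defect vanishes.
    set z : ℝ → ℝ := fun t => fderiv ℝ Y (h, t) (k, 0) - t • θ (u₀ + t • h, Y (h, t)) k with hz
    have hθd : ∀ t ∈ Ioo (-ε) ε, ContDiffAt ℝ ∞ θ (u₀ + t • h, Y (h, t)) := fun t ht =>
      hθ.contDiffAt (hΩ.mem_nhds (hsol h hh |>.2 t ht).1)
    have hz' : ∀ t ∈ Ioo (-ε) ε, HasDerivAt z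
        (z t * fderiv ℝ θ (u₀ + t • h, Y (h, t)) (0, 1) h) t := by
      intro t ht
      have hθ' := ((hθd t ht).differentiableAt (by simp)).hasFDerivAt
      have hc : HasDerivAt (fun s : ℝ => ((h, s) : E × ℝ)) (0, 1) t :=
        (hasDerivAt_const t h).prodMk (hasDerivAt_id t)
      have h1 : HasDerivAt (fun s => fderiv ℝ Y (h, s) (k, 0))
          (fderiv ℝ (fderiv ℝ Y) (h, t) (k, 0) (0, 1)) t :=
        (hasFDerivAt_fderiv_apply (hYat h hh t ht) (k, 0)).comp_hasDerivAt t hc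
      have h2 : HasFDerivAt (fun q : E × ℝ => fderiv ℝ Y q (0, 1))
          (fderiv ℝ (fderiv ℝ Y) (h, t) (0, 1)) (h, t) :=
        hasFDerivAt_fderiv_apply (hYat h hh t ht) (0, 1)
      have h3 : HasDerivAt (fun s : ℝ => fderiv ℝ Y (h + s • k, t) (0, 1))
          (fderiv ℝ (fderiv ℝ Y) (h, t) (0, 1) (k, 0)) 0 := by
        have hl : HasDerivAt (fun s : ℝ => ((h + s • k, t) : E × ℝ)) (k, 0) 0 := by
          simpa using ((((hasDerivAt_id (0 : ℝ)).smul_const k).const_add h).prodMk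
            (hasDerivAt_const (0 : ℝ) t))
        refine HasFDerivAt.comp_hasDerivAt (0 : ℝ) (l := fun q : E × ℝ => fderiv ℝ Y q (0, 1))
          (f := fun s : ℝ => ((h + s • k, t) : E × ℝ)) ?_ hl
        simpa using h2
      have hl' : HasDerivAt (fun s : ℝ => h + s • k) k 0 := by
        simpa using (((hasDerivAt_id (0 : ℝ)).smul_const k).const_add h)
      have hYk : HasDerivAt (fun s : ℝ => Y (h + s • k, t)) (fderiv ℝ Y (h, t) (k, 0)) 0 := by
        refine HasFDerivAt.comp_hasDerivAt (0 : ℝ) (f := fun s : ℝ => ((h + s • k, t) : E × ℝ)) ?_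
          (hl'.prodMk (hasDerivAt_const (0 : ℝ) t))
        simpa using ((hYat h hh t ht).differentiableAt (by simp)).hasFDerivAt
      have h4 : HasDerivAt (fun s : ℝ => θ (u₀ + t • (h + s • k), Y (h + s • k, t)) (h + s • k))
          (fderiv ℝ θ (u₀ + t • h, Y (h, t)) (t • k, fderiv ℝ Y (h, t) (k, 0)) h
            + θ (u₀ + t • h, Y (h, t)) k) 0 := by
        have h5 : HasDerivAt (fun s : ℝ => θ (u₀ + t • (h + s • k), Y (h + s • k, t)))
            (fderiv ℝ θ (u₀ + t • h, Y (h, t)) (t • k, fderiv ℝ Y (h, t) (k, 0))) 0 := by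
          refine HasFDerivAt.comp_hasDerivAt (0 : ℝ)
            (f := fun s : ℝ => ((u₀ + t • (h + s • k), Y (h + s • k, t)) : E × ℝ)) ?_
            (((hl'.const_smul t).const_add u₀).prodMk hYk)
          simpa using hθ'
        simpa using h5.clm_apply hl'
      have hev : ∀ᶠ s : ℝ in 𝓝 0, h + s • k ∈ Metric.ball (0 : E) δ :=
        hl'.continuousAt.eventually_mem (by simpa using Metric.isOpen_ball.mem_nhds hh)
      have h6 := (h3.congr_of_eventuallyEq (f₁ := fun s : ℝ =>
        θ (u₀ + t • (h + s • k), Y (h + s • k, t)) (h + s • k)) (by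
          filter_upwards [hev] with s hs
          exact (hYt _ hs t ht).symm)).unique h4
      have hYh := (hsol h hh |>.2 t ht).2
      have h7 : HasDerivAt (fun s : ℝ => θ (u₀ + s • h, Y (h, s)) k)
          (fderiv ℝ θ (u₀ + t • h, Y (h, t)) (h, θ (u₀ + t • h, Y (h, t)) h) k) t := by
        have hl2 : HasDerivAt (fun s : ℝ => u₀ + s • h) h t := by
          simpa using (((hasDerivAt_id t).smul_const h).const_add u₀)
        have h8 : HasDerivAt (fun s : ℝ => θ (u₀ + s • h, Y (h, s)))
            (fderiv ℝ θ (u₀ + t • h, Y (h, t)) (h, θ (u₀ + t • h, Y (h, t)) h)) t :=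
          HasFDerivAt.comp_hasDerivAt t
            (f := fun s : ℝ => ((u₀ + s • h, Y (h, s)) : E × ℝ)) hθ' (hl2.prodMk hYh)
        simpa using h8.clm_apply (hasDerivAt_const t k)
      have h9 := h1.sub ((hasDerivAt_id t).smul h7)
      refine h9.congr_deriv ?_
      rw [fderiv_fderiv_symm (hYat h hh t ht), h6,
        hcompat _ (hsol h hh |>.2 t ht).1 h k]
      have e1 : ((t • k, fderiv ℝ Y (h, t) (k, 0)) : E × ℝ) =
          t • (k, θ (u₀ + t • h, Y (h, t)) k) + z t • ((0, 1) : E × ℝ) := by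
        simp [hz]
      rw [e1, map_add, map_smul, map_smul]
      simp
    have hcontz : ContinuousOn z (Icc 0 T) := fun t ht =>
      (hz' t (hsub ht)).continuousAt.continuousWithinAt
    have hcK : ContinuousOn (fun t : ℝ => fderiv ℝ θ (u₀ + t • h, Y (h, t)) (0, 1) h)
        (Icc 0 T) := by
      intro t ht
      have h1 : ContinuousAt (fun s : ℝ => ((u₀ + s • h, Y (h, s)) : E × ℝ)) t :=
        ContinuousAt.prodMk (by fun_prop) (hsol h hh |>.2 t (hsub ht)).2.continuousAt
      have h2 : ContinuousAt (fderiv ℝ θ) (u₀ + t • h, Y (h, t)) :=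
        (contDiffAt_fderiv (hθd t (hsub ht))).continuousAt
      have h3 : ContinuousAt (fun s : ℝ => fderiv ℝ θ (u₀ + s • h, Y (h, s))) t :=
        ContinuousAt.comp (f := fun s : ℝ => ((u₀ + s • h, Y (h, s)) : E × ℝ)) h2 h1
      exact ((h3.clm_apply continuousAt_const).clm_apply continuousAt_const).continuousWithinAt
    obtain ⟨C, hC⟩ := isCompact_Icc.exists_bound_of_continuousOn hcK
    -- At `t = 0` the radial solution equals `ν₀` in every direction.
    have hz0 : z 0 = 0 := by
      have h0 : (0 : ℝ) ∈ Ioo (-ε) ε := ⟨by linarith, hε⟩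
      have h1 : HasFDerivAt (fun h' => Y (h', (0 : ℝ)))
          (fderiv ℝ Y (h, 0) ∘L .inl ℝ E ℝ) h :=
        ((hYat h hh 0 h0).differentiableAt (by simp)).hasFDerivAt.comp h
          (hasFDerivAt_prodMk_left h 0)
      have h2 : HasFDerivAt (fun h' => Y (h', (0 : ℝ))) (0 : E →L[ℝ] ℝ) h := by
        refine (hasFDerivAt_const ν₀ h).congr_of_eventuallyEq ?_
        filter_upwards [Metric.isOpen_ball.mem_nhds hh] with h' hh'
        exact (hsol h' hh').1
      have := congrArg (fun L : E →L[ℝ] ℝ => L k) (h1.unique h2)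
      simpa [hz] using this
    have := eq_zero_of_abs_deriv_le_mul_abs_self_of_eq_zero_right hcontz
      (fun t ht => (hz' t (hsub (Ico_subset_Icc_self ht))).hasDerivWithinAt) hz0 (K := C)
      (fun t ht => by
        rw [norm_mul, mul_comm]
        exact mul_le_mul_of_nonneg_right (hC t (Ico_subset_Icc_self ht)) (norm_nonneg _))
      T ⟨hT.1, le_rfl⟩
    exact sub_eq_zero.1 this
  -- The radial solution is known only for `|t| < ε`, so the point `u` is reached at the fixed time
  -- `τ` in the direction `τ⁻¹ • (u - u₀)`. The factors `τ` and `τ⁻¹` cancel in the derivative.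
  set τ := ε / 2 with hτ
  have hτ0 : 0 < τ := half_pos hε
  have hτm : τ ∈ Ioo (-ε) ε := ⟨by linarith, half_lt_self hε⟩
  have hball : ∀ u ∈ Metric.ball u₀ (τ * δ), τ⁻¹ • (u - u₀) ∈ Metric.ball (0 : E) δ := by
    intro u hu
    rw [mem_ball_zero_iff, norm_smul, norm_inv, Real.norm_of_nonneg hτ0.le, inv_mul_lt_iff₀ hτ0]
    simpa [dist_eq_norm] using hu
  refine ⟨τ * δ, mul_pos hτ0 hδ, fun u => Y (τ⁻¹ • (u - u₀), τ), ?_, ?_, fun u hu => ?_⟩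
  · exact hY.comp (by fun_prop) fun u hu => ⟨hball u hu, hτm⟩
  · have h0 := (hsol 0 (Metric.mem_ball_self hδ)).2
    have h1 : ∀ t ∈ Ioo (-ε) ε, Y (0, t) = Y (0, 0) := fun t ht =>
      isOpen_Ioo.is_const_of_deriv_eq_zero (convex_Ioo (-ε) ε).isPreconnected
        (f := fun t => Y (0, t))
        (fun r hr => (h0 r hr).2.differentiableAt.differentiableWithinAt)
        (fun r hr => by simpa using (h0 r hr).2.deriv) ht ⟨by linarith, hε⟩
    simp only [sub_self, smul_zero]
    rw [h1 τ hτm, (hsol 0 (Metric.mem_ball_self hδ)).1]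
  · have hu' : u₀ + τ • (τ⁻¹ • (u - u₀)) = u := by
      rw [smul_inv_smul₀ hτ0.ne', add_sub_cancel]
    have h1 := hsol _ (hball u hu) |>.2 τ hτm
    rw [hu'] at h1
    refine ⟨h1.1, ?_⟩
    have h2 : HasFDerivAt (fun u => τ⁻¹ • (u - u₀)) (τ⁻¹ • ContinuousLinearMap.id ℝ E) u :=
      ((hasFDerivAt_id u).sub_const u₀).const_smul τ⁻¹
    have h3 := HasFDerivAt.comp (f := fun u => ((τ⁻¹ • (u - u₀), τ) : E × ℝ)) u
      ((hYat _ (hball u hu) τ hτm).differentiableAt (by simp)).hasFDerivAt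
      (h2.prodMk (hasFDerivAt_const τ u))
    refine h3.congr_fderiv ?_
    ext k
    have h4 := key _ (hball u hu) (τ⁻¹ • k) τ ⟨hτ0.le, hτm.2⟩
    rw [hu', map_smul, smul_smul, mul_inv_cancel₀ hτ0.ne', one_smul] at h4
    simpa using h4

end Pfaff

/-! ### Riemannian geometry of hypersurfaces in a coordinate domain -/

section Coordinates

open Topology Filter

variable {E E' : Type*} [NormedAddCommGroup E] [NormedSpace ℝ E]
  [NormedAddCommGroup E'] [NormedSpace ℝ E']

/-- `g` is a smooth Riemannian metric on the open set `Ω`, with Christoffel symbols `Γ`. -/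
structure IsMetricOn (g : E → E →L[ℝ] E →L[ℝ] ℝ) (Γ : E → E →ₗ[ℝ] E →ₗ[ℝ] E) (Ω : Set E) :
    Prop where
  isOpen : IsOpen Ω
  smooth : ContDiffOn ℝ ∞ g Ω
  symm : ∀ x ∈ Ω, ∀ a b, g x a b = g x b a
  pos : ∀ x ∈ Ω, ∀ a, a ≠ 0 → 0 < g x a a
  koszul : ∀ x ∈ Ω, ∀ a b c, g x (Γ x a b) c =
    1 / 2 * (fderiv ℝ g x a b c + fderiv ℝ g x b a c - fderiv ℝ g x c a b)

namespace IsMetricOn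

variable {g : E → E →L[ℝ] E →L[ℝ] ℝ} {Γ : E → E →ₗ[ℝ] E →ₗ[ℝ] E} {Ω : Set E}

lemma differentiableAt (hg : IsMetricOn g Γ Ω) {x : E} (hx : x ∈ Ω) : DifferentiableAt ℝ g x :=
  (hg.smooth.contDiffAt (hg.isOpen.mem_nhds hx)).differentiableAt (by simp)

lemma fderiv_symm (hg : IsMetricOn g Γ Ω) {x : E} (hx : x ∈ Ω) (a b c : E) :
    fderiv ℝ g x a b c = fderiv ℝ g x a c b := by
  have h := (hg.differentiableAt hx).hasFDerivAt
  have h1 : ∀ b c, HasFDerivAt (fun y => g y b c)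
      (((fderiv ℝ g x).flip b).flip c) x := fun b c => by
    have h2 := (h.clm_apply (hasFDerivAt_const b x)).clm_apply (hasFDerivAt_const c x)
    refine h2.congr_fderiv ?_
    ext d
    simp
  have h2 := (h1 b c).unique ((h1 c b).congr_of_eventuallyEq (by
    filter_upwards [hg.isOpen.mem_nhds hx] with y hy
    exact hg.symm y hy b c))
  exact congrArg (fun L : E →L[ℝ] ℝ => L a) h2

/-- Nondegeneracy of the metric. It turns identities for `Γ`, which is known only through the Koszul
formula, into identities of vectors. -/
lemma eq_of_forall_apply_eq (hg : IsMetricOn g Γ Ω) {x : E} (hx : x ∈ Ω) {a b : E}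
    (h : ∀ c, g x a c = g x b c) : a = b := by
  by_contra hne
  have h1 := hg.pos x hx (a - b) (sub_ne_zero.2 hne)
  have h2 : g x (a - b) (a - b) = 0 := by
    rw [map_sub (g x) a b, sub_apply, h, sub_self]
  exact h1.ne' h2

lemma christoffel_symm (hg : IsMetricOn g Γ Ω) {x : E} (hx : x ∈ Ω) (a b : E) :
    Γ x a b = Γ x b a := by
  refine hg.eq_of_forall_apply_eq hx fun c => ?_
  rw [hg.koszul x hx, hg.koszul x hx, hg.fderiv_symm hx c a b]
  ring

/-- Parallelism of the metric: of the two Koszul expressions, the terms other than the derivative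
along `a` cancel. -/
lemma fderiv_apply (hg : IsMetricOn g Γ Ω) {x : E} (hx : x ∈ Ω) (a b c : E) :
    fderiv ℝ g x a b c = g x (Γ x a b) c + g x b (Γ x a c) := by
  rw [hg.symm x hx b, hg.koszul x hx, hg.koszul x hx, hg.fderiv_symm hx a b c,
    hg.fderiv_symm hx b a c, hg.fderiv_symm hx c a b]
  ring

/-- Compatibility of the covariant derivative with the metric, along a curve. -/
lemma hasDerivAt_apply (hg : IsMetricOn g Γ Ω) {c a b : ℝ → E} {c' a' b' : E} {t : ℝ}
    (hx : c t ∈ Ω) (hc : HasDerivAt c c' t) (ha : HasDerivAt a a' t) (hb : HasDerivAt b b' t) :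
    HasDerivAt (fun s => g (c s) (a s) (b s))
      (g (c t) (a' + Γ (c t) c' (a t)) (b t) + g (c t) (a t) (b' + Γ (c t) c' (b t))) t := by
  have h0 : HasDerivAt (fun s => g (c s)) (fderiv ℝ g (c t) c') t :=
    HasFDerivAt.comp_hasDerivAt (l := g) (f := c) (l' := fderiv ℝ g (c t)) t
      (hg.differentiableAt hx).hasFDerivAt hc
  have h1 := (h0.clm_apply ha).clm_apply hb
  refine HasDerivAt.congr_deriv h1 ?_
  simp only [add_apply, map_add]
  rw [hg.fderiv_apply hx]
  ring

end IsMetricOn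

lemma isLinearMap_koszul₁ (D : E →L[ℝ] E →L[ℝ] E →L[ℝ] ℝ) (b c : E) :
    IsLinearMap ℝ fun a => 1 / 2 * (D a b c + D b a c - D c a b) :=
  ⟨fun _ _ => by simp only [map_add, add_apply]; ring,
    fun _ _ => by simp only [map_smul, smul_apply, smul_eq_mul]; ring⟩

lemma isLinearMap_koszul₂ (D : E →L[ℝ] E →L[ℝ] E →L[ℝ] ℝ) (a c : E) :
    IsLinearMap ℝ fun b => 1 / 2 * (D a b c + D b a c - D c a b) :=
  ⟨fun _ _ => by simp only [map_add, add_apply]; ring,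
    fun _ _ => by simp only [map_smul, smul_apply, smul_eq_mul]; ring⟩

lemma isLinearMap_koszul₃ (D : E →L[ℝ] E →L[ℝ] E →L[ℝ] ℝ) (a b : E) :
    IsLinearMap ℝ fun c => 1 / 2 * (D a b c + D b a c - D c a b) :=
  ⟨fun _ _ => by simp only [map_add, add_apply]; ring,
    fun _ _ => by simp only [map_smul, smul_apply, smul_eq_mul]; ring⟩

lemma contDiffOn_smul_const_vec {f : E → ℝ} {s : Set E} (hf : ContDiffOn ℝ ∞ f s) (c : E') :
    ContDiffOn ℝ ∞ (fun x => f x • c) s :=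
  hf.smul contDiffOn_const

lemma hasDerivAt_line (u h : E) : HasDerivAt (fun s : ℝ => u + s • h) h 0 := by
  simpa using (((hasDerivAt_id (0 : ℝ)).smul_const h).const_add u)

lemma hasDerivAt_comp_line {f : E → E'} {f' : E →L[ℝ] E'} {u : E} (hf : HasFDerivAt f f' u)
    (h : E) : HasDerivAt (fun s : ℝ => f (u + s • h)) (f' h) 0 := by
  refine HasFDerivAt.comp_hasDerivAt (0 : ℝ) (l := f) (f := fun s : ℝ => u + s • h) ?_
    (hasDerivAt_line u h)
  simpa using hf

lemma eventually_line {u : E} {p : E → Prop} (hp : ∀ᶠ y in 𝓝 u, p y) (h : E) :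
    ∀ᶠ s : ℝ in 𝓝 0, p (u + s • h) := by
  have h1 := (hasDerivAt_line u h).continuousAt
  rw [ContinuousAt, zero_smul, add_zero] at h1
  exact h1.eventually hp

/-- The covariant derivative of the vector field `N` along the parametrized surface `ψ`. -/
def covDeriv (Γ : E → E →ₗ[ℝ] E →ₗ[ℝ] E) (ψ N : E' → E) (u h : E') : E :=
  fderiv ℝ N u h + Γ (ψ u) (fderiv ℝ ψ u h) (N u)

/-- The covariant Hessian of the parametrized surface `ψ`. -/
def covHess (Γ : E → E →ₗ[ℝ] E →ₗ[ℝ] E) (ψ : E' → E) (u h k : E') : E :=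
  fderiv ℝ (fderiv ℝ ψ) u h k + Γ (ψ u) (fderiv ℝ ψ u h) (fderiv ℝ ψ u k)

/-! ### Second fundamental form of a parametrized hypersurface -/

section Surface

variable {g : E → E →L[ℝ] E →L[ℝ] ℝ} {Γ : E → E →ₗ[ℝ] E →ₗ[ℝ] E} {Ω : Set E}
  {ψ N : E' → E} {u : E'}

/-- Second derivatives commute and the connection has no torsion. -/
lemma covHess_symm (hg : IsMetricOn g Γ Ω) (hx : ψ u ∈ Ω) (hψ : ContDiffAt ℝ ∞ ψ u) (h k : E') :
    covHess Γ ψ u h k = covHess Γ ψ u k h := by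
  rw [covHess, covHess, fderiv_fderiv_symm hψ, hg.christoffel_symm hx]

lemma metric_covDeriv_unit (hg : IsMetricOn g Γ Ω) (hx : ψ u ∈ Ω) (hψ : DifferentiableAt ℝ ψ u)
    (hN : DifferentiableAt ℝ N u) (h1 : ∀ᶠ y in 𝓝 u, g (ψ y) (N y) (N y) = 1) (h : E') :
    g (ψ u) (covDeriv Γ ψ N u h) (N u) = 0 := by
  have hd := hg.hasDerivAt_apply (c := fun s : ℝ => ψ (u + s • h)) (t := 0) (by simpa using hx)
    (hasDerivAt_comp_line hψ.hasFDerivAt h) (hasDerivAt_comp_line hN.hasFDerivAt h)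
    (hasDerivAt_comp_line hN.hasFDerivAt h)
  have h2 := hd.unique ((hasDerivAt_const (0 : ℝ) (1 : ℝ)).congr_of_eventuallyEq
    (eventually_line h1 h))
  simp only [zero_smul, add_zero] at h2
  rw [hg.symm _ hx (N u)] at h2
  simpa [covDeriv] using h2

/-- The Weingarten relation. -/
lemma metric_covDeriv_tangent (hg : IsMetricOn g Γ Ω) (hx : ψ u ∈ Ω) (hψ : ContDiffAt ℝ ∞ ψ u)
    (hN : DifferentiableAt ℝ N u) (k : E') (h1 : ∀ᶠ y in 𝓝 u, g (ψ y) (N y) (fderiv ℝ ψ y k) = 0)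
    (h : E') :
    g (ψ u) (covDeriv Γ ψ N u h) (fderiv ℝ ψ u k) = - g (ψ u) (N u) (covHess Γ ψ u h k) := by
  have hk := hasDerivAt_comp_line (hasFDerivAt_fderiv_apply hψ k) h
  rw [fderiv_fderiv_symm hψ] at hk
  have hd := hg.hasDerivAt_apply (c := fun s : ℝ => ψ (u + s • h)) (t := 0) (by simpa using hx)
    (hasDerivAt_comp_line (hψ.differentiableAt (by simp)).hasFDerivAt h)
    (hasDerivAt_comp_line hN.hasFDerivAt h) hk
  have h2 := hd.unique ((hasDerivAt_const (0 : ℝ) (0 : ℝ)).congr_of_eventuallyEq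
    (eventually_line h1 h))
  simp only [zero_smul, add_zero] at h2
  exact eq_neg_of_add_eq_zero_left h2

/-- The shape operator is self-adjoint, since by the Weingarten relation both sides are minus the
normal part of the symmetric covariant Hessian. -/
lemma metric_covDeriv_symm (hg : IsMetricOn g Γ Ω) (hx : ψ u ∈ Ω) (hψ : ContDiffAt ℝ ∞ ψ u)
    (hN : DifferentiableAt ℝ N u) (h1 : ∀ᶠ y in 𝓝 u, ∀ k, g (ψ y) (N y) (fderiv ℝ ψ y k) = 0)
    (h k : E') :
    g (ψ u) (covDeriv Γ ψ N u h) (fderiv ℝ ψ u k) =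
      g (ψ u) (covDeriv Γ ψ N u k) (fderiv ℝ ψ u h) := by
  rw [metric_covDeriv_tangent hg hx hψ hN k (h1.mono fun _ hy => hy k),
    metric_covDeriv_tangent hg hx hψ hN h (h1.mono fun _ hy => hy h), covHess_symm hg hx hψ]

end Surface

/-! ### The compatibility condition -/

/-- The velocity gradient of the force. -/
def velGradMap (F : E × E → E) (x v a : E) : E := fderiv ℝ F (x, v) (0, a)

/-- The spatial gradient of the force. -/
def spGradMap (Γ : E → E →ₗ[ℝ] E →ₗ[ℝ] E) (F : E × E → E) (x v a : E) : E :=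
  fderiv ℝ F (x, v) (a, 0) + Γ x a (F (x, v)) - fderiv ℝ F (x, v) (0, Γ x a v)

/-- The bilinear form whose restriction to the orthogonal complement of `v` is symmetric
according to the first normality equation. -/
def symmForm (g : E → E →L[ℝ] E →L[ℝ] ℝ) (Γ : E → E →ₗ[ℝ] E →ₗ[ℝ] E) (F : E × E → E)
    (x v a b : E) : ℝ :=
  g x a (F (x, v)) * g x b (velGradMap F x v v) / g x v v - g x b (spGradMap Γ F x v a)

/-- The right hand side `θ` of the Pfaff equation `dν = θ(u, ν)` for the initial speed. -/
def pfaffForm (g : E → E →L[ℝ] E →L[ℝ] ℝ) (F : E × E → E) (ψ N : E' → E) (q : E' × ℝ) :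
    E' →L[ℝ] ℝ :=
  (-q.2⁻¹) • ((g (ψ q.1) (F (ψ q.1, q.2 • N q.1))) ∘L fderiv ℝ ψ q.1)

lemma pfaffForm_apply (g : E → E →L[ℝ] E →L[ℝ] ℝ) (F : E × E → E) (ψ N : E' → E) (q : E' × ℝ)
    (k : E') : pfaffForm g F ψ N q k =
      -q.2⁻¹ * g (ψ q.1) (F (ψ q.1, q.2 • N q.1)) (fderiv ℝ ψ q.1 k) := rfl

section Compat

variable {g : E → E →L[ℝ] E →L[ℝ] ℝ} {Γ : E → E →ₗ[ℝ] E →ₗ[ℝ] E} {Ω : Set E}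
  {F : E × E → E} {ψ N : E' → E} {u : E'} {ν : ℝ}

lemma contDiffAt_pfaffForm (hg : IsMetricOn g Γ Ω) (hx : ψ u ∈ Ω) (hψ : ContDiffAt ℝ ∞ ψ u)
    (hN : ContDiffAt ℝ ∞ N u) (hν : ν ≠ 0) (hF : ContDiffAt ℝ ∞ F (ψ u, ν • N u)) :
    ContDiffAt ℝ ∞ (pfaffForm g F ψ N) (u, ν) := by
  have hψ' : ContDiffAt ℝ ∞ (fun q : E' × ℝ => ψ q.1) (u, ν) := hψ.comp (u, ν) contDiffAt_fst
  have hN' : ContDiffAt ℝ ∞ (fun q : E' × ℝ => N q.1) (u, ν) := hN.comp (u, ν) contDiffAt_fst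
  have hD : ContDiffAt ℝ ∞ (fun q : E' × ℝ => fderiv ℝ ψ q.1) (u, ν) :=
    (contDiffAt_fderiv hψ).comp (u, ν) contDiffAt_fst
  have hF' : ContDiffAt ℝ ∞ (fun q : E' × ℝ => F (ψ q.1, q.2 • N q.1)) (u, ν) :=
    ContDiffAt.comp (u, ν) (f := fun q : E' × ℝ => (ψ q.1, q.2 • N q.1)) hF
      (hψ'.prodMk (contDiffAt_snd.smul hN'))
  have hg' : ContDiffAt ℝ ∞ (fun q : E' × ℝ => g (ψ q.1)) (u, ν) :=
    ContDiffAt.comp (u, ν) (f := fun q : E' × ℝ => ψ q.1)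
      (hg.smooth.contDiffAt (hg.isOpen.mem_nhds hx)) hψ'
  exact (contDiffAt_snd.inv hν).neg.smul ((hg'.clm_apply hF').clm_comp hD)

/-- The derivative of the Pfaff form along its own graph. -/
lemma fderiv_pfaffForm (hg : IsMetricOn g Γ Ω) (hx : ψ u ∈ Ω) (hψ : ContDiffAt ℝ ∞ ψ u)
    (hN : ContDiffAt ℝ ∞ N u) (hν : ν ≠ 0) (hF : ContDiffAt ℝ ∞ F (ψ u, ν • N u))
    (hN1 : g (ψ u) (N u) (N u) = 1) (h k : E') :
    fderiv ℝ (pfaffForm g F ψ N) (u, ν) (h, pfaffForm g F ψ N (u, ν) h) k =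
      -ν⁻¹ * g (ψ u) (covHess Γ ψ u h k) (F (ψ u, ν • N u))
      - ν⁻¹ ^ 3 * (g (ψ u) (fderiv ℝ ψ u h) (F (ψ u, ν • N u))
          * g (ψ u) (fderiv ℝ ψ u k) (F (ψ u, ν • N u)))
      + ν⁻¹ * symmForm g Γ F (ψ u) (ν • N u) (fderiv ℝ ψ u h) (fderiv ℝ ψ u k)
      - g (ψ u) (fderiv ℝ ψ u k) (velGradMap F (ψ u) (ν • N u) (covDeriv Γ ψ N u h)) := by
  set r := pfaffForm g F ψ N (u, ν) h with hr
  have hθ := ((contDiffAt_pfaffForm hg hx hψ hN hν hF).differentiableAt (by simp)).hasFDerivAt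
  have hl : HasDerivAt (fun s : ℝ => ν + s * r) r 0 := by
    simpa using ((hasDerivAt_id (0 : ℝ)).mul_const r).const_add ν
  have h1 : HasDerivAt (fun s : ℝ => pfaffForm g F ψ N (u + s • h, ν + s * r) k)
      (fderiv ℝ (pfaffForm g F ψ N) (u, ν) (h, r) k) 0 := by
    have := HasFDerivAt.comp_hasDerivAt (0 : ℝ)
      (f := fun s : ℝ => ((u + s • h, ν + s * r) : E' × ℝ)) (by simpa using hθ)
      ((hasDerivAt_line u h).prodMk hl)
    simpa using this.clm_apply (hasDerivAt_const (0 : ℝ) k)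
  have hψl := hasDerivAt_comp_line (hψ.differentiableAt (by simp)).hasFDerivAt h
  have hNl := hasDerivAt_comp_line (hN.differentiableAt (by simp)).hasFDerivAt h
  have hFl : HasDerivAt (fun s : ℝ => F (ψ (u + s • h), (ν + s * r) • N (u + s • h)))
      (fderiv ℝ F (ψ u, ν • N u) (fderiv ℝ ψ u h, ν • fderiv ℝ N u h + r • N u)) 0 := by
    have h2 := hl.fun_smul hNl
    simp only [zero_smul, add_zero, zero_mul] at h2
    exact HasFDerivAt.comp_hasDerivAt (0 : ℝ)
      (f := fun s : ℝ => (ψ (u + s • h), (ν + s * r) • N (u + s • h)))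
      (by simpa using (hF.differentiableAt (by simp)).hasFDerivAt) (hψl.prodMk h2)
  have hk := hasDerivAt_comp_line (hasFDerivAt_fderiv_apply hψ k) h
  rw [fderiv_fderiv_symm hψ] at hk
  have h3 := hg.hasDerivAt_apply (c := fun s : ℝ => ψ (u + s • h)) (t := 0) (by simpa using hx)
    hψl hFl hk
  have h4 := ((hl.fun_inv (by simpa using hν)).fun_neg.fun_mul h3)
  have h5 := h1.unique h4
  rw [h5]
  simp only [zero_smul, add_zero, zero_mul]
  -- Along the surface `v = νN` varies by `ν dN + r N`. Replacing `dN` by the covariant derivative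
  -- produces the Christoffel correction in the spatial gradient, and `r N = (r / ν) v` gives the
  -- term with the velocity gradient along `v`.
  have hdec : fderiv ℝ F (ψ u, ν • N u) (fderiv ℝ ψ u h, ν • fderiv ℝ N u h + r • N u)
      + Γ (ψ u) (fderiv ℝ ψ u h) (F (ψ u, ν • N u)) =
      spGradMap Γ F (ψ u) (ν • N u) (fderiv ℝ ψ u h)
        + ν • velGradMap F (ψ u) (ν • N u) (covDeriv Γ ψ N u h)
        + (r * ν⁻¹) • velGradMap F (ψ u) (ν • N u) (ν • N u) := by
    have e1 : ((fderiv ℝ ψ u h, ν • fderiv ℝ N u h + r • N u) : E × E) =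
        (fderiv ℝ ψ u h, 0) + ν • ((0, covDeriv Γ ψ N u h) : E × E)
          - (0, Γ (ψ u) (fderiv ℝ ψ u h) (ν • N u)) + (r * ν⁻¹) • ((0, ν • N u) : E × E) := by
      ext
      · simp
      · simp [covDeriv, smul_smul, hν]
    rw [e1, map_add, map_sub, map_add, (fderiv ℝ F (ψ u, ν • N u)).map_smul ν,
      (fderiv ℝ F (ψ u, ν • N u)).map_smul (r * ν⁻¹), spGradMap, velGradMap, velGradMap]
    abel
  have hrr : r = -ν⁻¹ * g (ψ u) (fderiv ℝ ψ u h) (F (ψ u, ν • N u)) := by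
    rw [hg.symm _ hx]; rfl
  rw [hdec, hg.symm _ hx _ (fderiv ℝ ψ u k), hg.symm _ hx _ (fderiv ℝ ψ u k),
    hg.symm _ hx (F (ψ u, ν • N u)) (_ + _)]
  simp only [map_add, map_smul, smul_eq_mul, symmForm, covHess, add_apply, smul_apply, hN1, hrr]
  field_simp
  ring

end Compat

end Coordinates

/-! ### The metric, the connection and the force field in a chart -/

section Chart

open Topology Filter Bundle

variable {n : ℕ} {M : Type*} [TopologicalSpace M] [ChartedSpace (Coord n) M]
  [IsManifold (𝓡 n) ∞ M] {φ : OpenPartialHomeomorph M (Coord n)}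

lemma mdifferentiable_chart (hφ : φ ∈ IsManifold.maximalAtlas (𝓡 n) ∞ M) :
    φ.MDifferentiable (𝓡 n) (𝓡 n) :=
  ⟨(contMDiffOn_of_mem_maximalAtlas hφ).mdifferentiableOn (by simp),
    (contMDiffOn_symm_of_mem_maximalAtlas hφ).mdifferentiableOn (by simp)⟩

lemma compOf_vecOf (hφ : φ ∈ IsManifold.maximalAtlas (𝓡 n) ∞ M) {x : Coord n} (hx : x ∈ φ.target)
    (w : Coord n) : compOf φ (φ.symm x) (vecOf φ x w) = w :=
  congrArg (fun L => L w) ((mdifferentiable_chart hφ).comp_symm_deriv hx)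

lemma vecOf_compOf (hφ : φ ∈ IsManifold.maximalAtlas (𝓡 n) ∞ M) {x : Coord n} (hx : x ∈ φ.target)
    (w : TangentSpace (𝓡 n) (φ.symm x)) : vecOf φ x (compOf φ (φ.symm x) w) = w := by
  have h := (mdifferentiable_chart hφ).symm_comp_deriv (φ.map_target hx)
  rw [φ.right_inv hx] at h
  exact congrArg (fun L => L w) h

lemma vecOf_ne_zero (hφ : φ ∈ IsManifold.maximalAtlas (𝓡 n) ∞ M) {x : Coord n} (hx : x ∈ φ.target)
    {w : Coord n} (hw : w ≠ 0) : vecOf φ x w ≠ 0 := by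
  intro h
  apply hw
  rw [← compOf_vecOf hφ hx w, h]
  exact map_zero (mfderiv (𝓡 n) (𝓡 n) φ (φ.symm x))

lemma contMDiffOn_vecOf (hφ : φ ∈ IsManifold.maximalAtlas (𝓡 n) ∞ M) :
    ContMDiffOn 𝓘(ℝ, Coord n × Coord n) (𝓡 n).tangent ∞
      (fun q : Coord n × Coord n => (⟨φ.symm q.1, vecOf φ q.1 q.2⟩ : TangentBundle (𝓡 n) M))
      (φ.target ×ˢ univ) := by
  have h1 := (contMDiffOn_symm_of_mem_maximalAtlas hφ).contMDiffOn_tangentMapWithin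
    (m := ∞) (by simp) (φ.open_target.uniqueMDiffOn (I := 𝓡 n))
  have h2 : ContMDiff 𝓘(ℝ, Coord n × Coord n) (𝓡 n).tangent ∞
      (fun q : Coord n × Coord n => (⟨q.1, q.2⟩ : TangentBundle (𝓡 n) (Coord n))) := by
    have h3 := contMDiff_tangentBundleModelSpaceHomeomorph_symm (I := 𝓡 n) (n := ∞)
    rw [modelWithCornersSelf_prod]
    convert! h3
  refine (h1.comp h2.contMDiffOn (fun q hq => hq.1)).congr fun q hq => ?_
  simp only [Function.comp, tangentMapWithin, vecOf]
  rw [mfderivWithin_of_isOpen φ.open_target hq.1]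

lemma contMDiffOn_compOf (hφ : φ ∈ IsManifold.maximalAtlas (𝓡 n) ∞ M) :
    ContMDiffOn (𝓡 n).tangent 𝓘(ℝ, Coord n) ∞
      (fun q : TangentBundle (𝓡 n) M => compOf φ q.1 q.2) {q | q.1 ∈ φ.source} := by
  have h1 := (contMDiffOn_of_mem_maximalAtlas hφ).contMDiffOn_tangentMapWithin
    (m := ∞) (by simp) (φ.open_source.uniqueMDiffOn (I := 𝓡 n))
  refine ((contMDiff_snd_tangentBundle_modelSpace (Coord n) (𝓡 n)).comp_contMDiffOn h1).congr
    fun q hq => ?_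
  simp only [Function.comp, tangentMapWithin, compOf]
  rw [mfderivWithin_of_isOpen φ.open_source hq]

lemma contDiffOn_gLow (g : RiemMetric n M) (hφ : φ ∈ IsManifold.maximalAtlas (𝓡 n) ∞ M)
    (i j : Fin n) : ContDiffOn ℝ ∞ (fun x => gLow g φ x i j) φ.target := by
  have hv : ∀ w : Coord n, ContMDiffOn (𝓡 n) (𝓡 n).tangent ∞
      (fun x => (⟨φ.symm x, vecOf φ x w⟩ : TangentBundle (𝓡 n) M)) φ.target := fun w =>
    (contMDiffOn_vecOf hφ).comp (g := fun q : Coord n × Coord n =>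
      (⟨φ.symm q.1, vecOf φ q.1 q.2⟩ : TangentBundle (𝓡 n) M)) (f := fun x => (x, w))
      (contMDiffOn_iff_contDiffOn.2 (by fun_prop)) fun x hx => ⟨hx, mem_univ _⟩
  intro x hx
  have h : ContMDiffWithinAt (𝓡 n) ((𝓡 n).prod 𝓘(ℝ)) ∞
      (fun x => TotalSpace.mk' ℝ (E := Bundle.Trivial M ℝ) (φ.symm x) (gLow g φ x i j))
      φ.target x := by
    apply ContMDiffWithinAt.clm_bundle_apply₂ (F₁ := Coord n) (F₂ := Coord n)
      (E₁ := fun p : M => TangentSpace (𝓡 n) p) (E₂ := fun p : M => TangentSpace (𝓡 n) p)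
    · exact g.contMDiff.contMDiffAt.comp_contMDiffWithinAt x
        (contMDiffOn_symm_of_mem_maximalAtlas hφ x hx)
    · exact hv _ x hx
    · exact hv _ x hx
  simp only [contMDiffWithinAt_totalSpace] at h
  exact contMDiffWithinAt_iff_contDiffWithinAt.1 h.2

lemma Coord.sum_smul_single (a : Coord n) :
    ∑ i, a i • (EuclideanSpace.single i 1 : Coord n) = a := by
  ext j
  simp [Finset.sum_apply, Pi.single_apply]

/-- The passage from index identities to identities for all vectors, used once for each argument of
a multilinear expression. -/
lemma Coord.eq_of_isLinearMap {f₁ f₂ : Coord n → ℝ} (h₁ : IsLinearMap ℝ f₁)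
    (h₂ : IsLinearMap ℝ f₂)
    (h : ∀ i, f₁ (EuclideanSpace.single i 1) = f₂ (EuclideanSpace.single i 1)) (a : Coord n) :
    f₁ a = f₂ a := by
  have e : ∀ {f : Coord n → ℝ} (_ : IsLinearMap ℝ f),
      f a = ∑ i, a i * f (EuclideanSpace.single i 1) := by
    intro f hf
    conv_lhs => rw [← Coord.sum_smul_single a]
    rw [← IsLinearMap.mk'_apply hf, map_sum]
    simp
  rw [e h₁, e h₂]
  simp [h]

/-- The metric in a chart. -/
def chartMetric (g : RiemMetric n M) (φ : OpenPartialHomeomorph M (Coord n)) (x : Coord n) :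
    Coord n →L[ℝ] Coord n →L[ℝ] ℝ :=
  ∑ i, ∑ j, gLow g φ x i j • ((EuclideanSpace.proj i : Coord n →L[ℝ] ℝ).smulRight
    (EuclideanSpace.proj j : Coord n →L[ℝ] ℝ))

lemma chartMetric_apply (g : RiemMetric n M) (φ : OpenPartialHomeomorph M (Coord n))
    (x a b : Coord n) : chartMetric g φ x a b = ∑ i, ∑ j, gLow g φ x i j * a i * b j := by
  simp [chartMetric, mul_assoc]

lemma chartMetric_single (g : RiemMetric n M) (φ : OpenPartialHomeomorph M (Coord n))
    (x : Coord n) (i j : Fin n) :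
    chartMetric g φ x (EuclideanSpace.single i 1) (EuclideanSpace.single j 1) =
      gLow g φ x i j := by
  simp [chartMetric_apply]

lemma inner_vecOf (g : RiemMetric n M) (φ : OpenPartialHomeomorph M (Coord n))
    (x a b : Coord n) :
    g.inner (φ.symm x) (vecOf φ x a) (vecOf φ x b) = chartMetric g φ x a b := by
  have h : ∀ a b c : Coord n, vecOf φ x (a + b) = vecOf φ x a + vecOf φ x b := fun a b _ =>
    map_add (mfderiv (𝓡 n) (𝓡 n) φ.symm x) a b
  have h' : ∀ (c : ℝ) (a : Coord n), vecOf φ x (c • a) = c • vecOf φ x a := fun c a =>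
    map_smul (mfderiv (𝓡 n) (𝓡 n) φ.symm x) c a
  refine Coord.eq_of_isLinearMap (f₁ := fun a => g.inner (φ.symm x) (vecOf φ x a) (vecOf φ x b))
    (f₂ := fun a => chartMetric g φ x a b)
    ⟨fun a c => by simp [h a c 0], fun c a => by simp [h']⟩
    ⟨fun a c => by simp, fun c a => by simp⟩ (fun i => ?_) a
  refine Coord.eq_of_isLinearMap
    (f₁ := fun b => g.inner (φ.symm x) (vecOf φ x (EuclideanSpace.single i 1)) (vecOf φ x b))
    (f₂ := fun b => chartMetric g φ x (EuclideanSpace.single i 1) b)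
    ⟨fun a c => by simp [h a c 0], fun c a => by simp [h']⟩
    ⟨fun a c => by simp, fun c a => by simp⟩ (fun j => ?_) b
  simp only [chartMetric_single, gLow]

lemma inner_eq_chartMetric (g : RiemMetric n M) (hφ : φ ∈ IsManifold.maximalAtlas (𝓡 n) ∞ M)
    {p : M} (hp : p ∈ φ.source) (a b : TangentSpace (𝓡 n) p) :
    g.inner p a b = chartMetric g φ (φ p) (compOf φ p a) (compOf φ p b) := by
  obtain ⟨x, hx, rfl⟩ : ∃ x ∈ φ.target, p = φ.symm x :=
    ⟨φ p, φ.map_source hp, (φ.left_inv hp).symm⟩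
  rw [φ.right_inv hx, ← inner_vecOf, vecOf_compOf hφ hx, vecOf_compOf hφ hx]

/-- The Christoffel symbols in a chart, as a bilinear map. -/
def chartGamma (g : RiemMetric n M) (φ : OpenPartialHomeomorph M (Coord n)) (x : Coord n) :
    Coord n →ₗ[ℝ] Coord n →ₗ[ℝ] Coord n :=
  LinearMap.mk₂ ℝ (fun a b => WithLp.toLp 2 fun k => ∑ i, ∑ j, Gam g φ x k i j * a i * b j)
    (fun a a' b => by ext k; simp [mul_add, add_mul, Finset.sum_add_distrib])
    (fun c a b => by
      ext k
      simp only [PiLp.smul_apply, smul_eq_mul, Finset.mul_sum]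
      refine Finset.sum_congr rfl fun i _ => Finset.sum_congr rfl fun j _ => by ring)
    (fun a b b' => by ext k; simp [mul_add, Finset.sum_add_distrib])
    (fun c a b => by
      ext k
      simp only [PiLp.smul_apply, smul_eq_mul, Finset.mul_sum]
      refine Finset.sum_congr rfl fun i _ => Finset.sum_congr rfl fun j _ => by ring)

lemma chartGamma_apply (g : RiemMetric n M) (φ : OpenPartialHomeomorph M (Coord n))
    (x a b : Coord n) (k : Fin n) :
    chartGamma g φ x a b k = ∑ i, ∑ j, Gam g φ x k i j * a i * b j := rfl

/-- The force field in a chart. -/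
def chartForce (F : ForceField n M) (φ : OpenPartialHomeomorph M (Coord n))
    (q : Coord n × Coord n) : Coord n :=
  compOf φ (φ.symm q.1) (F (φ.symm q.1) (vecOf φ q.1 q.2))

lemma contDiffOn_chartMetric (g : RiemMetric n M)
    (hφ : φ ∈ IsManifold.maximalAtlas (𝓡 n) ∞ M) :
    ContDiffOn ℝ ∞ (chartMetric g φ) φ.target :=
  ContDiffOn.sum fun i _ => ContDiffOn.sum fun j _ =>
    contDiffOn_smul_const_vec (contDiffOn_gLow g hφ i j) _

lemma chartMetric_symm (g : RiemMetric n M) (φ : OpenPartialHomeomorph M (Coord n))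
    (x a b : Coord n) : chartMetric g φ x a b = chartMetric g φ x b a := by
  rw [← inner_vecOf, ← inner_vecOf, g.symm]

lemma gLow_symm (g : RiemMetric n M) (φ : OpenPartialHomeomorph M (Coord n)) (x : Coord n)
    (i j : Fin n) : gLow g φ x i j = gLow g φ x j i :=
  g.symm _ _ _

lemma chartMetric_pos (g : RiemMetric n M) (hφ : φ ∈ IsManifold.maximalAtlas (𝓡 n) ∞ M)
    {x : Coord n} (hx : x ∈ φ.target) {a : Coord n} (ha : a ≠ 0) :
    0 < chartMetric g φ x a a := by
  rw [← inner_vecOf]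
  exact g.pos _ _ (vecOf_ne_zero hφ hx ha)

/-- Positive definiteness excludes a null vector of the Gram matrix, so the formal inverse in `gUp`
is a genuine one. -/
lemma sum_gUp_mul_gLow (g : RiemMetric n M) (hφ : φ ∈ IsManifold.maximalAtlas (𝓡 n) ∞ M)
    {x : Coord n} (hx : x ∈ φ.target) :
    Matrix.of (gLow g φ x) * Matrix.of (gUp g φ x) = 1 := by
  have hdet : (Matrix.of (gLow g φ x)).det ≠ 0 := by
    intro h
    obtain ⟨v, hv, h0⟩ := Matrix.exists_mulVec_eq_zero_iff.2 h
    have hpos := chartMetric_pos g hφ hx (a := WithLp.toLp 2 v) (by simpa using hv)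
    rw [chartMetric_apply] at hpos
    refine hpos.ne' (Finset.sum_eq_zero fun i _ => ?_)
    have := congrFun h0 i
    simp only [Matrix.mulVec, dotProduct, Matrix.of_apply, Pi.zero_apply] at this
    calc ∑ j, gLow g φ x i j * v i * v j = v i * ∑ j, gLow g φ x i j * v j := by
          rw [Finset.mul_sum]
          exact Finset.sum_congr rfl fun j _ => by ring
      _ = 0 := by rw [this, mul_zero]
  exact Matrix.mul_nonsing_inv _ (isUnit_iff_ne_zero.2 hdet)

lemma fderiv_chartMetric_single (g : RiemMetric n M)
    (hφ : φ ∈ IsManifold.maximalAtlas (𝓡 n) ∞ M) {x : Coord n} (hx : x ∈ φ.target)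
    (i j k : Fin n) :
    fderiv ℝ (chartMetric g φ) x (EuclideanSpace.single i 1) (EuclideanSpace.single j 1)
      (EuclideanSpace.single k 1) = pd (fun y => gLow g φ y j k) i x := by
  have hd := (((contDiffOn_chartMetric g hφ).contDiffAt
    (φ.open_target.mem_nhds hx)).differentiableAt (by simp)).hasFDerivAt
  have h1 := (hd.clm_apply (hasFDerivAt_const (EuclideanSpace.single j 1) x)).clm_apply
    (hasFDerivAt_const (EuclideanSpace.single k 1) x)
  simp only [chartMetric_single] at h1
  rw [pd, h1.fderiv]
  simp

lemma sum_gLow_mul_Gam (g : RiemMetric n M)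
    (hφ : φ ∈ IsManifold.maximalAtlas (𝓡 n) ∞ M) {x : Coord n} (hx : x ∈ φ.target)
    (i j k : Fin n) :
    ∑ l, gLow g φ x k l * Gam g φ x l i j = 1 / 2 * (pd (fun y => gLow g φ y k j) i x
      + pd (fun y => gLow g φ y i k) j x - pd (fun y => gLow g φ y i j) k x) := by
  have h := sum_gUp_mul_gLow g hφ hx
  have h1 : ∀ s, ∑ l, gLow g φ x k l * gUp g φ x l s = if k = s then 1 else 0 := by
    intro s
    have := congrFun (congrFun h k) s
    simpa [Matrix.mul_apply, Matrix.one_apply] using this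
  simp only [Gam]
  set T : Fin n → ℝ := fun s => pd (fun y => gLow g φ y s j) i x
      + pd (fun y => gLow g φ y i s) j x - pd (fun y => gLow g φ y i j) s x with hT
  calc ∑ l, gLow g φ x k l * (1 / 2 * ∑ s, gUp g φ x l s * T s)
      = 1 / 2 * ∑ s, (∑ l, gLow g φ x k l * gUp g φ x l s) * T s := by
        simp only [Finset.mul_sum, Finset.sum_mul]
        rw [Finset.sum_comm]
        exact Finset.sum_congr rfl fun s _ => Finset.sum_congr rfl fun l _ => by ring
    _ = 1 / 2 * T k := by simp [h1]

/-- All invariant computations are made for `IsMetricOn`; this brings them to the coordinate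
formulas. The Koszul identity is trilinear, so basis vectors suffice, and there it is the definition
of the Christoffel symbols with the index lowered. -/
theorem isMetricOn_chart (g : RiemMetric n M) (hφ : φ ∈ IsManifold.maximalAtlas (𝓡 n) ∞ M) :
    IsMetricOn (chartMetric g φ) (chartGamma g φ) φ.target where
  isOpen := φ.open_target
  smooth := contDiffOn_chartMetric g hφ
  symm x _ := chartMetric_symm g φ x
  pos x hx a := chartMetric_pos g hφ hx
  koszul x hx a b c := by
    refine Coord.eq_of_isLinearMap (f₁ := fun a => chartMetric g φ x (chartGamma g φ x a b) c)
      (f₂ := fun a => 1 / 2 * (fderiv ℝ (chartMetric g φ) x a b c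
        + fderiv ℝ (chartMetric g φ) x b a c - fderiv ℝ (chartMetric g φ) x c a b))
      ⟨fun _ _ => by simp, fun _ _ => by simp⟩
      (isLinearMap_koszul₁ (fderiv ℝ (chartMetric g φ) x) _ _) (fun i => ?_) a
    refine Coord.eq_of_isLinearMap
      (f₁ := fun b => chartMetric g φ x (chartGamma g φ x (EuclideanSpace.single i 1) b) c)
      (f₂ := fun b => 1 / 2 * (fderiv ℝ (chartMetric g φ) x (EuclideanSpace.single i 1) b c
        + fderiv ℝ (chartMetric g φ) x b (EuclideanSpace.single i 1) c
        - fderiv ℝ (chartMetric g φ) x c (EuclideanSpace.single i 1) b))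
      ⟨fun _ _ => by simp, fun _ _ => by simp⟩
      (isLinearMap_koszul₂ (fderiv ℝ (chartMetric g φ) x) _ _) (fun j => ?_) b
    refine Coord.eq_of_isLinearMap
      (f₁ := fun c => chartMetric g φ x (chartGamma g φ x (EuclideanSpace.single i 1)
        (EuclideanSpace.single j 1)) c)
      (f₂ := fun c => 1 / 2 * (fderiv ℝ (chartMetric g φ) x (EuclideanSpace.single i 1)
          (EuclideanSpace.single j 1) c
        + fderiv ℝ (chartMetric g φ) x (EuclideanSpace.single j 1) (EuclideanSpace.single i 1) c
        - fderiv ℝ (chartMetric g φ) x c (EuclideanSpace.single i 1) (EuclideanSpace.single j 1)))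
      ⟨fun _ _ => by simp, fun _ _ => by simp⟩
      (isLinearMap_koszul₃ (fderiv ℝ (chartMetric g φ) x) _ _) (fun k => ?_) c
    simp only [fderiv_chartMetric_single g hφ hx]
    have hs : ∀ a b : Fin n, (fun y => gLow g φ y a b) = fun y => gLow g φ y b a := fun a b =>
      funext fun y => gLow_symm g φ y a b
    rw [hs j k, ← sum_gLow_mul_Gam g hφ hx i j k, chartMetric_symm, chartMetric_apply]
    simp [chartGamma_apply]

lemma chartForce_apply (F : ForceField n M) (φ : OpenPartialHomeomorph M (Coord n))
    (x v : Coord n) (k : Fin n) : chartForce F φ (x, v) k = FUp F φ x v k := rfl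

lemma contDiffOn_chartForce {F : ForceField n M} (hF : SmoothForce F)
    (hφ : φ ∈ IsManifold.maximalAtlas (𝓡 n) ∞ M) :
    ContDiffOn ℝ ∞ (chartForce F φ) (φ.target ×ˢ {v | v ≠ 0}) := by
  have h1 := (contMDiffOn_vecOf hφ).mono (prod_mono_right (subset_univ {v : Coord n | v ≠ 0}))
  have h2 := ContMDiffOn.comp (t := {q : TangentBundle (𝓡 n) M | q.2 ≠ 0}) hF h1
    (fun q hq => vecOf_ne_zero hφ hq.1 hq.2)
  have h3 := (contMDiffOn_compOf hφ).comp h2 (fun q hq => φ.map_target hq.1)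
  exact contMDiffOn_iff_contDiffOn.1 h3

lemma compOf_force (F : ForceField n M) (hφ : φ ∈ IsManifold.maximalAtlas (𝓡 n) ∞ M) {p : M}
    (hp : p ∈ φ.source) (v : TangentSpace (𝓡 n) p) :
    compOf φ p (F p v) = chartForce F φ (φ p, compOf φ p v) := by
  obtain ⟨x, hx, rfl⟩ : ∃ x ∈ φ.target, p = φ.symm x :=
    ⟨φ p, φ.map_source hp, (φ.left_inv hp).symm⟩
  rw [φ.right_inv hx, chartForce, vecOf_compOf hφ hx]

end Chart

/-! ### Invariant form of the normality equations -/

section Equations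

open Topology Filter Bundle

variable {n : ℕ} {M : Type*} [TopologicalSpace M] [ChartedSpace (Coord n) M]
  [IsManifold (𝓡 n) ∞ M] {φ : OpenPartialHomeomorph M (Coord n)}

lemma Coord.sum_mul_single {L : Coord n → ℝ} (hL : IsLinearMap ℝ L) (a : Coord n) :
    ∑ i, a i * L (EuclideanSpace.single i 1) = L a := by
  conv_rhs => rw [← Coord.sum_smul_single a]
  rw [← IsLinearMap.mk'_apply hL, map_sum]
  simp

/-- The first normality equation at `(x, v)`, as a condition on vectors perpendicular to `v`. -/
def SymmCondition {E : Type*} [NormedAddCommGroup E] [NormedSpace ℝ E]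
    (g : E → E →L[ℝ] E →L[ℝ] ℝ) (Γ : E → E →ₗ[ℝ] E →ₗ[ℝ] E) (F : E × E → E) (x v : E) : Prop :=
  ∀ a b, g x a v = 0 → g x b v = 0 → symmForm g Γ F x v a b = symmForm g Γ F x v b a

/-- The second normality equation at `(x, v)`, as a condition on vectors perpendicular to `v`. -/
def ScalarCondition {E : Type*} [NormedAddCommGroup E] [NormedSpace ℝ E]
    (g : E → E →L[ℝ] E →L[ℝ] ℝ) (F : E × E → E) (x v : E) : Prop :=
  ∃ c : ℝ, ∀ a b, g x a v = 0 → g x b v = 0 → g x b (velGradMap F x v a) = c * g x b a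

/-- The projection onto the orthogonal complement of `v`. -/
def perpMap {E : Type*} [NormedAddCommGroup E] [NormedSpace ℝ E]
    (G : E →L[ℝ] E →L[ℝ] ℝ) (v : E) : E →ₗ[ℝ] E :=
  LinearMap.id - ((G v v)⁻¹ • (G.flip v : E →ₗ[ℝ] ℝ)).smulRight v

section Perp

variable {E : Type*} [NormedAddCommGroup E] [NormedSpace ℝ E] {G : E →L[ℝ] E →L[ℝ] ℝ} {v : E}

lemma perpMap_apply (a : E) : perpMap G v a = a - ((G v v)⁻¹ * G a v) • v := rfl

lemma perpMap_perp (hv : G v v ≠ 0) (a : E) : G (perpMap G v a) v = 0 := by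
  rw [perpMap_apply, map_sub, map_smul, sub_apply, smul_apply, smul_eq_mul]
  field_simp
  ring

lemma perpMap_of_perp {a : E} (ha : G a v = 0) : perpMap G v a = a := by
  simp [perpMap_apply, ha]

lemma apply_perpMap {b : E} (hb : G b v = 0) (a : E) :
    G b (perpMap G v a) = G b a := by
  simp [perpMap_apply, hb]

end Perp

lemma isLinearMap_symmForm_left {E : Type*} [NormedAddCommGroup E] [NormedSpace ℝ E]
    (g : E → E →L[ℝ] E →L[ℝ] ℝ) (Γ : E → E →ₗ[ℝ] E →ₗ[ℝ] E) (F : E × E → E) (x v b : E) :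
    IsLinearMap ℝ fun a => symmForm g Γ F x v a b := by
  have e1 : ∀ a a' : E, ((a + a', 0) : E × E) = (a, 0) + (a', 0) := fun a a' => by simp
  have e2 : ∀ a a' : E, ((0, a + a') : E × E) = (0, a) + (0, a') := fun a a' => by simp
  have e3 : ∀ (c : ℝ) (a : E), ((c • a, 0) : E × E) = c • (a, 0) := fun c a => by simp
  have e4 : ∀ (c : ℝ) (a : E), ((0, c • a) : E × E) = c • (0, a) := fun c a => by simp
  constructor
  · intro a a'
    simp only [symmForm, spGradMap, map_add, map_sub, add_apply, LinearMap.add_apply, e1, e2]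
    ring
  · intro c a
    simp only [symmForm, spGradMap, map_add, map_sub, map_smul, smul_apply, LinearMap.smul_apply,
      e3, e4, smul_eq_mul]
    ring

lemma isLinearMap_symmForm_right {E : Type*} [NormedAddCommGroup E] [NormedSpace ℝ E]
    (g : E → E →L[ℝ] E →L[ℝ] ℝ) (Γ : E → E →ₗ[ℝ] E →ₗ[ℝ] E) (F : E × E → E) (x v a : E) :
    IsLinearMap ℝ fun b => symmForm g Γ F x v a b := by
  constructor
  · intro b b'
    simp only [symmForm, map_add, add_apply]
    ring
  · intro c b
    simp only [symmForm, map_smul, smul_apply, smul_eq_mul]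
    ring

lemma IsLinearMap.comp_linearMap {E E' : Type*} [AddCommGroup E] [Module ℝ E] [AddCommGroup E']
    [Module ℝ E'] {f : E → ℝ} (hf : IsLinearMap ℝ f) (L : E' →ₗ[ℝ] E) :
    IsLinearMap ℝ fun a => f (L a) :=
  ⟨fun a b => by rw [map_add, hf.map_add], fun c a => by rw [map_smul, hf.map_smul]⟩

variable (g : RiemMetric n M) (F : ForceField n M)

lemma speed_sq (hφ : φ ∈ IsManifold.maximalAtlas (𝓡 n) ∞ M) {x v : Coord n} (hx : x ∈ φ.target)
    (hv : v ≠ 0) : speed g φ x v ^ 2 = chartMetric g φ x v v := by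
  rw [speed, ← chartMetric_apply, Real.sq_sqrt (chartMetric_pos g hφ hx hv).le]

lemma speed_ne_zero (hφ : φ ∈ IsManifold.maximalAtlas (𝓡 n) ∞ M) {x v : Coord n}
    (hx : x ∈ φ.target) (hv : v ≠ 0) : speed g φ x v ≠ 0 := by
  intro h
  have := speed_sq g hφ hx hv
  rw [h] at this
  exact (chartMetric_pos g hφ hx hv).ne' (by simpa using this.symm)

lemma chartMetric_single_apply (x b : Coord n) (i : Fin n) :
    chartMetric g φ x (EuclideanSpace.single i 1) b = ∑ j, gLow g φ x i j * b j := by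
  simp [chartMetric_apply]

lemma NLow_eq (x v : Coord n) (i : Fin n) :
    NLow g φ x v i = chartMetric g φ x (EuclideanSpace.single i 1) v / speed g φ x v := by
  rw [NLow, chartMetric_single_apply, Finset.sum_div]
  exact Finset.sum_congr rfl fun j _ => by rw [NUp, mul_div_assoc]

lemma Proj_eq (hφ : φ ∈ IsManifold.maximalAtlas (𝓡 n) ∞ M) {x v : Coord n}
    (hx : x ∈ φ.target) (hv : v ≠ 0) (i j : Fin n) :
    Proj g φ x v i j = perpMap (chartMetric g φ x) v (EuclideanSpace.single j 1) i := by
  have h := speed_ne_zero g hφ hx hv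
  rw [perpMap_apply, ← speed_sq g hφ hx hv, Proj, NLow_eq, NUp]
  simp only [PiLp.sub_apply, PiLp.smul_apply, smul_eq_mul, PiLp.single_apply]
  congr 1
  field_simp

lemma FLow_eq (x v : Coord n) (i : Fin n) :
    FLow g F φ x v i = chartMetric g φ x (EuclideanSpace.single i 1) (chartForce F φ (x, v)) := by
  rw [FLow, chartMetric_single_apply]
  rfl

variable {F}

lemma contDiffAt_chartForce (hF : SmoothForce F)
    (hφ : φ ∈ IsManifold.maximalAtlas (𝓡 n) ∞ M) {x v : Coord n} (hx : x ∈ φ.target) (hv : v ≠ 0) :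
    ContDiffAt ℝ ∞ (chartForce F φ) (x, v) :=
  (contDiffOn_chartForce hF hφ).contDiffAt
    ((φ.open_target.prod isOpen_ne).mem_nhds ⟨hx, hv⟩)

lemma velGrad_eq (hF : SmoothForce F) (hφ : φ ∈ IsManifold.maximalAtlas (𝓡 n) ∞ M)
    {x v : Coord n} (hx : x ∈ φ.target) (hv : v ≠ 0) (j i : Fin n) :
    velGrad F φ x v j i = velGradMap (chartForce F φ) x v (EuclideanSpace.single j 1) i := by
  have h := ((contDiffAt_chartForce hF hφ hx hv).differentiableAt (by simp)).hasFDerivAt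
  have h1 := h.comp v (hasFDerivAt_prodMk_right x v)
  have h2 := (EuclideanSpace.proj i : Coord n →L[ℝ] ℝ).hasFDerivAt.comp v h1
  rw [velGrad, pd]
  have h3 : (fun w => FUp F φ x w i) =
    ((EuclideanSpace.proj i : Coord n →L[ℝ] ℝ) ∘ chartForce F φ ∘ fun w => (x, w)) := rfl
  rw [h3, h2.fderiv]
  rfl

lemma velGradLow_eq (hF : SmoothForce F) (hφ : φ ∈ IsManifold.maximalAtlas (𝓡 n) ∞ M)
    {x v : Coord n} (hx : x ∈ φ.target) (hv : v ≠ 0) (j i : Fin n) :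
    velGradLow g F φ x v j i = chartMetric g φ x (EuclideanSpace.single i 1)
      (velGradMap (chartForce F φ) x v (EuclideanSpace.single j 1)) := by
  rw [velGradLow, chartMetric_single_apply]
  exact Finset.sum_congr rfl fun k _ => by rw [velGrad_eq hF hφ hx hv]

lemma isLinearMap_velGradMap (F : Coord n × Coord n → Coord n) (x v : Coord n) (i : Fin n) :
    IsLinearMap ℝ fun a => velGradMap F x v a i := by
  constructor
  · intro a a'
    have : ((0, a + a') : Coord n × Coord n) = (0, a) + (0, a') := by simp
    simp only [velGradMap, this, map_add, PiLp.add_apply]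
  · intro c a
    have : ((0, c • a) : Coord n × Coord n) = c • (0, a) := by simp
    simp only [velGradMap, this, map_smul, PiLp.smul_apply]

lemma spGrad_eq (hF : SmoothForce F) (hφ : φ ∈ IsManifold.maximalAtlas (𝓡 n) ∞ M)
    {x v : Coord n} (hx : x ∈ φ.target) (hv : v ≠ 0) (j i : Fin n) :
    spGrad g F φ x v j i =
      spGradMap (chartGamma g φ) (chartForce F φ) x v (EuclideanSpace.single j 1) i := by
  have h := ((contDiffAt_chartForce hF hφ hx hv).differentiableAt (by simp)).hasFDerivAt
  have h1 := HasFDerivAt.comp (f := fun y => (y, v)) x h (hasFDerivAt_prodMk_left (𝕜 := ℝ) x v)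
  have h2 := (EuclideanSpace.proj i : Coord n →L[ℝ] ℝ).hasFDerivAt.comp x h1
  have h3 : (fun y => FUp F φ y v i) =
    ((EuclideanSpace.proj i : Coord n →L[ℝ] ℝ) ∘ chartForce F φ ∘ fun y => (y, v)) := rfl
  rw [spGrad, pd, h3, h2.fderiv, spGradMap]
  simp only [PiLp.sub_apply, PiLp.add_apply]
  congr 1
  · congr 1
    rw [chartGamma_apply]
    simp [chartForce_apply]
  · have h4 := Coord.sum_mul_single (isLinearMap_velGradMap (chartForce F φ) x v i)
      (chartGamma g φ x (EuclideanSpace.single j 1) v)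
    rw [velGradMap] at h4
    rw [← h4, Finset.sum_comm]
    refine Finset.sum_congr rfl fun b _ => ?_
    have h5 : chartGamma g φ x (EuclideanSpace.single j 1) v b = ∑ a, Gam g φ x b j a * v a := by
      simp [chartGamma_apply]
    rw [h5, Finset.sum_mul]
    simp only [velGrad_eq hF hφ hx hv]
    exact Finset.sum_congr rfl fun a _ => by ring

lemma spGradLow_eq (hF : SmoothForce F) (hφ : φ ∈ IsManifold.maximalAtlas (𝓡 n) ∞ M)
    {x v : Coord n} (hx : x ∈ φ.target) (hv : v ≠ 0) (j i : Fin n) :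
    spGradLow g F φ x v j i = chartMetric g φ x (EuclideanSpace.single i 1)
      (spGradMap (chartGamma g φ) (chartForce F φ) x v (EuclideanSpace.single j 1)) := by
  rw [spGradLow, chartMetric_single_apply]
  exact Finset.sum_congr rfl fun k _ => by rw [spGrad_eq g hF hφ hx hv]

/-- Columns of the projector are projections of basis vectors, and `N^m / |v| = v^m / |v|²` accounts
for the denominator `g x v v` in `symmForm`. -/
lemma symmSide_eq (hF : SmoothForce F) (hφ : φ ∈ IsManifold.maximalAtlas (𝓡 n) ∞ M)
    {x v : Coord n} (hx : x ∈ φ.target) (hv : v ≠ 0) (ε σ : Fin n) :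
    symmSide g F φ x v ε σ = symmForm (chartMetric g φ) (chartGamma g φ) (chartForce F φ) x v
      (perpMap (chartMetric g φ x) v (EuclideanSpace.single ε 1))
      (perpMap (chartMetric g φ x) v (EuclideanSpace.single σ 1)) := by
  have hs := speed_ne_zero g hφ hx hv
  have key : ∀ i j, (∑ m, NUp g φ x v m * (FLow g F φ x v i * velGradLow g F φ x v m j /
      speed g φ x v)) - spGradLow g F φ x v i j =
      symmForm (chartMetric g φ) (chartGamma g φ) (chartForce F φ) x v
        (EuclideanSpace.single i 1) (EuclideanSpace.single j 1) := by
    intro i j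
    rw [symmForm, ← FLow_eq, ← spGradLow_eq g hF hφ hx hv, ← speed_sq g hφ hx hv]
    congr 1
    have hL : IsLinearMap ℝ fun a => chartMetric g φ x (EuclideanSpace.single j 1)
        (velGradMap (chartForce F φ) x v a) := by
      constructor
      · intro a a'
        have : ((0, a + a') : Coord n × Coord n) = (0, a) + (0, a') := by simp
        simp only [velGradMap, this, map_add]
      · intro c a
        have : ((0, c • a) : Coord n × Coord n) = c • (0, a) := by simp
        simp only [velGradMap, this, map_smul]
    rw [← Coord.sum_mul_single hL v, Finset.mul_sum, Finset.sum_div]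
    refine Finset.sum_congr rfl fun m _ => ?_
    rw [velGradLow_eq g hF hφ hx hv, NUp]
    field_simp
  rw [symmSide]
  simp only [key, Proj_eq g hφ hx hv]
  rw [← Coord.sum_mul_single (isLinearMap_symmForm_left _ _ _ x v _)
    (perpMap (chartMetric g φ x) v (EuclideanSpace.single ε 1))]
  refine Finset.sum_congr rfl fun i _ => ?_
  rw [← Coord.sum_mul_single (isLinearMap_symmForm_right _ _ _ x v _)
    (perpMap (chartMetric g φ x) v (EuclideanSpace.single σ 1)), Finset.mul_sum]
  exact Finset.sum_congr rfl fun j _ => by ring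

/-- The projections of the basis vectors span the orthogonal complement of `v`, so by bilinearity
testing on them is testing on the whole complement. -/
theorem symmEquation_iff (hF : SmoothForce F) (hφ : φ ∈ IsManifold.maximalAtlas (𝓡 n) ∞ M)
    {x v : Coord n} (hx : x ∈ φ.target) (hv : v ≠ 0) :
    SymmEquation g F φ x v ↔
      SymmCondition (chartMetric g φ) (chartGamma g φ) (chartForce F φ) x v := by
  have hG := (chartMetric_pos g hφ hx hv).ne'
  simp only [SymmEquation, symmSide_eq g hF hφ hx hv]
  constructor
  · intro h a b ha hb
    rw [← perpMap_of_perp ha, ← perpMap_of_perp hb]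
    refine Coord.eq_of_isLinearMap
      (IsLinearMap.comp_linearMap (isLinearMap_symmForm_left _ _ _ x v _) _)
      (IsLinearMap.comp_linearMap (isLinearMap_symmForm_right _ _ _ x v _) _) (fun i => ?_) a
    exact Coord.eq_of_isLinearMap
      (IsLinearMap.comp_linearMap (isLinearMap_symmForm_right _ _ _ x v _) _)
      (IsLinearMap.comp_linearMap (isLinearMap_symmForm_left _ _ _ x v _) _) (fun j => h i j) b
  · intro h ε σ
    exact h _ _ (perpMap_perp hG _) (perpMap_perp hG _)

lemma sum_Proj_mul (hφ : φ ∈ IsManifold.maximalAtlas (𝓡 n) ∞ M) {x v : Coord n}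
    (hx : x ∈ φ.target) (hv : v ≠ 0) (w : Coord n) (k : Fin n) :
    ∑ i, Proj g φ x v k i * w i = perpMap (chartMetric g φ x) v w k := by
  simp only [Proj_eq g hφ hx hv]
  rw [← Coord.sum_mul_single (L := fun a => perpMap (chartMetric g φ x) v a k)
    ⟨fun a b => by simp, fun c a => by simp⟩ w]
  exact Finset.sum_congr rfl fun i _ => mul_comm _ _

/-- The projected velocity gradient. -/
def projVelGrad (F : ForceField n M) (φ : OpenPartialHomeomorph M (Coord n)) (x v a : Coord n) :
    Coord n :=
  perpMap (chartMetric g φ x) v (velGradMap (chartForce F φ) x v (perpMap (chartMetric g φ x) v a))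

lemma sum_Proj_velGrad_Proj (hF : SmoothForce F) (hφ : φ ∈ IsManifold.maximalAtlas (𝓡 n) ∞ M)
    {x v : Coord n} (hx : x ∈ φ.target) (hv : v ≠ 0) (σ ε : Fin n) :
    ∑ i, ∑ j, Proj g φ x v j σ * velGrad F φ x v j i * Proj g φ x v ε i =
      projVelGrad g F φ x v (EuclideanSpace.single σ 1) ε := by
  rw [projVelGrad, ← sum_Proj_mul g hφ hx hv]
  refine Finset.sum_congr rfl fun i _ => ?_
  rw [← Coord.sum_mul_single (isLinearMap_velGradMap _ x v i), Finset.mul_sum]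
  refine Finset.sum_congr rfl fun j _ => ?_
  rw [Proj_eq g hφ hx hv j σ, velGrad_eq hF hφ hx hv]
  ring

/-- The trace of a projector of rank `n - 1`: the subtracted part has trace `N^m N_m = 1`. -/
lemma sum_Proj_diag (hφ : φ ∈ IsManifold.maximalAtlas (𝓡 n) ∞ M) {x v : Coord n}
    (hx : x ∈ φ.target) (hv : v ≠ 0) : ∑ m, Proj g φ x v m m = n - 1 := by
  have hs := speed_ne_zero g hφ hx hv
  simp only [Proj, if_true, Finset.sum_sub_distrib, Finset.sum_const, Finset.card_univ,
    Fintype.card_fin, nsmul_eq_mul, mul_one]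
  congr 1
  have h := Coord.sum_mul_single (L := fun a => chartMetric g φ x a v)
    ⟨fun a b => by simp, fun c a => by simp⟩ v
  simp only [NLow_eq, NUp]
  calc ∑ m, v m / speed g φ x v * (chartMetric g φ x (EuclideanSpace.single m 1) v / speed g φ x v)
      = (∑ m, v m * chartMetric g φ x (EuclideanSpace.single m 1) v) / speed g φ x v ^ 2 := by
        rw [Finset.sum_div]
        exact Finset.sum_congr rfl fun m _ => by field_simp
    _ = 1 := by
        rw [h, ← speed_sq g hφ hx hv, div_self (pow_ne_zero 2 hs)]

/-- If the projected velocity gradient is `c` times the projector, comparing traces forces `c` to be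
the trace divided by `n - 1`; so it makes no difference whether the scalar is prescribed or
arbitrary. -/
theorem scalarEquation_iff (hn : 2 ≤ n) (hF : SmoothForce F)
    (hφ : φ ∈ IsManifold.maximalAtlas (𝓡 n) ∞ M) {x v : Coord n} (hx : x ∈ φ.target) (hv : v ≠ 0) :
    ScalarEquation g F φ x v ↔ ScalarCondition (chartMetric g φ) (chartForce F φ) x v := by
  have hG := (chartMetric_pos g hφ hx hv).ne'
  have hn1 : (n : ℝ) - 1 ≠ 0 := by
    have : (2 : ℝ) ≤ n := by exact_mod_cast hn
    linarith
  have htr : (∑ i, ∑ j, ∑ m,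
        Proj g φ x v j m * velGrad F φ x v j i * Proj g φ x v m i / ((n : ℝ) - 1)) =
      (∑ m, projVelGrad g F φ x v (EuclideanSpace.single m 1) m) / ((n : ℝ) - 1) := by
    simp only [← sum_Proj_velGrad_Proj g hF hφ hx hv, Finset.sum_div]
    rw [Finset.sum_comm' (t' := Finset.univ) (s' := fun _ => Finset.univ) (by simp)]
    conv_rhs => rw [Finset.sum_comm]
    conv_lhs => rw [Finset.sum_comm]
    refine Finset.sum_congr rfl fun i _ => ?_
    rw [Finset.sum_comm]
  have heq : ScalarEquation g F φ x v ↔ ∀ σ ε, projVelGrad g F φ x v (EuclideanSpace.single σ 1) ε =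
      (∑ m, projVelGrad g F φ x v (EuclideanSpace.single m 1) m) / ((n : ℝ) - 1) *
        perpMap (chartMetric g φ x) v (EuclideanSpace.single σ 1) ε := by
    refine forall_congr' fun σ => forall_congr' fun ε => ?_
    rw [sum_Proj_velGrad_Proj g hF hφ hx hv, htr, Proj_eq g hφ hx hv]
  rw [heq]
  have hA : ∀ k, IsLinearMap ℝ fun a => projVelGrad g F φ x v a k := by
    have hlin : ∀ f : Coord n → Coord n, (∀ k, IsLinearMap ℝ fun a => f a k) →
        ∀ k, IsLinearMap ℝ fun a => perpMap (chartMetric g φ x) v (f a) k := by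
      intro f hf k
      have h1 : ∀ a b, f (a + b) = f a + f b := fun a b => by
        ext k
        exact (hf k).map_add a b
      have h2 : ∀ (c : ℝ) a, f (c • a) = c • f a := fun c a => by
        ext k
        exact (hf k).map_smul c a
      exact ⟨fun a b => by simp [h1], fun c a => by simp [h2]⟩
    intro k
    exact IsLinearMap.comp_linearMap (hlin _ (isLinearMap_velGradMap (chartForce F φ) x v) k) _
  constructor
  · intro h
    refine ⟨(∑ m, projVelGrad g F φ x v (EuclideanSpace.single m 1) m) / ((n : ℝ) - 1),
      fun a b ha hb => ?_⟩
    have h1 : projVelGrad g F φ x v a = ((∑ m, projVelGrad g F φ x v (EuclideanSpace.single m 1) m)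
        / ((n : ℝ) - 1)) • perpMap (chartMetric g φ x) v a := by
      ext k
      refine Coord.eq_of_isLinearMap (hA k) (f₂ := fun a => (((∑ m, projVelGrad g F φ x v
        (EuclideanSpace.single m 1) m) / ((n : ℝ) - 1)) • perpMap (chartMetric g φ x) v a) k)
        ⟨fun a b => by simp, fun c a => by simp; ring⟩ (fun i => ?_) a
      rw [h i k]
      rfl
    have h2 := congrArg (chartMetric g φ x b) h1
    rw [projVelGrad, apply_perpMap hb, perpMap_of_perp ha, map_smul,
      smul_eq_mul] at h2
    exact h2
  · rintro ⟨c, hc⟩ σ ε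
    have h1 : ∀ a, projVelGrad g F φ x v a = c • perpMap (chartMetric g φ x) v a := by
      intro a
      refine (isMetricOn_chart g hφ).eq_of_forall_apply_eq hx fun b => ?_
      have hpa := perpMap_perp (G := chartMetric g φ x) hG a
      have e : ∀ w, chartMetric g φ x w v = 0 → chartMetric g φ x w b =
          chartMetric g φ x w (perpMap (chartMetric g φ x) v b) := fun w hw =>
        (apply_perpMap hw b).symm
      have hpb := perpMap_perp (G := chartMetric g φ x) hG b
      rw [e _ (by rw [projVelGrad]; exact perpMap_perp hG _),
        e _ (by rw [map_smul, smul_apply, hpa, smul_zero]),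
        chartMetric_symm, chartMetric_symm g φ x (c • _), map_smul, smul_eq_mul,
        ← hc _ _ hpa hpb, projVelGrad, apply_perpMap hpb]
    have h2 : (∑ m, projVelGrad g F φ x v (EuclideanSpace.single m 1) m) / ((n : ℝ) - 1) = c := by
      rw [div_eq_iff hn1, ← sum_Proj_diag g hφ hx hv, Finset.mul_sum]
      refine Finset.sum_congr rfl fun m _ => ?_
      rw [h1, Proj_eq g hφ hx hv]
      rfl
    rw [h1, h2]
    rfl

end Equations

/-! ### Adapted coordinates, smooth unit normals and change of Christoffel symbols -/

section Analysis

open Topology Filter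

variable {E E' : Type*} [NormedAddCommGroup E] [NormedSpace ℝ E]
  [NormedAddCommGroup E'] [NormedSpace ℝ E']

/-- The inverse function theorem, in the smooth category. -/
lemma exists_smooth_local_inverse [CompleteSpace E] {f : E → E'} {s : Set E} (hs : IsOpen s)
    (hf : ContDiffOn ℝ ∞ f s) {a : E} (ha : a ∈ s) {f' : E ≃L[ℝ] E'}
    (hf' : HasFDerivAt f (f' : E →L[ℝ] E') a) :
    ∃ e : OpenPartialHomeomorph E E', a ∈ e.source ∧ e.source ⊆ s ∧ (e : E → E') = f ∧
      ContDiffOn ℝ ∞ e.symm e.target := by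
  have hne : (∞ : WithTop ℕ∞) ≠ 0 := by simp
  have hfa : ∀ x ∈ s, ContDiffAt ℝ ∞ f x := fun x hx => hf.contDiffAt (hs.mem_nhds hx)
  set e₀ := (hfa a ha).toOpenPartialHomeomorph f hf' hne with he₀
  -- Restricting to the open set where the differential is invertible makes the inverse smooth on
  -- its whole domain and not only at the image of `a`.
  set t : Set E := s ∩ {x | fderiv ℝ f x ∈ range ((↑) : (E ≃L[ℝ] E') → E →L[ℝ] E')} with ht
  have hto : IsOpen t := by
    have hc : ContinuousOn (fderiv ℝ f) s := fun x hx =>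
      (contDiffAt_fderiv (hfa x hx)).continuousAt.continuousWithinAt
    exact hc.isOpen_inter_preimage hs (ContinuousLinearEquiv.isOpen (𝕜 := ℝ) (E := E) (F := E'))
  refine ⟨e₀.restrOpen t hto, ⟨(hfa a ha).mem_toOpenPartialHomeomorph_source hf' hne, ha, f',
    hf'.fderiv.symm⟩, fun x hx => hx.2.1, rfl, fun y hy => ?_⟩
  have hy' : e₀.symm y ∈ t := ((e₀.restrOpen t hto).map_target hy).2
  obtain ⟨f'', hf''⟩ := hy'.2
  refine (OpenPartialHomeomorph.contDiffAt_symm (f₀' := f'') (e₀.restrOpen t hto) hy ?_ ?_).contDiffWithinAt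
  · have := ((hfa _ hy'.1).differentiableAt (by simp)).hasFDerivAt
    rw [← hf''] at this
    exact this
  · exact hfa _ hy'.1

/-- Coordinates adapted to the hypersurface parametrized by `ψ`: the projection `r` onto the
parameters along the direction `n₀`, and a defining function `h`. -/
lemma exists_adapted_coordinates [FiniteDimensional ℝ E] [FiniteDimensional ℝ E'] {ψ : E' → E}
    {U : Set E'} (hU : IsOpen U) (hψ : ContDiffOn ℝ ∞ ψ U) {u₀ : E'} (hu₀ : u₀ ∈ U)
    (hinj : Function.Injective (fderiv ℝ ψ u₀)) {n₀ : E} (hn₀ : n₀ ∉ range (fderiv ℝ ψ u₀))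
    (hdim : Module.finrank ℝ E = Module.finrank ℝ E' + 1) :
    ∃ W : Set E, IsOpen W ∧ ∃ (r : E → E') (h : E → ℝ), ContDiffOn ℝ ∞ r W ∧ ContDiffOn ℝ ∞ h W ∧
      fderiv ℝ h (ψ u₀) n₀ = 1 ∧ ∃ V ⊆ U, IsOpen V ∧ u₀ ∈ V ∧
        ∀ u ∈ V, ψ u ∈ W ∧ r (ψ u) = u ∧ h (ψ u) = 0 := by
  have : CompleteSpace E' := FiniteDimensional.complete ℝ E'
  -- The surface is translated along `n₀`; the two components of the local inverse of `Ψ` are `r`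
  -- and `h`.
  set Ψ : E' × ℝ → E := fun q => ψ q.1 + q.2 • n₀ with hΨ
  set L : E' × ℝ →L[ℝ] E := (fderiv ℝ ψ u₀).coprod (ContinuousLinearMap.toSpanSingleton ℝ n₀) with hL
  have hLapp : ∀ a s, L (a, s) = fderiv ℝ ψ u₀ a + s • n₀ := fun a s => by simp [hL]
  have hLinj : Function.Injective L := by
    rw [injective_iff_map_eq_zero]
    rintro ⟨a, s⟩ h
    rw [hLapp] at h
    have hs : s = 0 := by
      by_contra hs
      apply hn₀
      refine ⟨-(s⁻¹ • a), ?_⟩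
      rw [map_neg, map_smul, eq_neg_of_add_eq_zero_left h, smul_neg, neg_neg, inv_smul_smul₀ hs]
    subst hs
    rw [zero_smul, add_zero] at h
    rw [(injective_iff_map_eq_zero _).1 hinj a h]
    rfl
  have hfin : Module.finrank ℝ (E' × ℝ) = Module.finrank ℝ E := by
    rw [hdim, Module.finrank_prod, Module.finrank_self]
  let L' : (E' × ℝ) ≃L[ℝ] E :=
    (LinearEquiv.ofInjectiveOfFinrankEq (L : E' × ℝ →ₗ[ℝ] E) hLinj hfin).toContinuousLinearEquiv
  have hL' : (L' : E' × ℝ →L[ℝ] E) = L := by ext <;> rfl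
  have hψat : ∀ u ∈ U, ContDiffAt ℝ ∞ ψ u := fun u hu => hψ.contDiffAt (hU.mem_nhds hu)
  have hd : HasFDerivAt Ψ (L' : E' × ℝ →L[ℝ] E) (u₀, 0) := by
    rw [hL']
    have h1 : HasFDerivAt (fun q : E' × ℝ => ψ q.1)
        (fderiv ℝ ψ u₀ ∘L ContinuousLinearMap.fst ℝ E' ℝ) (u₀, 0) :=
      HasFDerivAt.comp (f := Prod.fst) (u₀, (0 : ℝ))
        ((hψat u₀ hu₀).differentiableAt (by simp)).hasFDerivAt hasFDerivAt_fst
    have h2 := h1.add ((hasFDerivAt_snd (𝕜 := ℝ) (p := (u₀, (0 : ℝ)))).smul_const n₀)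
    refine h2.congr_fderiv ?_
    ext a <;> simp [hL]
  have hΨs : ContDiffOn ℝ ∞ Ψ (U ×ˢ univ) :=
    (hψ.comp contDiffOn_fst fun q hq => hq.1).add (contDiffOn_snd.smul contDiffOn_const)
  obtain ⟨e, hae, hes, hef, hsymm⟩ := exists_smooth_local_inverse (hU.prod isOpen_univ) hΨs
    (a := (u₀, 0)) ⟨hu₀, mem_univ _⟩ hd
  have hΨ0 : ∀ u, e (u, 0) = ψ u := fun u => by rw [hef]; simp [hΨ]
  refine ⟨e.target, e.open_target, fun x => (e.symm x).1, fun x => (e.symm x).2,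
    contDiff_fst.comp_contDiffOn hsymm, contDiff_snd.comp_contDiffOn hsymm, ?_,
    {u | (u, (0 : ℝ)) ∈ e.source}, fun u hu => (hes hu).1,
    e.open_source.preimage (by fun_prop), hae, fun u hu => ?_⟩
  · have h1 : HasDerivAt (fun s : ℝ => ψ u₀ + s • n₀) n₀ 0 := hasDerivAt_line _ _
    have hmem : ψ u₀ ∈ e.target := hΨ0 u₀ ▸ e.map_source hae
    have hdh : DifferentiableAt ℝ (fun x => (e.symm x).2) (ψ u₀) :=
      ((contDiff_snd.comp_contDiffOn hsymm).contDiffAt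
        (e.open_target.mem_nhds hmem)).differentiableAt (by simp)
    have h2 := hasDerivAt_comp_line hdh.hasFDerivAt n₀
    refine h2.unique ((hasDerivAt_id (0 : ℝ)).congr_of_eventuallyEq ?_)
    have hc : Continuous fun s : ℝ => (u₀, s) := by fun_prop
    filter_upwards [(e.open_source.preimage hc).mem_nhds (x := (0 : ℝ)) hae] with s hs
    have : ψ u₀ + s • n₀ = e (u₀, s) := by rw [hef]
    simp only [id]
    rw [this, e.left_inv hs]
  · rw [← hΨ0]
    refine ⟨e.map_source hu, ?_, ?_⟩ <;> simp only [e.left_inv hu]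

lemma contDiffAt_fderiv_apply_snd {f : E → E'} {x : E} (hf : ContDiffAt ℝ ∞ f x) (v : E) :
    ContDiffAt ℝ ∞ (fun q : E × E => fderiv ℝ f q.1 q.2) (x, v) :=
  (ContDiffAt.comp (x, v) (f := Prod.fst) (contDiffAt_fderiv hf) contDiffAt_fst).clm_apply
    contDiffAt_snd

section Metric

variable {g : E → E →L[ℝ] E →L[ℝ] ℝ} {Γ : E → E →ₗ[ℝ] E →ₗ[ℝ] E} {Ω : Set E}

lemma IsMetricOn.isInvertible [FiniteDimensional ℝ E] (hg : IsMetricOn g Γ Ω) {x : E}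
    (hx : x ∈ Ω) : (g x).IsInvertible := by
  have hinj : Function.Injective (g x) := by
    rw [injective_iff_map_eq_zero]
    intro a ha
    refine hg.eq_of_forall_apply_eq hx fun c => ?_
    rw [ha, map_zero]
  have hfin : Module.finrank ℝ E = Module.finrank ℝ (E →L[ℝ] ℝ) := by
    rw [LinearEquiv.finrank_eq (LinearMap.toContinuousLinearMap (𝕜 := ℝ) (E := E) (F' := ℝ)).symm]
    exact (Subspace.dual_finrank_eq (K := ℝ) (V := E)).symm
  exact ⟨(LinearEquiv.ofInjectiveOfFinrankEq (g x : E →ₗ[ℝ] E →L[ℝ] ℝ) hinj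
    hfin).toContinuousLinearEquiv, by ext; rfl⟩

lemma IsMetricOn.apply_inverse [FiniteDimensional ℝ E] (hg : IsMetricOn g Γ Ω) {x : E}
    (hx : x ∈ Ω) (l : E →L[ℝ] ℝ) : g x ((g x).inverse l) = l :=
  (hg.isInvertible hx).self_apply_inverse l

lemma IsMetricOn.contDiffAt_inverse [FiniteDimensional ℝ E] (hg : IsMetricOn g Γ Ω) {x : E}
    (hx : x ∈ Ω) : ContDiffAt ℝ ∞ (fun y => (g y).inverse) x := by
  have : CompleteSpace E := FiniteDimensional.complete ℝ E
  exact ContDiffAt.comp x (f := g) (hg.isInvertible hx).contDiffAt_map_inverse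
    (hg.smooth.contDiffAt (hg.isOpen.mem_nhds hx))

/-- The quadratic form of the Christoffel symbols is smooth. -/
lemma IsMetricOn.contDiffAt_christoffel [FiniteDimensional ℝ E] (hg : IsMetricOn g Γ Ω) {x v : E}
    (hx : x ∈ Ω) : ContDiffAt ℝ ∞ (fun q : E × E => Γ q.1 q.2 q.2) (x, v) := by
  have hgx : ∀ y ∈ Ω, ContDiffAt ℝ ∞ g y := fun y hy => hg.smooth.contDiffAt (hg.isOpen.mem_nhds hy)
  -- `IsMetricOn` gives no regularity of `Γ` directly. The Koszul formula with equal arguments reads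
  -- `g(Γ(v, v), c) = dg(v)(v, c) - ½ dg(c)(v, v)`, and the last term is half of the spatial
  -- derivative of `G`. Hence `Γ(v, v)` is the inverse metric applied to a smooth covector.
  set G : E × E → ℝ := fun q => g q.1 q.2 q.2 with hG
  have hGs : ∀ q : E × E, q.1 ∈ Ω → ContDiffAt ℝ ∞ G q := fun q hq =>
    ((ContDiffAt.comp q (f := Prod.fst) (hgx _ hq) contDiffAt_fst).clm_apply
      contDiffAt_snd).clm_apply contDiffAt_snd
  have hGd : ∀ q : E × E, q.1 ∈ Ω → ∀ c, fderiv ℝ G q (c, 0) = fderiv ℝ g q.1 c q.2 q.2 := by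
    intro q hq c
    have h1 := HasFDerivAt.comp (f := fun y => (y, q.2)) q.1
      ((hGs q hq).differentiableAt (by simp)).hasFDerivAt (hasFDerivAt_prodMk_left (𝕜 := ℝ) q.1 q.2)
    have h2 := ((hg.differentiableAt hq).hasFDerivAt.clm_apply
      (hasFDerivAt_const q.2 q.1)).clm_apply (hasFDerivAt_const q.2 q.1)
    have h3 := congrArg (fun L : E →L[ℝ] ℝ => L c) (h1.unique h2)
    simpa using h3
  set l : E × E → E →L[ℝ] ℝ := fun q => fderiv ℝ g q.1 q.2 q.2 -
    (1 / 2 : ℝ) • (fderiv ℝ G q ∘L ContinuousLinearMap.inl ℝ E E) with hl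
  have heq : ∀ q : E × E, q.1 ∈ Ω → Γ q.1 q.2 q.2 = (g q.1).inverse (l q) := by
    intro q hq
    refine hg.eq_of_forall_apply_eq hq fun c => ?_
    rw [hg.apply_inverse hq, hg.koszul _ hq]
    simp only [hl, sub_apply, smul_apply, ContinuousLinearMap.comp_apply,
      ContinuousLinearMap.inl_apply, hGd q hq, smul_eq_mul]
    ring
  have hev : (fun q : E × E => Γ q.1 q.2 q.2) =ᶠ[𝓝 (x, v)] fun q => (g q.1).inverse (l q) := by
    filter_upwards [(hg.isOpen.preimage continuous_fst).mem_nhds (x := (x, v)) hx] with q hq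
    exact heq q hq
  refine ContDiffAt.congr_of_eventuallyEq ?_ hev
  have h1 : ContDiffAt ℝ ∞ (fun q : E × E => (g q.1).inverse) (x, v) :=
    ContDiffAt.comp (x, v) (f := Prod.fst) (hg.contDiffAt_inverse hx) contDiffAt_fst
  exact h1.clm_apply (((contDiffAt_fderiv_apply_snd (hgx x hx) v).clm_apply contDiffAt_snd).sub
    (((contDiffAt_fderiv (hGs (x, v) hx)).clm_comp contDiffAt_const).const_smul (1 / 2 : ℝ)))

/-- The unit vector field normal to the level sets of `h`. -/
def unitNormal (g : E → E →L[ℝ] E →L[ℝ] ℝ) (h : E → ℝ) (x : E) : E :=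
  (Real.sqrt (fderiv ℝ h x ((g x).inverse (fderiv ℝ h x))))⁻¹ • (g x).inverse (fderiv ℝ h x)

/-- The value is the squared length of the gradient dual to `l`. It permits the square root and the
division in `unitNormal`. -/
lemma IsMetricOn.gradient_pos [FiniteDimensional ℝ E] (hg : IsMetricOn g Γ Ω) {x : E}
    (hx : x ∈ Ω) {l : E →L[ℝ] ℝ} (hl : l ≠ 0) : 0 < l ((g x).inverse l) := by
  have h := hg.apply_inverse hx l
  have hne : (g x).inverse l ≠ 0 := by
    intro h0
    rw [h0, map_zero] at h
    exact hl h.symm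
  have := hg.pos x hx _ hne
  rwa [h] at this

lemma unitNormal_unit [FiniteDimensional ℝ E] (hg : IsMetricOn g Γ Ω) {h : E → ℝ} {x : E}
    (hx : x ∈ Ω) (hl : fderiv ℝ h x ≠ 0) : g x (unitNormal g h x) (unitNormal g h x) = 1 := by
  have hp := hg.gradient_pos hx hl
  simp only [unitNormal, map_smul, smul_apply, hg.apply_inverse hx, smul_eq_mul]
  rw [← mul_assoc, ← mul_inv, Real.mul_self_sqrt hp.le, inv_mul_cancel₀ hp.ne']

lemma unitNormal_apply [FiniteDimensional ℝ E] (hg : IsMetricOn g Γ Ω) {h : E → ℝ} {x : E}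
    (hx : x ∈ Ω) {b : E} (hb : fderiv ℝ h x b = 0) : g x (unitNormal g h x) b = 0 := by
  rw [unitNormal, map_smul, smul_apply, hg.apply_inverse hx, hb, smul_zero]

lemma contDiffAt_unitNormal [FiniteDimensional ℝ E] (hg : IsMetricOn g Γ Ω) {h : E → ℝ} {x : E}
    (hx : x ∈ Ω) (hh : ContDiffAt ℝ ∞ h x) (hl : fderiv ℝ h x ≠ 0) :
    ContDiffAt ℝ ∞ (unitNormal g h) x := by
  have hp := hg.gradient_pos hx hl
  have h1 := (hg.contDiffAt_inverse hx).clm_apply (contDiffAt_fderiv hh)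
  have h2 := (contDiffAt_fderiv hh).clm_apply h1
  exact ((h2.sqrt hp.ne').inv (Real.sqrt_pos.2 hp).ne').smul h1

/-- The transformation law of the Christoffel symbols. -/
lemma christoffel_transform {E₂ : Type*} [NormedAddCommGroup E₂] [NormedSpace ℝ E₂]
    {g₂ : E₂ → E₂ →L[ℝ] E₂ →L[ℝ] ℝ} {Γ₂ : E₂ → E₂ →ₗ[ℝ] E₂ →ₗ[ℝ] E₂} {Ω₂ : Set E₂}
    (hg : IsMetricOn g Γ Ω) (hg₂ : IsMetricOn g₂ Γ₂ Ω₂) {T : E → E₂} {x : E} (hx : x ∈ Ω)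
    (hTx : T x ∈ Ω₂) (hT : ContDiffAt ℝ ∞ T x)
    (hiso : ∀ᶠ y in 𝓝 x, ∀ a b, g y a b = g₂ (T y) (fderiv ℝ T y a) (fderiv ℝ T y b))
    (hsurj : Function.Surjective (fderiv ℝ T x)) (a b : E) :
    fderiv ℝ T x (Γ x a b) =
      covHess Γ₂ T x a b := by
  -- The isometry identity is differentiated along `c`. The three cyclic versions inserted in the
  -- Koszul formula leave only the covariant Hessian of `T`, because the latter is symmetric.
  have key : ∀ a b c, fderiv ℝ g x c a b =
      g₂ (T x) (covHess Γ₂ T x c a) (fderiv ℝ T x b) +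
      g₂ (T x) (fderiv ℝ T x a) (covHess Γ₂ T x c b) := by
    intro a b c
    have h1 := hg.hasDerivAt_apply (c := fun s : ℝ => x + s • c) (t := 0) (by simpa using hx)
      (hasDerivAt_line x c) (hasDerivAt_const (0 : ℝ) a) (hasDerivAt_const (0 : ℝ) b)
    have hk : ∀ a, HasDerivAt (fun s : ℝ => fderiv ℝ T (x + s • c) a)
        (fderiv ℝ (fderiv ℝ T) x c a) 0 := fun a => by
      rw [fderiv_fderiv_symm hT]
      exact hasDerivAt_comp_line (hasFDerivAt_fderiv_apply hT a) c
    have h2 := hg₂.hasDerivAt_apply (c := fun s : ℝ => T (x + s • c)) (t := 0) (by simpa using hTx)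
      (hasDerivAt_comp_line (hT.differentiableAt (by simp)).hasFDerivAt c) (hk a) (hk b)
    have h3 := h1.unique (h2.congr_of_eventuallyEq
      ((eventually_line hiso c).mono fun s hs => hs a b))
    simp only [zero_smul, add_zero, zero_add] at h3
    rw [hg.fderiv_apply hx, h3]
    rfl
  refine hg₂.eq_of_forall_apply_eq hTx fun d => ?_
  obtain ⟨c, rfl⟩ := hsurj d
  rw [← hiso.self_of_nhds, hg.koszul x hx, key, key, key, covHess_symm hg₂ hTx hT b a,
    covHess_symm hg₂ hTx hT c a, covHess_symm hg₂ hTx hT c b,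
    hg₂.symm _ hTx (fderiv ℝ T x b), hg₂.symm _ hTx (fderiv ℝ T x a)]
  ring

end Metric

end Analysis

/-! ### The function of deviation -/

section VariationOfTrajectories

open Topology Filter

variable {E E' : Type*} [NormedAddCommGroup E] [NormedSpace ℝ E]
  [NormedAddCommGroup E'] [NormedSpace ℝ E']
  {g : E → E →L[ℝ] E →L[ℝ] ℝ} {Γ : E → E →ₗ[ℝ] E →ₗ[ℝ] E} {Ω : Set E}

/-- The derivative of the function of deviation of a family `X(u, t)` of trajectories with initial
speed `μ(u)`, at `t = 0`. -/
lemma hasDerivAt_inner_variation (hg : IsMetricOn g Γ Ω) {X : E' × ℝ → E} {u : E'}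
    (hX : ContDiffAt ℝ ∞ X (u, 0)) (hx : X (u, 0) ∈ Ω) {μ : E' → ℝ} {μ' : E' →L[ℝ] ℝ}
    (hμ : HasFDerivAt μ μ' u)
    (hspeed : ∀ᶠ w in 𝓝 u,
      g (X (w, 0)) (fderiv ℝ X (w, 0) (0, 1)) (fderiv ℝ X (w, 0) (0, 1)) = μ w ^ 2) (k : E') :
    HasDerivAt (fun t => g (X (u, t)) (fderiv ℝ X (u, t) (k, 0)) (fderiv ℝ X (u, t) (0, 1)))
      (μ u * μ' k + g (X (u, 0)) (fderiv ℝ X (u, 0) (k, 0))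
        (fderiv ℝ (fderiv ℝ X) (u, 0) (0, 1) (0, 1) +
          Γ (X (u, 0)) (fderiv ℝ X (u, 0) (0, 1)) (fderiv ℝ X (u, 0) (0, 1)))) 0 := by
  have hXd := (hX.differentiableAt (by simp)).hasFDerivAt
  have e1 : ∀ s : ℝ, ((u, 0) : E' × ℝ) + s • (0, 1) = (u, s) := fun s => by simp
  have e2 : ∀ s : ℝ, ((u, 0) : E' × ℝ) + s • (k, 0) = (u + s • k, 0) := fun s => by simp
  have hD : ∀ a, HasDerivAt (fun s : ℝ => fderiv ℝ X (u, s) a)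
      (fderiv ℝ (fderiv ℝ X) (u, 0) (0, 1) a) 0 := fun a => by
    have := hasDerivAt_comp_line (hasFDerivAt_fderiv_apply hX a) (0, 1)
    rw [fderiv_fderiv_symm hX] at this
    simpa only [e1] using this
  have hD' : HasDerivAt (fun s : ℝ => fderiv ℝ X (u + s • k, 0) (0, 1))
      (fderiv ℝ (fderiv ℝ X) (u, 0) (0, 1) (k, 0)) 0 := by
    have := hasDerivAt_comp_line (hasFDerivAt_fderiv_apply hX (0, 1)) (k, 0)
    simpa only [e2] using this
  have hc := hasDerivAt_comp_line hXd (0, 1)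
  simp only [e1] at hc
  have hc' := hasDerivAt_comp_line hXd (k, 0)
  simp only [e2] at hc'
  have h1 := hg.hasDerivAt_apply (c := fun s : ℝ => X (u, s)) hx hc (hD (k, 0)) (hD (0, 1))
  have h2 := hg.hasDerivAt_apply (c := fun s : ℝ => X (u + s • k, 0)) (t := 0) (by simpa using hx)
    hc' hD' hD'
  -- Mixed covariant derivatives of `X` agree, so the term containing the derivative of `τ_k` in
  -- time is `(∇_k v | v)`, half the derivative of `|v|² = μ²` along `k`, which is `μ dμ`.
  have h3 := (hasDerivAt_comp_line hμ k).fun_pow 2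
  have h4 := h2.unique (h3.congr_of_eventuallyEq (eventually_line hspeed k))
  simp only [zero_smul, add_zero] at h4
  refine h1.congr_deriv ?_
  rw [hg.christoffel_symm hx (fderiv ℝ X (u, 0) (0, 1)) (fderiv ℝ X (u, 0) (k, 0))]
  rw [hg.symm _ hx (fderiv ℝ X (u, 0) (0, 1))] at h4
  simp only [Nat.cast_ofNat, Nat.add_one_sub_one, pow_one] at h4
  congr 1
  linarith

end VariationOfTrajectories

/-! ### The deviation of a shift on the manifold -/

section Deviation

open Topology Filter Bundle

variable {n : ℕ} {M : Type*} [TopologicalSpace M] [ChartedSpace (Coord n) M]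
  [IsManifold (𝓡 n) ∞ M] {φ : OpenPartialHomeomorph M (Coord n)}

lemma compOf_mfderiv {E' : Type*} [NormedAddCommGroup E'] [NormedSpace ℝ E']
    (hφ : φ ∈ IsManifold.maximalAtlas (𝓡 n) ∞ M) {σ : E' → M} {u : E'}
    (hσ : MDifferentiableAt 𝓘(ℝ, E') (𝓡 n) σ u) (hu : σ u ∈ φ.source) (a : E') :
    compOf φ (σ u) (mfderiv 𝓘(ℝ, E') (𝓡 n) σ u a) = fderiv ℝ (fun w => φ (σ w)) u a := by
  have h := mfderiv_comp u ((mdifferentiable_chart hφ).mdifferentiableAt hu) hσ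
  rw [← mfderiv_eq_fderiv]
  exact (congrArg (fun L => L a) h).symm

lemma contDiffAt_chart_comp {E' : Type*} [NormedAddCommGroup E'] [NormedSpace ℝ E']
    (hφ : φ ∈ IsManifold.maximalAtlas (𝓡 n) ∞ M) {σ : E' → M} {u : E'}
    (hσ : ContMDiffAt 𝓘(ℝ, E') (𝓡 n) ∞ σ u) (hu : σ u ∈ φ.source) :
    ContDiffAt ℝ ∞ (fun w => φ (σ w)) u :=
  contMDiffAt_iff_contDiffAt.1
    (((contMDiffOn_of_mem_maximalAtlas hφ).contMDiffAt (φ.open_source.mem_nhds hu)).comp u hσ)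

lemma IsLocalParam.mem {S : Set M} {U : Set (Coord (n - 1))} {σ : Coord (n - 1) → M}
    (h : IsLocalParam (n := n) S U σ) {u : Coord (n - 1)} (hu : u ∈ U) : σ u ∈ S := by
  obtain ⟨W, -, hW⟩ := h.isOpenMap U Subset.rfl h.isOpen
  exact (hW ▸ mem_image_of_mem σ hu : σ u ∈ S ∩ W).1

lemma IsLocalParam.contMDiffAt {S : Set M} {U : Set (Coord (n - 1))} {σ : Coord (n - 1) → M}
    (h : IsLocalParam (n := n) S U σ) {u : Coord (n - 1)} (hu : u ∈ U) :
    ContMDiffAt (𝓡 (n - 1)) (𝓡 n) ∞ σ u :=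
  h.smooth.contMDiffAt (h.isOpen.mem_nhds hu)

lemma motionEquation_iff (g : RiemMetric n M) (F : ForceField n M)
    (φ : OpenPartialHomeomorph M (Coord n)) (γ : ℝ → M) (t : ℝ) :
    MotionEquation g F φ γ t ↔
      deriv (deriv fun s => φ (γ s)) t + chartGamma g φ (φ (γ t)) (deriv (fun s => φ (γ s)) t)
        (deriv (fun s => φ (γ s)) t) = chartForce F φ (φ (γ t), deriv (fun s => φ (γ s)) t) := by
  constructor
  · intro h
    ext k
    rw [PiLp.add_apply, chartGamma_apply, chartForce_apply]
    exact h k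
  · intro h k
    have := congrArg (fun w : Coord n => w k) h
    rwa [PiLp.add_apply, chartGamma_apply, chartForce_apply] at this

/-- The derivative of the function of deviation at `t = 0`. -/
theorem hasDerivAt_deviation {g : RiemMetric n M} {F : ForceField n M}
    (hφ : φ ∈ IsManifold.maximalAtlas (𝓡 n) ∞ M) {S : Set M} {N : (p : M) → TangentSpace (𝓡 n) p}
    (hN : ∀ p ∈ S, g.inner p (N p) (N p) = 1) {ν : M → ℝ} {ε : ℝ} (hε : 0 < ε) {f : ℝ → M → M}
    (hf : IsShift g F S N ν ε f) {U : Set (Coord (n - 1))} {σ : Coord (n - 1) → M}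
    (hσ : IsLocalParam (n := n) S U σ) {u : Coord (n - 1)} (hu : u ∈ U) (huφ : σ u ∈ φ.source)
    {μ' : Coord (n - 1) →L[ℝ] ℝ} (hμ : HasFDerivAt (fun w => ν (σ w)) μ' u) (k : Fin (n - 1)) :
    HasDerivAt (deviation g f σ u k)
      (ν (σ u) * μ' (EuclideanSpace.single k 1) + chartMetric g φ (φ (σ u))
        (fderiv ℝ (fun w => φ (σ w)) u (EuclideanSpace.single k 1))
        (chartForce F φ (φ (σ u), ν (σ u) • compOf φ (σ u) (N (σ u))))) 0 := by
  set J := Ioo (-ε) ε with hJ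
  have h0J : (0 : ℝ) ∈ J := ⟨by linarith, hε⟩
  have hf0 : ∀ p ∈ S, f 0 p = p := fun p hp => congrArg (fun q => q.1) (hf.initial p hp)
  set Y : Coord (n - 1) × ℝ → M := fun q => f q.2 (σ q.1) with hY
  have hYs : ∀ q ∈ U ×ˢ J, ContMDiffAt ((𝓡 (n - 1)).prod 𝓘(ℝ, ℝ)) (𝓡 n) ∞ Y q := by
    have h1 : ContMDiffOn ((𝓡 (n - 1)).prod 𝓘(ℝ, ℝ)) ((𝓡 n).prod 𝓘(ℝ, ℝ)) ∞
        (fun q : Coord (n - 1) × ℝ => (σ q.1, q.2)) (U ×ˢ J) :=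
      (hσ.smooth.comp contMDiffOn_fst fun q hq => hq.1).prodMk contMDiffOn_snd
    intro q hq
    exact (hf.smooth.comp h1 fun q hq => ⟨hσ.mem hq.1, hq.2⟩).contMDiffAt
      ((hσ.isOpen.prod isOpen_Ioo).mem_nhds hq)
  have hYs' : ∀ q ∈ U ×ˢ J, ContMDiffAt 𝓘(ℝ, Coord (n - 1) × ℝ) (𝓡 n) ∞ Y q := by
    intro q hq
    rw [modelWithCornersSelf_prod, ← chartedSpaceSelf_prod]
    exact hYs q hq
  set X : Coord (n - 1) × ℝ → Coord n := fun q => φ (Y q) with hX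
  have hXs : ∀ q ∈ U ×ˢ J, Y q ∈ φ.source → ContDiffAt ℝ ∞ X q := fun q hq hs =>
    contDiffAt_chart_comp hφ (hYs' q hq) hs
  have hY0 : Y (u, 0) = σ u := hf0 _ (hσ.mem hu)
  have hev : ∀ᶠ q in 𝓝 (u, (0 : ℝ)), q ∈ U ×ˢ J ∧ Y q ∈ φ.source := by
    refine Filter.Eventually.and ((hσ.isOpen.prod isOpen_Ioo).mem_nhds ⟨hu, h0J⟩) ?_
    exact (hYs' (u, 0) ⟨hu, h0J⟩).continuousAt.preimage_mem_nhds
      (φ.open_source.mem_nhds (by rwa [hY0]))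
  have hX0 := hXs (u, 0) hev.self_of_nhds.1 hev.self_of_nhds.2
  have htime : ∀ q ∈ U ×ˢ J, Y q ∈ φ.source →
      compOf φ (Y q) (velocity (n := n) (fun s => f s (σ q.1)) q.2) = fderiv ℝ X q (0, 1) := by
    intro q hq hs
    have h1 : MDifferentiableAt 𝓘(ℝ, ℝ) (𝓡 n) (fun s => f s (σ q.1)) q.2 :=
      (((hf.trajectory _ (hσ.mem hq.1)).smooth).contMDiffAt
        (isOpen_Ioo.mem_nhds hq.2)).mdifferentiableAt (by simp)
    rw [velocity]
    refine (compOf_mfderiv hφ h1 hs (1 : ℝ)).trans ?_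
    have h2 := HasFDerivAt.comp (f := fun s : ℝ => (q.1, s)) q.2
      ((hXs q hq hs).differentiableAt (by simp)).hasFDerivAt (hasFDerivAt_prodMk_right q.1 q.2)
    have h3 : fderiv ℝ (fun s => φ (f s (σ q.1))) q.2 = _ := h2.fderiv
    rw [h3]
    simp
  have hspace : ∀ q ∈ U ×ˢ J, Y q ∈ φ.source →
      compOf φ (Y q) (variationVector f σ q.1 k q.2) =
        fderiv ℝ X q (EuclideanSpace.single k 1, 0) := by
    intro q hq hs
    have h1 : MDifferentiableAt (𝓡 (n - 1)) (𝓡 n) (fun w => f q.2 (σ w)) q.1 := by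
      have := ContMDiffAt.comp (g := Y) (f := fun w => (w, q.2)) q.1 (hYs q hq)
        (contMDiffAt_id.prodMk contMDiffAt_const)
      exact this.mdifferentiableAt (by simp)
    rw [variationVector]
    refine (compOf_mfderiv hφ h1 hs (EuclideanSpace.single k 1)).trans ?_
    have h2 := HasFDerivAt.comp (f := fun w => (w, q.2)) q.1
      ((hXs q hq hs).differentiableAt (by simp)).hasFDerivAt
      (hasFDerivAt_prodMk_left (𝕜 := ℝ) q.1 q.2)
    have h3 : fderiv ℝ (fun w => φ (f q.2 (σ w))) q.1 = _ := h2.fderiv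
    rw [h3]
    simp
  have hinit : ∀ w ∈ U, σ w ∈ φ.source →
      fderiv ℝ X (w, 0) (0, 1) = ν (σ w) • compOf φ (σ w) (N (σ w)) := by
    intro w hw hs
    have h1 := congrArg (fun q : TangentBundle (𝓡 n) M => compOf φ q.1 q.2)
      (hf.initial _ (hσ.mem hw))
    have h2 := htime (w, 0) ⟨hw, h0J⟩ (by rw [hY]; simpa only [hf0 _ (hσ.mem hw)] using hs)
    rw [← h2]
    refine Eq.trans h1 ?_
    exact map_smul (mfderiv (𝓡 n) (𝓡 n) φ (σ w)) _ _
  have hw0 : ∀ᶠ w in 𝓝 u, w ∈ U ∧ σ w ∈ φ.source :=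
    Filter.Eventually.and (hσ.isOpen.mem_nhds hu) ((hσ.contMDiffAt hu).continuousAt.preimage_mem_nhds
      (φ.open_source.mem_nhds huφ))
  have hXw : ∀ w ∈ U, X (w, 0) = φ (σ w) := fun w hw => by
    simp only [hX, hY, hf0 _ (hσ.mem hw)]
  have hspeed : ∀ᶠ w in 𝓝 u, chartMetric g φ (X (w, 0)) (fderiv ℝ X (w, 0) (0, 1))
      (fderiv ℝ X (w, 0) (0, 1)) = ν (σ w) ^ 2 := by
    filter_upwards [hw0] with w hw
    have h1 := hN _ (hσ.mem hw.1)
    rw [inner_eq_chartMetric g hφ hw.2] at h1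
    rw [hXw w hw.1, hinit w hw.1 hw.2]
    simp only [map_smul, smul_apply, h1, smul_eq_mul]
    ring
  have hmain := hasDerivAt_inner_variation (isMetricOn_chart g hφ) hX0
    (by rw [hXw u hu]; exact φ.map_source huφ) hμ hspeed (EuclideanSpace.single k 1)
  -- The equation of motion at `t = 0` replaces the covariant acceleration in `hmain` by the force.
  have hmot := (motionEquation_iff g F φ _ 0).1 ((hf.trajectory _ (hσ.mem hu)).motion 0 h0J φ hφ
    (by simpa only [hf0 _ (hσ.mem hu)] using huφ))
  have hlin : ∀ᶠ t : ℝ in 𝓝 0, (u, t) ∈ U ×ˢ J ∧ Y (u, t) ∈ φ.source := by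
    have hc : Continuous fun t : ℝ => (u, t) := by fun_prop
    exact hc.continuousAt.eventually hev
  have hd1 : ∀ᶠ t : ℝ in 𝓝 0, deriv (fun s => φ (f s (σ u))) t = fderiv ℝ X (u, t) (0, 1) := by
    filter_upwards [hlin] with t ht
    have h2 := HasFDerivAt.comp_hasDerivAt (f := fun s : ℝ => (u, s)) t
      ((hXs _ ht.1 ht.2).differentiableAt (by simp)).hasFDerivAt
      ((hasDerivAt_const t u).prodMk (hasDerivAt_id t))
    exact h2.deriv
  have hd2 : deriv (deriv fun s => φ (f s (σ u))) 0 =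
      fderiv ℝ (fderiv ℝ X) (u, 0) (0, 1) (0, 1) := by
    have hd : deriv (fun s => φ (f s (σ u))) =ᶠ[𝓝 0] fun t => fderiv ℝ X (u, t) (0, 1) := hd1
    rw [hd.deriv_eq]
    have h2 := HasFDerivAt.comp_hasDerivAt (f := fun s : ℝ => (u, s)) (0 : ℝ)
      (hasFDerivAt_fderiv_apply hX0 (0, 1)) ((hasDerivAt_const 0 u).prodMk (hasDerivAt_id 0))
    rw [fderiv_fderiv_symm hX0] at h2
    exact h2.deriv
  rw [hd2, hd1.self_of_nhds] at hmot
  have hXu : φ (f 0 (σ u)) = X (u, 0) := rfl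
  rw [hXu] at hmot
  rw [hmot, hinit u hu huφ] at hmain
  have hψ : fderiv ℝ X (u, 0) (EuclideanSpace.single k 1, 0) =
      fderiv ℝ (fun w => φ (σ w)) u (EuclideanSpace.single k 1) := by
    have h2 := HasFDerivAt.comp (f := fun w => (w, (0 : ℝ))) u
      (hX0.differentiableAt (by simp)).hasFDerivAt
      (hasFDerivAt_prodMk_left (𝕜 := ℝ) u (0 : ℝ))
    have h3 : (fun w => φ (σ w)) =ᶠ[𝓝 u] X ∘ fun w => (w, (0 : ℝ)) := by
      filter_upwards [hw0] with w hw
      exact (hXw w hw.1).symm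
    rw [h3.fderiv_eq, h2.fderiv]
    simp
  rw [hψ, hXw u hu] at hmain
  refine hmain.congr_of_eventuallyEq ?_
  filter_upwards [hlin] with t ht
  rw [deviation, inner_eq_chartMetric g hφ ht.2, ← hspace (u, t) ht.1 ht.2,
    ← htime (u, t) ht.1 ht.2]

end Deviation

/-! ### Invariance of the equations of motion -/

section Transition

open Topology Filter Bundle

variable {n : ℕ} {M : Type*} [TopologicalSpace M] [ChartedSpace (Coord n) M]
  [IsManifold (𝓡 n) ∞ M] {φ φ' : OpenPartialHomeomorph M (Coord n)}

lemma compOf_transition (hφ : φ ∈ IsManifold.maximalAtlas (𝓡 n) ∞ M)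
    (hφ' : φ' ∈ IsManifold.maximalAtlas (𝓡 n) ∞ M) {p : M} (hp : p ∈ φ.source)
    (hp' : p ∈ φ'.source) (a : TangentSpace (𝓡 n) p) :
    compOf φ' p a = fderiv ℝ (fun y => φ' (φ.symm y)) (φ p) (compOf φ p a) := by
  obtain ⟨x, hx, rfl⟩ : ∃ x ∈ φ.target, p = φ.symm x :=
    ⟨φ p, φ.map_source hp, (φ.left_inv hp).symm⟩
  have h := compOf_mfderiv hφ' ((mdifferentiable_chart hφ).mdifferentiableAt_symm hx) hp'
    (compOf φ (φ.symm x) a)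
  rw [φ.right_inv hx, ← h]
  exact congrArg (compOf φ' (φ.symm x)) (vecOf_compOf hφ hx a).symm

lemma contDiffAt_transition (hφ : φ ∈ IsManifold.maximalAtlas (𝓡 n) ∞ M)
    (hφ' : φ' ∈ IsManifold.maximalAtlas (𝓡 n) ∞ M) {x : Coord n} (hx : x ∈ φ.target)
    (hp' : φ.symm x ∈ φ'.source) : ContDiffAt ℝ ∞ (fun y => φ' (φ.symm y)) x :=
  contDiffAt_chart_comp hφ' ((contMDiffOn_symm_of_mem_maximalAtlas hφ).contMDiffAt
    (φ.open_target.mem_nhds hx)) hp'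

lemma chartMetric_transition (g : RiemMetric n M) (hφ : φ ∈ IsManifold.maximalAtlas (𝓡 n) ∞ M)
    (hφ' : φ' ∈ IsManifold.maximalAtlas (𝓡 n) ∞ M) {x : Coord n} (hx : x ∈ φ.target)
    (hp' : φ.symm x ∈ φ'.source) (a b : Coord n) :
    chartMetric g φ x a b = chartMetric g φ' (φ' (φ.symm x))
      (fderiv ℝ (fun y => φ' (φ.symm y)) x a) (fderiv ℝ (fun y => φ' (φ.symm y)) x b) := by
  rw [← inner_vecOf, inner_eq_chartMetric g hφ' hp',
    compOf_transition hφ hφ' (φ.map_target hx) hp', compOf_transition hφ hφ' (φ.map_target hx) hp',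
    compOf_vecOf hφ hx, compOf_vecOf hφ hx, φ.right_inv hx]

lemma surjective_fderiv_transition (hφ : φ ∈ IsManifold.maximalAtlas (𝓡 n) ∞ M)
    (hφ' : φ' ∈ IsManifold.maximalAtlas (𝓡 n) ∞ M) {x : Coord n} (hx : x ∈ φ.target)
    (hp' : φ.symm x ∈ φ'.source) :
    Function.Surjective (fderiv ℝ (fun y => φ' (φ.symm y)) x) := by
  intro d
  obtain ⟨a, ha⟩ := (mdifferentiable_chart hφ').mfderiv_surjective hp' d
  refine ⟨compOf φ (φ.symm x) a, ?_⟩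
  have h := compOf_transition hφ hφ' (φ.map_target hx) hp' a
  rw [φ.right_inv hx] at h
  rw [← h]
  exact ha

/-- Trajectories are constructed in one chart, whereas `IsTrajectory` requires the equation in all
charts. The second derivative of the transition map in the coordinate acceleration cancels against
its contribution to the transformed Christoffel symbols, so covariant acceleration transforms as a
vector, as does the force. -/
theorem MotionEquation.transition {g : RiemMetric n M} {F : ForceField n M}
    (hφ : φ ∈ IsManifold.maximalAtlas (𝓡 n) ∞ M) (hφ' : φ' ∈ IsManifold.maximalAtlas (𝓡 n) ∞ M)
    {γ : ℝ → M} {t : ℝ} (hγ : ContMDiffAt 𝓘(ℝ, ℝ) (𝓡 n) ∞ γ t) (hp : γ t ∈ φ.source)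
    (hp' : γ t ∈ φ'.source) (h : MotionEquation g F φ γ t) : MotionEquation g F φ' γ t := by
  rw [motionEquation_iff] at h ⊢
  set T : Coord n → Coord n := fun y => φ' (φ.symm y) with hT
  have hx : φ (γ t) ∈ φ.target := φ.map_source hp
  have hxp : φ.symm (φ (γ t)) ∈ φ'.source := by rwa [φ.left_inv hp]
  have hTs := contDiffAt_transition hφ hφ' hx hxp
  have hTx : T (φ (γ t)) = φ' (γ t) := by simp only [hT, φ.left_inv hp]
  have hc := contDiffAt_chart_comp hφ hγ hp
  have hγd : MDifferentiableAt 𝓘(ℝ, ℝ) (𝓡 n) γ t := hγ.mdifferentiableAt (by simp)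
  have hv1 : compOf φ (γ t) (velocity (n := n) γ t) = deriv (fun s => φ (γ s)) t :=
    compOf_mfderiv hφ hγd hp (1 : ℝ)
  have hv2 : compOf φ' (γ t) (velocity (n := n) γ t) = deriv (fun s => φ' (γ s)) t :=
    compOf_mfderiv hφ' hγd hp' (1 : ℝ)
  have hcomp : ∀ᶠ s in 𝓝 t, deriv (fun s => φ' (γ s)) s =
      fderiv ℝ T (φ (γ s)) (deriv (fun s => φ (γ s)) s) := by
    filter_upwards [eventually_eventually_nhds.2
        (hγ.continuousAt.preimage_mem_nhds (φ.open_source.mem_nhds hp)),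
      hγ.continuousAt.preimage_mem_nhds (φ'.open_source.mem_nhds hp'),
      (hc.of_le (m := 1) (by simp)).eventually (by simp)] with s h1 h2 h3
    have hs : γ s ∈ φ.source := h1.self_of_nhds
    have h4 := ((contDiffAt_transition hφ hφ' (φ.map_source hs)
      (by rwa [φ.left_inv hs])).differentiableAt (by simp)).hasFDerivAt.comp_hasDerivAt s
      (h3.differentiableAt (by simp)).hasDerivAt
    refine (h4.congr_of_eventuallyEq ?_).deriv
    filter_upwards [h1] with r hr
    exact congrArg φ' (φ.left_inv hr).symm
  have hc2 : ContDiffAt ℝ ∞ (deriv fun s => φ (γ s)) t := by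
    have h1 := (contDiffAt_fderiv hc).clm_apply (contDiffAt_const (c := (1 : ℝ)))
    exact h1
  have hdd : deriv (deriv fun s => φ' (γ s)) t =
      fderiv ℝ (fderiv ℝ T) (φ (γ t)) (deriv (fun s => φ (γ s)) t) (deriv (fun s => φ (γ s)) t) +
        fderiv ℝ T (φ (γ t)) (deriv (deriv fun s => φ (γ s)) t) := by
    have hcomp' : deriv (fun s => φ' (γ s)) =ᶠ[𝓝 t] _ := hcomp
    rw [hcomp'.deriv_eq]
    have h1 := ((contDiffAt_fderiv hTs).differentiableAt (by simp)).hasFDerivAt.comp_hasDerivAt t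
      (hc.differentiableAt (by simp)).hasDerivAt
    exact (h1.clm_apply (hc2.differentiableAt (by simp)).hasDerivAt).deriv
  have hiso : ∀ᶠ y in 𝓝 (φ (γ t)), ∀ a b, chartMetric g φ y a b =
      chartMetric g φ' (T y) (fderiv ℝ T y a) (fderiv ℝ T y b) := by
    filter_upwards [φ.open_target.mem_nhds hx, (φ.continuousAt_symm hx).preimage_mem_nhds
      (φ'.open_source.mem_nhds hxp)] with y hy hy' a b
    exact chartMetric_transition g hφ hφ' hy hy' a b
  have hΓ : fderiv ℝ T (φ (γ t)) _ = _ :=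
    christoffel_transform (T := T) (isMetricOn_chart g hφ) (isMetricOn_chart g hφ') hx
      (by rw [hTx]; exact φ'.map_source hp') hTs hiso (surjective_fderiv_transition hφ hφ' hx hxp)
      (deriv (fun s => φ (γ s)) t) (deriv (fun s => φ (γ s)) t)
  have hF : compOf φ' (γ t) (F (γ t) (velocity (n := n) γ t)) =
      fderiv ℝ T (φ (γ t)) (compOf φ (γ t) (F (γ t) (velocity (n := n) γ t))) :=
    compOf_transition hφ hφ' hp hp' _
  rw [compOf_force F hφ' hp', compOf_force F hφ hp, hv1, hv2, ← h, map_add, hΓ, covHess, hTx,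
    ← hcomp.self_of_nhds] at hF
  rw [hF, hdd]
  abel

end Transition

/-! ### Solving the equation for the initial speed -/

section InitialSpeed

open Topology Filter Metric

variable {E E' : Type*} [NormedAddCommGroup E] [NormedSpace ℝ E]
  [NormedAddCommGroup E'] [NormedSpace ℝ E']
  {g : E → E →L[ℝ] E →L[ℝ] ℝ} {Γ : E → E →ₗ[ℝ] E →ₗ[ℝ] E} {Ω : Set E} {F : E × E → E}

lemma exists_eq_add_smul [FiniteDimensional ℝ E] [FiniteDimensional ℝ E'] {D : E' →L[ℝ] E}
    (hinj : Function.Injective D) {n₀ : E} (hn₀ : n₀ ∉ range D)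
    (hdim : Module.finrank ℝ E = Module.finrank ℝ E' + 1) (b : E) : ∃ (a : E') (s : ℝ), D a + s • n₀ = b := by
  set L : E' × ℝ →ₗ[ℝ] E := (D : E' →ₗ[ℝ] E).coprod (LinearMap.toSpanSingleton ℝ E n₀) with hL
  have hLapp : ∀ a s, L (a, s) = D a + s • n₀ := fun a s => by simp [hL]
  have hLinj : Function.Injective L := by
    rw [injective_iff_map_eq_zero]
    rintro ⟨a, s⟩ h
    rw [hLapp] at h
    have hs : s = 0 := by
      by_contra hs
      apply hn₀
      refine ⟨-(s⁻¹ • a), ?_⟩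
      rw [map_neg, map_smul, eq_neg_of_add_eq_zero_left h, smul_neg, neg_neg, inv_smul_smul₀ hs]
    subst hs
    rw [zero_smul, add_zero] at h
    rw [(injective_iff_map_eq_zero _).1 hinj a h]
    rfl
  have hfin : Module.finrank ℝ (E' × ℝ) = Module.finrank ℝ E := by
    rw [hdim, Module.finrank_prod, Module.finrank_self]
  obtain ⟨⟨a, s⟩, h⟩ := (LinearMap.injective_iff_surjective_of_finrank_eq_finrank hfin).1 hLinj b
  exact ⟨a, s, by rw [← h, hLapp]⟩

/-- It fixes the sign: the normalized gradient of the defining function is the prescribed normal and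
not its opposite. -/
lemma unitNormal_eq [FiniteDimensional ℝ E] (hg : IsMetricOn g Γ Ω) {h : E → ℝ} {x n₀ : E}
    (hx : x ∈ Ω) (hn₀ : g x n₀ n₀ = 1) (hh : fderiv ℝ h x = g x n₀) : unitNormal g h x = n₀ := by
  have h1 : (g x).inverse (fderiv ℝ h x) = n₀ := by
    rw [hh]
    exact (hg.isInvertible hx).inverse_apply_self n₀
  rw [unitNormal, h1, hh, hn₀, Real.sqrt_one, inv_one, one_smul]

/-- The algebraic core of sufficiency. In `fderiv_pfaffForm` the Hessian term and the product of the
two force components are symmetric; `symmForm` is symmetric by the first condition; the scalar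
condition turns the velocity gradient term into a multiple of the second fundamental form. -/
lemma pfaffForm_compat (hg : IsMetricOn g Γ Ω) {ψ N : E' → E} {u : E'} {ν : ℝ} (hx : ψ u ∈ Ω)
    (hψ : ContDiffAt ℝ ∞ ψ u) (hN : ContDiffAt ℝ ∞ N u) (hν : ν ≠ 0)
    (hF : ContDiffAt ℝ ∞ F (ψ u, ν • N u)) (hN1 : ∀ᶠ y in 𝓝 u, g (ψ y) (N y) (N y) = 1)
    (hNt : ∀ᶠ y in 𝓝 u, ∀ k, g (ψ y) (N y) (fderiv ℝ ψ y k) = 0)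
    (hsymm : SymmCondition g Γ F (ψ u) (ν • N u)) (hscal : ScalarCondition g F (ψ u) (ν • N u))
    (h k : E') :
    fderiv ℝ (pfaffForm g F ψ N) (u, ν) (h, pfaffForm g F ψ N (u, ν) h) k =
      fderiv ℝ (pfaffForm g F ψ N) (u, ν) (k, pfaffForm g F ψ N (u, ν) k) h := by
  obtain ⟨c, hc⟩ := hscal
  have hNd := hN.differentiableAt (by simp)
  have ht : ∀ k, g (ψ u) (fderiv ℝ ψ u k) (ν • N u) = 0 := fun k => by
    rw [map_smul, hg.symm _ hx, hNt.self_of_nhds, smul_zero]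
  have hd : ∀ k, g (ψ u) (covDeriv Γ ψ N u k) (ν • N u) = 0 := fun k => by
    rw [map_smul, metric_covDeriv_unit hg hx (hψ.differentiableAt (by simp)) hNd hN1, smul_zero]
  rw [fderiv_pfaffForm hg hx hψ hN hν hF hN1.self_of_nhds,
    fderiv_pfaffForm hg hx hψ hN hν hF hN1.self_of_nhds, covHess_symm hg hx hψ h k,
    hsymm _ _ (ht h) (ht k), hc _ _ (hd h) (ht k), hc _ _ (hd k) (ht h),
    hg.symm _ hx (fderiv ℝ ψ u k) (covDeriv Γ ψ N u h),
    hg.symm _ hx (fderiv ℝ ψ u h) (covDeriv Γ ψ N u k), metric_covDeriv_symm hg hx hψ hNd hNt h k]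
  ring

/-- Besides the speed `ν` on parameters, a retraction `r` and a normal field `N` on an open set of
the ambient space are provided: they are needed to regard the initial data as smooth functions on
subsets of the manifold. -/
lemma exists_normal_speed [FiniteDimensional ℝ E] [FiniteDimensional ℝ E']
    (hg : IsMetricOn g Γ Ω) (hF : ContDiffOn ℝ ∞ F (Ω ×ˢ {v | v ≠ 0}))
    (hsymm : ∀ x ∈ Ω, ∀ v ≠ 0, SymmCondition g Γ F x v)
    (hscal : ∀ x ∈ Ω, ∀ v ≠ 0, ScalarCondition g F x v) {ψ : E' → E} {U : Set E'} (hU : IsOpen U)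
    (hψ : ContDiffOn ℝ ∞ ψ U) (hψΩ : MapsTo ψ U Ω) {u₀ : E'} (hu₀ : u₀ ∈ U)
    (hinj : Function.Injective (fderiv ℝ ψ u₀)) {n₀ : E} (hn₀ : g (ψ u₀) n₀ n₀ = 1)
    (hn₀t : ∀ a, g (ψ u₀) n₀ (fderiv ℝ ψ u₀ a) = 0)
    (hdim : Module.finrank ℝ E = Module.finrank ℝ E' + 1) {ν₀ : ℝ} (hν₀ : ν₀ ≠ 0) :
    ∃ (W : Set E) (r : E → E') (N : E → E) (δ : ℝ) (ν : E' → ℝ), IsOpen W ∧ ContDiffOn ℝ ∞ r W ∧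
      ContDiffOn ℝ ∞ N W ∧ 0 < δ ∧ ball u₀ δ ⊆ U ∧ ContDiffOn ℝ ∞ ν (ball u₀ δ) ∧
      N (ψ u₀) = n₀ ∧ ν u₀ = ν₀ ∧ ∀ u ∈ ball u₀ δ, ψ u ∈ W ∧ r (ψ u) = u ∧ ν u ≠ 0 ∧
        g (ψ u) (N (ψ u)) (N (ψ u)) = 1 ∧ (∀ k, g (ψ u) (N (ψ u)) (fderiv ℝ ψ u k) = 0) ∧
        HasFDerivAt ν (pfaffForm g F ψ (fun w => N (ψ w)) (u, ν u)) u := by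
  have : CompleteSpace E' := FiniteDimensional.complete ℝ E'
  have hn₀r : n₀ ∉ range (fderiv ℝ ψ u₀) := by
    rintro ⟨a, ha⟩
    have := hn₀t a
    rw [ha, hn₀] at this
    exact one_ne_zero this
  obtain ⟨W₀, hW₀, r, h, hr, hh, hhn, V, hVU, hV, hu₀V, hVW⟩ :=
    exists_adapted_coordinates hU hψ hu₀ hinj hn₀r hdim
  have hψat : ∀ u ∈ U, ContDiffAt ℝ ∞ ψ u := fun u hu => hψ.contDiffAt (hU.mem_nhds hu)
  have hhat : ∀ x ∈ W₀, ContDiffAt ℝ ∞ h x := fun x hx => hh.contDiffAt (hW₀.mem_nhds hx)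
  -- The gradient of `h` must be nonzero and the metric defined, so that the unit normal is smooth.
  set W : Set E := (W₀ ∩ fderiv ℝ h ⁻¹' {0}ᶜ) ∩ Ω with hW
  have hWo : IsOpen W := by
    refine IsOpen.inter ?_ hg.isOpen
    have hc : ContinuousOn (fderiv ℝ h) W₀ := fun x hx =>
      (contDiffAt_fderiv (hhat x hx)).continuousAt.continuousWithinAt
    exact hc.isOpen_inter_preimage hW₀ isOpen_compl_singleton
  set N : E → E := unitNormal g h with hN
  have hNs : ∀ x ∈ W, ContDiffAt ℝ ∞ N x := fun x hx =>
    contDiffAt_unitNormal hg hx.2 (hhat x hx.1.1) hx.1.2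
  have hhψ : ∀ u ∈ V, ∀ k, fderiv ℝ h (ψ u) (fderiv ℝ ψ u k) = 0 := by
    intro u hu k
    have h1 := HasFDerivAt.comp u ((hhat _ (hVW u hu).1).differentiableAt (by simp)).hasFDerivAt
      ((hψat u (hVU hu)).differentiableAt (by simp)).hasFDerivAt
    have h2 : HasFDerivAt (h ∘ ψ) (0 : E' →L[ℝ] ℝ) u :=
      (hasFDerivAt_const (0 : ℝ) u).congr_of_eventuallyEq
        (by filter_upwards [hV.mem_nhds hu] with w hw using (hVW w hw).2.2)
    exact congrArg (fun L : E' →L[ℝ] ℝ => L k) (h1.unique h2)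
  have hψ₀ : ψ u₀ ∈ W := by
    refine ⟨⟨(hVW u₀ hu₀V).1, fun h0 => ?_⟩, hψΩ hu₀⟩
    rw [h0] at hhn
    exact zero_ne_one hhn
  -- Both covectors vanish on the tangent space of the surface and take the value `1` on `n₀`, and
  -- these vectors span.
  have hdh : fderiv ℝ h (ψ u₀) = g (ψ u₀) n₀ := by
    ext b
    obtain ⟨a, s, rfl⟩ := exists_eq_add_smul hinj hn₀r hdim b
    rw [map_add, map_add, map_smul, map_smul, hhψ u₀ hu₀V, hhn, hn₀, hn₀t]
  have hV₁ : IsOpen (V ∩ ψ ⁻¹' W) := ((hψ.mono hVU).continuousOn).isOpen_inter_preimage hV hWo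
  set V₁ := V ∩ ψ ⁻¹' W with hV₁d
  have hψV : ∀ u ∈ V₁, ContDiffAt ℝ ∞ ψ u := fun u hu => hψat u (hVU hu.1)
  have hNψ : ∀ u ∈ V₁, ContDiffAt ℝ ∞ (fun w => N (ψ w)) u := fun u hu =>
    ContDiffAt.comp u (hNs _ hu.2) (hψV u hu)
  have hunit : ∀ u ∈ V₁, g (ψ u) (N (ψ u)) (N (ψ u)) = 1 := fun u hu =>
    unitNormal_unit hg hu.2.2 hu.2.1.2
  have htan : ∀ u ∈ V₁, ∀ k, g (ψ u) (N (ψ u)) (fderiv ℝ ψ u k) = 0 := fun u hu k =>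
    unitNormal_apply hg hu.2.2 (hhψ u hu.1 k)
  have hNne : ∀ u ∈ V₁, N (ψ u) ≠ 0 := fun u hu h0 => by
    have := hunit u hu
    rw [h0, map_zero] at this
    exact zero_ne_one this
  have hFat : ∀ u ∈ V₁, ∀ ν : ℝ, ν ≠ 0 → ContDiffAt ℝ ∞ F (ψ u, ν • N (ψ u)) := fun u hu ν hν =>
    hF.contDiffAt ((hg.isOpen.prod isOpen_ne).mem_nhds ⟨hu.2.2, smul_ne_zero hν (hNne u hu)⟩)
  -- The domain of the Pfaff equation excludes `ν = 0`, so the solution does not vanish.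
  obtain ⟨δ, hδ, ν, hνs, hν0, hνd⟩ := exists_solution_pfaff
    (Ω := V₁ ×ˢ {ν : ℝ | ν ≠ 0}) (θ := pfaffForm g F ψ (fun w => N (ψ w)))
    (hV₁.prod isOpen_ne)
    (fun q hq => (contDiffAt_pfaffForm hg hq.1.2.2 (hψV _ hq.1) (hNψ _ hq.1) hq.2
      (hFat _ hq.1 _ hq.2)).contDiffWithinAt)
    (fun q hq => pfaffForm_compat hg hq.1.2.2 (hψV _ hq.1) (hNψ _ hq.1) hq.2
      (hFat _ hq.1 _ hq.2) (by filter_upwards [hV₁.mem_nhds hq.1] with y hy using hunit y hy)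
      (by filter_upwards [hV₁.mem_nhds hq.1] with y hy using htan y hy)
      (hsymm _ hq.1.2.2 _ (smul_ne_zero hq.2 (hNne _ hq.1)))
      (hscal _ hq.1.2.2 _ (smul_ne_zero hq.2 (hNne _ hq.1))))
    (u₀ := u₀) (ν₀ := ν₀) ⟨⟨hu₀V, hψ₀⟩, hν₀⟩
  refine ⟨W, r, N, δ, ν, hWo, hr.mono fun x hx => hx.1.1,
    fun x hx => (hNs x hx).contDiffWithinAt, hδ, fun u hu => hVU (hνd u hu).1.1.1, hνs,
    unitNormal_eq hg (hψΩ hu₀) hn₀ hdh, hν0, fun u hu => ?_⟩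
  have h1 := (hνd u hu).1
  exact ⟨h1.1.2, (hVW u h1.1.1).2.1, h1.2, hunit u h1.1, htan u h1.1, (hνd u hu).2⟩

end InitialSpeed

/-! ### Trajectories and pieces of hypersurfaces in a chart -/

section Trajectories

open Topology Filter Metric

variable {E : Type*} [NormedAddCommGroup E] [NormedSpace ℝ E]
  {g : E → E →L[ℝ] E →L[ℝ] ℝ} {Γ : E → E →ₗ[ℝ] E →ₗ[ℝ] E} {Ω : Set E} {F : E × E → E}

/-- The solutions of the equations of motion depend smoothly on the initial data. -/
lemma exists_smooth_trajectories [FiniteDimensional ℝ E] (hg : IsMetricOn g Γ Ω)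
    (hF : ContDiffOn ℝ ∞ F (Ω ×ˢ {v | v ≠ 0})) {x v : E} (hx : x ∈ Ω) (hv : v ≠ 0) :
    ∃ δ > 0, ∃ ε > 0, ∃ X : (E × E) × ℝ → E,
      ContDiffOn ℝ ∞ X (ball (x, v) δ ×ˢ Ioo (-ε) ε) ∧ ∀ q ∈ ball (x, v) δ,
        X (q, 0) = q.1 ∧ deriv (fun t => X (q, t)) 0 = q.2 ∧ ∀ t ∈ Ioo (-ε) ε, X (q, t) ∈ Ω ∧
          deriv (deriv fun t => X (q, t)) t +
            Γ (X (q, t)) (deriv (fun t => X (q, t)) t) (deriv (fun t => X (q, t)) t) =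
              F (X (q, t), deriv (fun t => X (q, t)) t) := by
  -- The second order equation as a first order system in position and velocity. The condition `v ≠
  -- 0` is open, so it persists for short times.
  have hY : ContDiffOn ℝ ∞ (fun q : E × E => (q.2, F q - Γ q.1 q.2 q.2)) (Ω ×ˢ {v | v ≠ 0}) :=
    contDiffOn_snd.prodMk (hF.sub fun q hq =>
      (hg.contDiffAt_christoffel (x := q.1) (v := q.2) hq.1).contDiffWithinAt)
  obtain ⟨δ, hδ, ε, hε, Φ, hΦ, hΦ'⟩ := exists_smooth_localFlow (hg.isOpen.prod isOpen_ne) hY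
    (x₀ := (x, v)) ⟨hx, hv⟩
  refine ⟨δ, hδ, ε, hε, fun q => (Φ q).1, contDiff_fst.comp_contDiffOn hΦ, fun q hq => ?_⟩
  obtain ⟨h0, h1⟩ := hΦ' q hq
  have hd : ∀ t ∈ Ioo (-ε) ε, deriv (fun t => (Φ (q, t)).1) t = (Φ (q, t)).2 := fun t ht =>
    (HasFDerivAt.comp_hasDerivAt (l := Prod.fst) (l' := ContinuousLinearMap.fst ℝ E E) t hasFDerivAt_fst (h1 t ht).2).deriv
  have h0J : (0 : ℝ) ∈ Ioo (-ε) ε := ⟨by linarith, hε⟩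
  refine ⟨by simp only [h0], by rw [hd 0 h0J, h0], fun t ht => ⟨(h1 t ht).1.1, ?_⟩⟩
  have hev : deriv (fun t => (Φ (q, t)).1) =ᶠ[𝓝 t] fun t => (Φ (q, t)).2 := by
    filter_upwards [isOpen_Ioo.mem_nhds ht] with s hs using hd s hs
  have hdd : deriv (fun t => (Φ (q, t)).2) t = _ :=
    (HasFDerivAt.comp_hasDerivAt (l := Prod.snd) (l' := ContinuousLinearMap.snd ℝ E E) t hasFDerivAt_snd (h1 t ht).2).deriv
  rw [hev.deriv_eq, hd t ht, hdd]
  simp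

end Trajectories

/-! ### Coordinate pieces of hypersurfaces -/

section Pieces

open Topology Filter Bundle Metric

variable {n : ℕ} {M : Type*} [TopologicalSpace M] [ChartedSpace (Coord n) M]

lemma IsLocalParam.image {S : Set M} {U B : Set (Coord (n - 1))} {σ : Coord (n - 1) → M}
    (h : IsLocalParam (n := n) S U σ) (hB : IsOpen B) (hBU : B ⊆ U) :
    IsLocalParam (n := n) (σ '' B) B σ where
  isOpen := hB
  smooth := h.smooth.mono hBU
  immersive u hu := h.immersive u (hBU hu)
  injOn := h.injOn.mono hBU
  isOpenMap V hVB hV := by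
    obtain ⟨W, hW, hVW⟩ := h.isOpenMap V (hVB.trans hBU) hV
    refine ⟨W, hW, Subset.antisymm (subset_inter (image_mono hVB) ?_) ?_⟩
    · exact hVW ▸ inter_subset_right
    · rintro _ ⟨⟨u, hu, rfl⟩, hw⟩
      rw [hVW]
      refine ⟨?_, hw⟩
      obtain ⟨W', -, hW'⟩ := h.isOpenMap B hBU hB
      exact (hW' ▸ mem_image_of_mem σ hu : σ u ∈ S ∩ W').1

lemma IsLocalParam.isHypersurface_image {S : Set M} {U B : Set (Coord (n - 1))}
    {σ : Coord (n - 1) → M} (h : IsLocalParam (n := n) S U σ) (hB : IsOpen B) (hBU : B ⊆ U) :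
    IsHypersurface (n := n) (σ '' B) :=
  fun _ hp => ⟨B, σ, h.image hB hBU, hp⟩

lemma IsLocalParam.mono {S : Set M} {U B : Set (Coord (n - 1))} {σ : Coord (n - 1) → M}
    (h : IsLocalParam (n := n) S U σ) (hB : IsOpen B) (hBU : B ⊆ U) :
    IsLocalParam (n := n) S B σ where
  isOpen := hB
  smooth := h.smooth.mono hBU
  immersive u hu := h.immersive u (hBU hu)
  injOn := h.injOn.mono hBU
  isOpenMap V hVB hV := h.isOpenMap V (hVB.trans hBU) hV

/-- A small coordinate ball of a hypersurface belongs to the transformation class. -/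
lemma hypersurfaceTransformationClass_image_ball [T2Space M] {S : Set M}
    {U : Set (Coord (n - 1))} {σ : Coord (n - 1) → M} (h : IsLocalParam (n := n) S U σ)
    {ρ : M → Coord (n - 1)} {u₀ : Coord (n - 1)} {δ δ' : ℝ} (hδ : 0 < δ) (hδδ' : δ < δ')
    (hU : ball u₀ δ' ⊆ U) (hρ : ContinuousOn ρ (σ '' ball u₀ δ'))
    (hρσ : ∀ u ∈ ball u₀ δ', ρ (σ u) = u) :
    closure (σ '' ball u₀ δ) ⊆ σ '' ball u₀ δ' ∧
      HypersurfaceTransformationClass (n := n) (σ '' ball u₀ δ) := by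
  have hσc : ContinuousOn σ (ball u₀ δ') := h.smooth.continuousOn.mono hU
  have hsub : closedBall u₀ δ ⊆ ball u₀ δ' := closedBall_subset_ball hδδ'
  have hsub' : ball u₀ δ ⊆ ball u₀ δ' := ball_subset_closedBall.trans hsub
  have hcomp : IsCompact (σ '' closedBall u₀ δ) :=
    (isCompact_closedBall u₀ δ).image_of_continuousOn (hσc.mono hsub)
  -- In a Hausdorff space the compact image of the closed ball is closed, so it contains the
  -- closure.
  have hcl : closure (σ '' ball u₀ δ) ⊆ σ '' closedBall u₀ δ :=
    closure_minimal (image_mono ball_subset_closedBall) hcomp.isClosed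
  have hcl' := hcl.trans (image_mono (f := σ) hsub)
  have hne : (ball u₀ δ).Nonempty := ⟨u₀, mem_ball_self hδ⟩
  refine ⟨hcl', h.isHypersurface_image isOpen_ball (hsub'.trans hU), ?_, ?_,
    hcomp.closure_of_subset (image_mono ball_subset_closedBall), σ '' ball u₀ δ',
    h.isHypersurface_image isOpen_ball hU, hcl'⟩
  · exact ((convex_ball u₀ δ).isConnected hne).image σ (hσc.mono hsub')
  -- The continuous left inverse `ρ` makes the piece homeomorphic to a ball, which is convex and
  -- hence contractible.
  · have : ContractibleSpace (ball u₀ δ) := (convex_ball u₀ δ).contractibleSpace hne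
    have hmem : ∀ p : (σ '' ball u₀ δ : Set M), ρ p ∈ ball u₀ δ := by
      rintro ⟨_, u, hu, rfl⟩
      rwa [hρσ u (hsub' hu)]
    let e : (σ '' ball u₀ δ : Set M) ≃ₜ ball u₀ δ :=
      { toFun := fun p => ⟨ρ p, hmem p⟩
        invFun := fun u => ⟨σ u, mem_image_of_mem σ u.2⟩
        left_inv := by
          rintro ⟨_, u, hu, rfl⟩
          simp only [hρσ u (hsub' hu)]
        right_inv := by
          rintro ⟨u, hu⟩
          simp only [hρσ u (hsub' hu)]
        continuous_toFun := Continuous.subtype_mk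
          ((hρ.mono (image_mono hsub')).domRestrict) hmem
        continuous_invFun := Continuous.subtype_mk ((hσc.mono hsub').domRestrict) fun u => mem_image_of_mem σ u.2 }
    have := e.contractibleSpace
    infer_instance

variable [IsManifold (𝓡 n) ∞ M] {φ : OpenPartialHomeomorph M (Coord n)}

lemma tangentBundle_ext (hφ : φ ∈ IsManifold.maximalAtlas (𝓡 n) ∞ M)
    {q q' : TangentBundle (𝓡 n) M} (hq : q.1 ∈ φ.source) (h : q.1 = q'.1)
    (hc : compOf φ q.1 q.2 = compOf φ q'.1 q'.2) : q = q' := by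
  obtain ⟨p, w⟩ := q
  obtain ⟨p', w'⟩ := q'
  obtain rfl : p = p' := h
  have : w = w' := (mdifferentiable_chart hφ).mfderiv_injective hq hc
  rw [this]

/-- The tangent vector at `p` with components `w` in the chart `φ`. -/
def ofComp (φ : OpenPartialHomeomorph M (Coord n)) (p : M) (w : Coord n) : TangentSpace (𝓡 n) p :=
  vecOf φ (φ p) w

/-- Stated in the total space because `φ (φ.symm y)` and `y` are only propositionally equal, so the
two tangent vectors have different dependent types. -/
lemma ofComp_eq {p : M} {y : Coord n} (hy : y ∈ φ.target) (hp : p = φ.symm y) (w : Coord n) :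
    (⟨p, ofComp φ p w⟩ : TangentBundle (𝓡 n) M) = ⟨φ.symm y, vecOf φ y w⟩ := by
  subst hp
  have : ∀ z, z = y → (⟨φ.symm y, (vecOf φ z w : Coord n)⟩ : TangentBundle (𝓡 n) M) =
      ⟨φ.symm y, vecOf φ y w⟩ := by
    rintro z rfl
    rfl
  exact this _ (φ.right_inv hy)

lemma compOf_ofComp (hφ : φ ∈ IsManifold.maximalAtlas (𝓡 n) ∞ M) {p : M} (hp : p ∈ φ.source)
    (w : Coord n) : compOf φ p (ofComp φ p w) = w := by
  have hx := φ.map_source hp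
  have h := congrArg (fun q : TangentBundle (𝓡 n) M => compOf φ q.1 q.2)
    (ofComp_eq hx (φ.left_inv hp).symm w)
  exact h.trans (compOf_vecOf hφ hx w)

lemma contMDiffOn_ofComp (hφ : φ ∈ IsManifold.maximalAtlas (𝓡 n) ∞ M) {W : Set (Coord n)}
    {N : Coord n → Coord n} (hN : ContDiffOn ℝ ∞ N W) :
    ContMDiffOn (𝓡 n) (𝓡 n).tangent ∞
      (fun p => (⟨p, ofComp φ p (N (φ p))⟩ : TangentBundle (𝓡 n) M)) (φ.source ∩ φ ⁻¹' W) := by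
  have h1 : ContMDiffOn (𝓡 n) 𝓘(ℝ, Coord n × Coord n) ∞ (fun p => (φ p, N (φ p)))
      (φ.source ∩ φ ⁻¹' W) := by
    have h2 : ContMDiffOn (𝓡 n) 𝓘(ℝ, Coord n × Coord n) ∞ (fun y => (y, N y)) W :=
      contMDiffOn_iff_contDiffOn.2 (contDiffOn_id.prodMk hN)
    exact h2.comp ((contMDiffOn_of_mem_maximalAtlas hφ).mono inter_subset_left) fun p hp => hp.2
  refine ((contMDiffOn_vecOf hφ).comp h1 fun p hp => ⟨φ.map_source hp.1, mem_univ _⟩).congr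
    fun p hp => ?_
  exact ofComp_eq (φ.map_source hp.1) (φ.left_inv hp.1).symm _

/-- Another parametrization of a coordinate piece of a hypersurface is a smooth change of
parameters. -/
lemma IsLocalParam.exists_reparam (hφ : φ ∈ IsManifold.maximalAtlas (𝓡 n) ∞ M)
    {B U₂ : Set (Coord (n - 1))} {σ σ₂ : Coord (n - 1) → M}
    (h₂ : IsLocalParam (n := n) (σ '' B) U₂ σ₂) (hσφ : ∀ u ∈ B, σ u ∈ φ.source)
    {W : Set (Coord n)} (hW : IsOpen W) {r : Coord n → Coord (n - 1)} (hr : ContDiffOn ℝ ∞ r W)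
    (hrσ : ∀ u ∈ B, φ (σ u) ∈ W ∧ r (φ (σ u)) = u) :
    ∃ ρ : Coord (n - 1) → Coord (n - 1), (∀ w ∈ U₂, ρ w ∈ B ∧ σ (ρ w) = σ₂ w) ∧
      ∀ w ∈ U₂, DifferentiableAt ℝ ρ w := by
  refine ⟨fun w => r (φ (σ₂ w)), fun w hw => ?_, fun w hw => ?_⟩
  · obtain ⟨u, hu, h⟩ := h₂.mem hw
    beta_reduce
    rw [← h, (hrσ u hu).2]
    exact ⟨hu, rfl⟩
  · obtain ⟨u, hu, h⟩ := h₂.mem hw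
    have h1 := contDiffAt_chart_comp hφ (h₂.contMDiffAt hw) (h ▸ hσφ u hu)
    have h2 : ContDiffAt ℝ ∞ r (φ (σ₂ w)) :=
      hr.contDiffAt (hW.mem_nhds (h ▸ (hrσ u hu).1))
    exact (ContDiffAt.comp w (f := fun w => φ (σ₂ w)) h2 h1).differentiableAt (by simp)

lemma IsLocalParam.fderiv_chart_comp_injective (hφ : φ ∈ IsManifold.maximalAtlas (𝓡 n) ∞ M)
    {S : Set M} {U : Set (Coord (n - 1))} {σ : Coord (n - 1) → M}
    (h : IsLocalParam (n := n) S U σ) {u : Coord (n - 1)} (hu : u ∈ U) (hs : σ u ∈ φ.source) :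
    Function.Injective (fderiv ℝ (fun w => φ (σ w)) u) := by
  intro a b hab
  have hd := (h.contMDiffAt hu).mdifferentiableAt (by simp)
  rw [← compOf_mfderiv hφ hd hs, ← compOf_mfderiv hφ hd hs] at hab
  exact h.immersive u hu ((mdifferentiable_chart hφ).mfderiv_injective hs hab)

end Pieces

/-! ### Sufficiency of the normality equations -/

section Sufficiency

open Topology Filter Bundle Metric

variable {n : ℕ} {M : Type*} [TopologicalSpace M] [ChartedSpace (Coord n) M]
  [IsManifold (𝓡 n) ∞ M]

/-- The piece is a coordinate ball on which the Pfaff equation has a solution `ν`, and the shift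
follows the trajectories with initial velocity `νN`, all in one chart. The definition tests every
parametrization, so the equation for `ν` is also transported along smooth changes of parameters. -/
theorem additionalNormality_of_conditions [T2Space M] (hn : 1 ≤ n) {g : RiemMetric n M}
    {F : ForceField n M} (hF : SmoothForce F)
    (H : ∀ φ ∈ IsManifold.maximalAtlas (𝓡 n) ∞ M, ∀ x ∈ φ.target, ∀ v ≠ 0,
      SymmCondition (chartMetric g φ) (chartGamma g φ) (chartForce F φ) x v ∧
        ScalarCondition (chartMetric g φ) (chartForce F φ) x v) :
    AdditionalNormality g F := by
  intro S hS p₀ hp₀ N₀ hN₀ ν₀ hν₀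
  obtain ⟨U₀, σ, hσ₀, u₀, hu₀', rfl⟩ := hS p₀ hp₀
  set φ := chartAt (Coord n) (σ u₀) with hφd
  have hφ : φ ∈ IsManifold.maximalAtlas (𝓡 n) ∞ M := IsManifold.chart_mem_maximalAtlas _
  have hs₀ : σ u₀ ∈ φ.source := mem_chart_source _ _
  have hUo : IsOpen (U₀ ∩ σ ⁻¹' φ.source) :=
    hσ₀.smooth.continuousOn.isOpen_inter_preimage hσ₀.isOpen φ.open_source
  set U := U₀ ∩ σ ⁻¹' φ.source with hU
  have hu₀ : u₀ ∈ U := ⟨hu₀', hs₀⟩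
  have hσ : IsLocalParam (n := n) S U σ := hσ₀.mono hUo inter_subset_left
  set ψ : Coord (n - 1) → Coord n := fun w => φ (σ w) with hψ
  have hψs : ∀ u ∈ U, ContDiffAt ℝ ∞ ψ u := fun u hu =>
    contDiffAt_chart_comp hφ (hσ.contMDiffAt hu) hu.2
  have hG := isMetricOn_chart g hφ
  have hFs := contDiffOn_chartForce hF hφ
  set n₀ : Coord n := compOf φ (σ u₀) N₀ with hn₀
  have hn₀1 : chartMetric g φ (ψ u₀) n₀ n₀ = 1 := by
    rw [← hN₀.1, inner_eq_chartMetric g hφ hs₀]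
  have hn₀t : ∀ a, chartMetric g φ (ψ u₀) n₀ (fderiv ℝ ψ u₀ a) = 0 := by
    intro a
    rw [← compOf_mfderiv hφ ((hσ.contMDiffAt hu₀).mdifferentiableAt (by simp)) hs₀,
      ← inner_eq_chartMetric g hφ hs₀]
    exact hN₀.2 _ ⟨U, σ, hσ, u₀, hu₀, a, rfl⟩
  have hn₀ne : n₀ ≠ 0 := by
    intro h0
    rw [h0, map_zero] at hn₀1
    exact zero_ne_one hn₀1
  have hdim : Module.finrank ℝ (Coord n) = Module.finrank ℝ (Coord (n - 1)) + 1 := by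
    simp only [finrank_euclideanSpace_fin]
    omega
  obtain ⟨W, r, N, δ, ν, hW, hr, hN, hδ, hδU, hνs, hNn₀, hνν₀, hprop⟩ :=
    exists_normal_speed hG hFs (fun x hx v hv => (H φ hφ x hx v hv).1)
      (fun x hx v hv => (H φ hφ x hx v hv).2) hUo (fun u hu => (hψs u hu).contDiffWithinAt)
      (fun u hu => φ.map_source hu.2) hu₀ (hσ.fderiv_chart_comp_injective hφ hu₀ hs₀) hn₀1 hn₀t
      hdim hν₀
  obtain ⟨δ₁, hδ₁, ε, hε, X, hX, hXp⟩ := exists_smooth_trajectories hG hFs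
    (φ.map_source hs₀) (smul_ne_zero hν₀ hn₀ne)
  have hνat : ∀ u ∈ ball u₀ δ, ContDiffAt ℝ ∞ ν u := fun u hu =>
    hνs.contDiffAt (isOpen_ball.mem_nhds hu)
  obtain ⟨δ₂, hδ₂, hball⟩ : ∃ δ₂ > 0, ball u₀ δ₂ ⊆ ball u₀ δ ∩
      {u | (ψ u, ν u • N (ψ u)) ∈ ball (ψ u₀, ν₀ • n₀) δ₁} := by
    refine Metric.mem_nhds_iff.1 (inter_mem (ball_mem_nhds u₀ hδ) ?_)
    have hu : u₀ ∈ ball u₀ δ := mem_ball_self hδ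
    have hc : ContinuousAt (fun u => (ψ u, ν u • N (ψ u))) u₀ :=
      (hψs u₀ hu₀).continuousAt.prodMk ((hνat u₀ hu).continuousAt.smul
        (ContinuousAt.comp (f := ψ) (hN.continuousOn.continuousAt
          (hW.mem_nhds (hprop u₀ hu).1)) (hψs u₀ hu₀).continuousAt))
    have := hc.preimage_mem_nhds (ball_mem_nhds _ hδ₁)
    rwa [hNn₀, hνν₀] at this
  have hδU₂ : ball u₀ δ₂ ⊆ U := fun u hu => hδU (hball hu).1
  -- With half the radius, the closure of the piece stays in the image of `ball u₀ δ₂`, where `ν` is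
  -- still defined, smooth and nonzero.
  set B := ball u₀ (δ₂ / 2) with hB
  have hBB : B ⊆ ball u₀ δ₂ := ball_subset_ball (by linarith)
  have hBU : B ⊆ U := hBB.trans hδU₂
  have hu₀B : u₀ ∈ B := mem_ball_self (by linarith)
  -- the initial data, as functions on the manifold
  set νM : M → ℝ := fun p => ν (r (φ p)) with hνM
  have hrσ : ∀ u ∈ ball u₀ δ₂, r (φ (σ u)) = u := fun u hu => (hprop u (hball hu).1).2.1
  have hνσ : ∀ u ∈ ball u₀ δ₂, νM (σ u) = ν u := fun u hu => by rw [hνM]; simp only [hrσ u hu]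
  have hφat : ∀ u ∈ ball u₀ δ₂, ContMDiffAt (𝓡 n) (𝓡 n) ∞ φ (σ u) := fun u hu =>
    (contMDiffOn_of_mem_maximalAtlas hφ).contMDiffAt (φ.open_source.mem_nhds (hδU₂ hu).2)
  have hρat : ∀ u ∈ ball u₀ δ₂, ContMDiffAt (𝓡 n) (𝓡 (n - 1)) ∞ (fun p => r (φ p)) (σ u) :=
    fun u hu => ContMDiffAt.comp (σ u) (g := r) (f := φ)
      ((hr.contDiffAt (hW.mem_nhds (hprop u (hball hu).1).1)).contMDiffAt) (hφat u hu)
  have hνMs : ∀ u ∈ ball u₀ δ₂, ContMDiffAt (𝓡 n) 𝓘(ℝ, ℝ) ∞ νM (σ u) := fun u hu =>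
    ContMDiffAt.comp (σ u) (g := ν) (f := fun p => r (φ p))
      (by rw [hrσ u hu]; exact (hνat u (hball hu).1).contMDiffAt) (hρat u hu)
  -- Through the retraction `r` the initial data become smooth near the surface inside `M`, so the
  -- smoothness required of the shift on `S ×ˢ Ioo (-ε) ε` is inherited from an open set.
  set D : M → Coord n × Coord n := fun p => (φ p, νM p • N (φ p)) with hD
  have hDs : ∀ u ∈ ball u₀ δ₂, ContMDiffAt (𝓡 n) 𝓘(ℝ, Coord n × Coord n) ∞ D (σ u) := by
    intro u hu
    have hNφ : ContMDiffAt (𝓡 n) (𝓡 n) ∞ (fun p => N (φ p)) (σ u) :=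
      ContMDiffAt.comp (σ u) (g := N) (f := φ)
        ((hN.contDiffAt (hW.mem_nhds (hprop u (hball hu).1).1)).contMDiffAt) (hφat u hu)
    exact (hφat u hu).prodMk_space ((hνMs u hu).smul hNφ)
  have hDb : ∀ u ∈ ball u₀ δ₂, D (σ u) ∈ ball (ψ u₀, ν₀ • n₀) δ₁ := by
    intro u hu
    simp only [hD, hνσ u hu]
    exact (hball hu).2
  set f : ℝ → M → M := fun t p => φ.symm (X (D p, t)) with hf
  have hJo : IsOpen (Ioo (-ε) ε) := isOpen_Ioo
  have h0J : (0 : ℝ) ∈ Ioo (-ε) ε := ⟨by linarith, hε⟩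
  have hXat : ∀ u ∈ ball u₀ δ₂, ∀ t ∈ Ioo (-ε) ε, ContDiffAt ℝ ∞ X (D (σ u), t) :=
    fun u hu t ht => hX.contDiffAt ((isOpen_ball.prod hJo).mem_nhds ⟨hDb u hu, ht⟩)
  have hsymm : ∀ x ∈ φ.target, ContMDiffAt (𝓡 n) (𝓡 n) ∞ φ.symm x := fun x hx =>
    (contMDiffOn_symm_of_mem_maximalAtlas hφ).contMDiffAt (φ.open_target.mem_nhds hx)
  -- compatibility with other parametrizations
  have hrep : ∀ (U₂ : Set (Coord (n - 1))) (σ₂ : Coord (n - 1) → M),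
      IsLocalParam (n := n) (σ '' B) U₂ σ₂ → ∀ u ∈ U₂, ∃ b ∈ B, σ₂ u = σ b ∧
        ∃ R : Coord (n - 1) →L[ℝ] Coord (n - 1),
          (∀ a, fderiv ℝ (fun w => φ (σ₂ w)) u a = fderiv ℝ ψ b (R a)) ∧
          HasFDerivAt (fun w => νM (σ₂ w)) (pfaffForm (chartMetric g φ) (chartForce F φ) ψ
            (fun w => N (ψ w)) (b, ν b) ∘L R) u := by
    intro U₂ σ₂ hσ₂ u hu
    obtain ⟨ρ, hρ, hρd⟩ := hσ₂.exists_reparam hφ (fun b hb => (hBU hb).2) hW hr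
      (fun b hb => ⟨(hprop b (hball (hBB hb)).1).1, hrσ b (hBB hb)⟩)
    have hb := hρ u hu
    refine ⟨ρ u, hb.1, hb.2.symm, fderiv ℝ ρ u, fun a => ?_, ?_⟩
    · have h1 := HasFDerivAt.comp u
        ((hψs _ (hBU hb.1)).differentiableAt (by simp)).hasFDerivAt (hρd u hu).hasFDerivAt
      have h2 : (fun w => φ (σ₂ w)) =ᶠ[𝓝 u] ψ ∘ ρ := by
        filter_upwards [hσ₂.isOpen.mem_nhds hu] with w hw
        simp only [hψ, Function.comp, (hρ w hw).2]
      rw [h2.fderiv_eq, h1.fderiv]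
      rfl
    · have h1 := HasFDerivAt.comp u (hprop _ (hball (hBB hb.1)).1).2.2.2.2.2
        (hρd u hu).hasFDerivAt
      refine h1.congr_of_eventuallyEq ?_
      filter_upwards [hσ₂.isOpen.mem_nhds hu] with w hw
      rw [← (hρ w hw).2, hνσ _ (hBB (hρ w hw).1)]
      rfl
  have hcompN : ∀ u ∈ B, compOf φ (σ u) (ofComp φ (σ u) (N (φ (σ u)))) = N (ψ u) := fun u hu =>
    compOf_ofComp hφ (hBU hu).2 _
  obtain ⟨hcl, hclass⟩ := hypersurfaceTransformationClass_image_ball hσ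
    (ρ := fun p => r (φ p)) (u₀ := u₀) (half_pos hδ₂) (half_lt_self hδ₂) hδU₂
    (by
      rintro _ ⟨u, hu, rfl⟩
      exact (hρat u hu).continuousAt.continuousWithinAt) hrσ
  obtain ⟨W', hW', hSW'⟩ := hσ.isOpenMap B hBU isOpen_ball
  have hunit : ∀ p ∈ σ '' B, g.inner p (ofComp φ p (N (φ p))) (ofComp φ p (N (φ p))) = 1 := by
    rintro _ ⟨u, hu, rfl⟩
    rw [inner_eq_chartMetric g hφ (hBU hu).2, hcompN u hu]
    exact (hprop u (hball (hBB hu)).1).2.2.2.1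
  have hshift : IsShift g F (σ '' B) (fun p => ofComp φ p (N (φ p))) νM ε f := by
    have hγ : ∀ u ∈ B, ContMDiffOn 𝓘(ℝ, ℝ) (𝓡 n) ∞ (fun t => f t (σ u)) (Ioo (-ε) ε) := by
      intro u hu t ht
      have h1 : ContDiffAt ℝ ∞ (fun t => X (D (σ u), t)) t :=
        ContDiffAt.comp t (f := fun t => (D (σ u), t)) (hXat u (hBB hu) t ht)
          (contDiffAt_const.prodMk contDiffAt_id)
      exact (ContMDiffAt.comp t (g := φ.symm) (f := fun t => X (D (σ u), t))
        (hsymm _ ((hXp _ (hDb u (hBB hu))).2.2 t ht).1) h1.contMDiffAt).contMDiffWithinAt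
    have hc : ∀ u ∈ B, ∀ t ∈ Ioo (-ε) ε,
        (fun s => φ (f s (σ u))) =ᶠ[𝓝 t] fun s => X (D (σ u), s) := by
      intro u hu t ht
      filter_upwards [hJo.mem_nhds ht] with s hs
      exact φ.right_inv ((hXp _ (hDb u (hBB hu))).2.2 s hs).1
    refine ⟨?_, ?_, ?_⟩
    · rintro ⟨_, t⟩ ⟨⟨u, hu, rfl⟩, ht⟩
      have h1 : ContMDiffAt ((𝓡 n).prod 𝓘(ℝ, ℝ)) 𝓘(ℝ, (Coord n × Coord n) × ℝ) ∞
          (fun q : M × ℝ => (D q.1, q.2)) (σ u, t) :=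
        (ContMDiffAt.comp (σ u, t) (f := Prod.fst) (hDs u (hBB hu)) contMDiffAt_fst).prodMk_space
          contMDiffAt_snd
      have h2 := ContMDiffAt.comp (σ u, t) (g := X) (f := fun q : M × ℝ => (D q.1, q.2))
        (hXat u (hBB hu) t ht).contMDiffAt h1
      exact (ContMDiffAt.comp (σ u, t) (g := φ.symm) (f := fun q : M × ℝ => X (D q.1, q.2))
        (hsymm _ ((hXp _ (hDb u (hBB hu))).2.2 t ht).1) h2).contMDiffWithinAt
    · rintro _ ⟨u, hu, rfl⟩
      refine ⟨hγ u hu, fun t ht φ' hφ' hs' => ?_⟩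
      have ht' := ((hXp _ (hDb u (hBB hu))).2.2 t ht)
      refine MotionEquation.transition hφ hφ' ((hγ u hu).contMDiffAt (hJo.mem_nhds ht))
        (φ.map_target ht'.1) hs' ((motionEquation_iff g F φ _ t).2 ?_)
      have hct : φ (f t (σ u)) = X (D (σ u), t) := (hc u hu t ht).self_of_nhds
      rw [(hc u hu t ht).deriv.deriv_eq, (hc u hu t ht).deriv_eq, hct]
      exact ht'.2
    · rintro _ ⟨u, hu, rfl⟩
      have h0 := (hXp _ (hDb u (hBB hu)))
      have hf0 : f 0 (σ u) = σ u := by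
        simp only [hf, h0.1]
        exact φ.left_inv (hBU hu).2
      have hs0 : f 0 (σ u) ∈ φ.source := by rw [hf0]; exact (hBU hu).2
      refine tangentBundle_ext hφ hs0 hf0 ?_
      have h1 : compOf φ (f 0 (σ u)) (velocity (n := n) (fun t => f t (σ u)) 0) =
          νM (σ u) • N (ψ u) := by
        refine (compOf_mfderiv hφ (((hγ u hu).contMDiffAt (hJo.mem_nhds h0J)).mdifferentiableAt
          (by simp)) hs0 (1 : ℝ)).trans ?_
        refine Eq.trans ?_ h0.2.1
        exact (hc u hu 0 h0J).deriv_eq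
      refine h1.trans ?_
      refine Eq.trans ?_ (map_smul (mfderiv (𝓡 n) (𝓡 n) φ (σ u)) _ _).symm
      exact congrArg (fun w => νM (σ u) • w) (hcompN u hu).symm
  refine ⟨σ '' B, ⟨W', hW', hSW'⟩, mem_image_of_mem σ hu₀B, hclass,
    fun p => ofComp φ p (N (φ p)), ⟨?_, ?_⟩, ?_, νM, ⟨⟨σ '' ball u₀ δ₂, ?_, hcl, ?_⟩, ?_⟩, ?_,
    ε, hε, f, hshift, ?_⟩
  · refine (contMDiffOn_ofComp hφ hN).mono ?_
    rintro _ ⟨u, hu, rfl⟩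
    exact ⟨(hBU hu).2, (hprop u (hball (hBB hu)).1).1⟩
  · intro p hp
    refine ⟨hunit p hp, ?_⟩
    rintro w ⟨U₂, σ₂, hσ₂, u, hu, a, hwa⟩
    obtain ⟨b, hb, hbσ, R, hR, -⟩ := hrep U₂ σ₂ hσ₂ u hu
    have hp' : p = σ₂ u := congrArg (fun q => q.1) hwa
    have hps : p ∈ φ.source := by rw [hp', hbσ]; exact (hBU hb).2
    have hw := congrArg (fun q : TangentBundle (𝓡 n) M => compOf φ q.1 q.2) hwa
    have hw' : compOf φ p w = fderiv ℝ ψ b (R a) := by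
      rw [← hR]
      exact hw.trans (compOf_mfderiv hφ ((hσ₂.contMDiffAt hu).mdifferentiableAt (by simp))
        (hp' ▸ hps) a)
    rw [inner_eq_chartMetric g hφ hps, hw', compOf_ofComp hφ hps, hp', hbσ]
    exact (hprop b (hball (hBB hb)).1).2.2.2.2.1 _
  · apply (mdifferentiable_chart hφ).mfderiv_injective hs₀
    refine (hcompN u₀ hu₀B).trans ?_
    exact hNn₀
  · exact hσ.isHypersurface_image isOpen_ball hδU₂
  · rintro _ ⟨u, hu, rfl⟩
    exact (hνMs u hu).contMDiffWithinAt
  · intro p hp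
    obtain ⟨u, hu, rfl⟩ := hcl hp
    rw [hνσ u hu]
    exact (hprop u (hball hu).1).2.2.1
  · rw [hνσ u₀ (hBB hu₀B), hνν₀]
  · intro U₂ σ₂ hσ₂ u hu k
    obtain ⟨b, hb, hbσ, R, hR, hμ⟩ := hrep U₂ σ₂ hσ₂ u hu
    have hs : σ₂ u ∈ φ.source := hbσ ▸ (hBU hb).2
    refine (hasDerivAt_deviation hφ hunit hε hshift hσ₂ hu hs hμ k).congr_deriv ?_
    -- The Pfaff equation makes the two terms of the derivative of the deviation cancel.
    rw [hR, ContinuousLinearMap.comp_apply, pfaffForm_apply, compOf_ofComp hφ hs, hbσ,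
      hνσ b (hBB hb), chartMetric_symm g φ _ (fderiv ℝ ψ b _)]
    have hν := (hprop b (hball (hBB hb)).1).2.2.1
    simp only [hψ]
    field_simp
    ring

end Sufficiency

/-! ### Hypersurfaces with a prescribed second fundamental form -/

section TestSurface

open Topology Filter Metric

variable {E E' : Type*} [NormedAddCommGroup E] [NormedSpace ℝ E]
  [NormedAddCommGroup E'] [NormedSpace ℝ E']
  {g : E → E →L[ℝ] E →L[ℝ] ℝ} {Γ : E → E →ₗ[ℝ] E →ₗ[ℝ] E} {Ω : Set E} {F : E × E → E}

/-- The graph of a quadratic form. -/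
lemma exists_quadratic_surface (x₀ n₀ : E) (L : E' →L[ℝ] E) (Q : E' →L[ℝ] E' →L[ℝ] ℝ)
    (hQ : ∀ h k, Q h k = Q k h) :
    ∃ ψ : E' → E, ContDiff ℝ ∞ ψ ∧ ψ 0 = x₀ ∧ fderiv ℝ ψ 0 = L ∧
      ∀ h k, fderiv ℝ (fderiv ℝ ψ) 0 h k = Q h k • n₀ := by
  set ψ : E' → E := fun u => x₀ + L u + ((1 / 2 : ℝ) * Q u u) • n₀ with hψ
  have hs : ContDiff ℝ ∞ ψ := by
    have h1 : ContDiff ℝ ∞ fun u => Q u u := Q.contDiff.clm_apply contDiff_id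
    exact (contDiff_const.add L.contDiff).add ((contDiff_const.mul h1).smul contDiff_const)
  have hd : ∀ u, HasFDerivAt ψ (L + (Q u).smulRight n₀) u := by
    intro u
    have h1 : HasFDerivAt (fun u => Q u u) _ u := Q.hasFDerivAt.clm_apply (hasFDerivAt_id u)
    refine ((L.hasFDerivAt.const_add x₀).add ((h1.const_mul (1 / 2)).smul_const n₀)).congr_fderiv ?_
    ext k
    simp only [add_apply, ContinuousLinearMap.smulRight_apply, smul_apply,
      ContinuousLinearMap.comp_apply, ContinuousLinearMap.flip_apply,
      ContinuousLinearMap.id_apply, smul_eq_mul, hQ k u]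
    congr 2
    ring
  refine ⟨ψ, hs, by simp [hψ], by rw [(hd 0).fderiv]; ext k; simp, fun h k => ?_⟩
  have h1 := hasFDerivAt_fderiv_apply (hs.contDiffAt (x := 0)) h
  have h2 : (fun u => fderiv ℝ ψ u h) = fun u => L h + Q u h • n₀ := by
    funext u
    rw [(hd u).fderiv]
    simp
  rw [h2] at h1
  have h3 : HasFDerivAt (fun u => L h + Q u h • n₀) ((Q.flip h).smulRight n₀) 0 :=
    ((Q.flip h).hasFDerivAt.smul_const n₀).const_add _
  have h4 := congrArg (fun T : E' →L[ℝ] E => T k) (h1.unique h3)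
  rw [hQ h k]
  simpa using h4

/-- The graph of a quadratic form over the plane `range L`: its coefficient is the prescribed second
fundamental form minus the normal part of the Christoffel term, symmetric because the connection is
torsion-free. Only the second order jet at one point matters. -/
lemma exists_surface_of_second_form [FiniteDimensional ℝ E'] (hg : IsMetricOn g Γ Ω) {x₀ n₀ : E}
    (hx : x₀ ∈ Ω) (hn₀ : g x₀ n₀ n₀ = 1) (L : E' →L[ℝ] E) (c : E) :
    ∃ ψ : E' → E, ContDiff ℝ ∞ ψ ∧ ψ 0 = x₀ ∧ fderiv ℝ ψ 0 = L ∧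
      ∀ h k, g x₀ n₀ (covHess Γ ψ 0 h k) = -(g x₀ (L h) c * g x₀ (L k) c) := by
  let B : E' →ₗ[ℝ] E' →ₗ[ℝ] ℝ := LinearMap.mk₂ ℝ
    (fun h k => -(g x₀ (L h) c * g x₀ (L k) c) - g x₀ n₀ (Γ x₀ (L h) (L k)))
    (fun h h' k => by simp only [map_add, add_apply, LinearMap.add_apply]; ring)
    (fun s h k => by simp only [map_smul, smul_apply, LinearMap.smul_apply, smul_eq_mul]; ring)
    (fun h k k' => by simp only [map_add, add_apply]; ring)
    (fun s h k => by simp only [map_smul, smul_apply, smul_eq_mul]; ring)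
  let Q : E' →L[ℝ] E' →L[ℝ] ℝ := LinearMap.toContinuousLinearMap
    ((LinearMap.toContinuousLinearMap : (E' →ₗ[ℝ] ℝ) ≃ₗ[ℝ] (E' →L[ℝ] ℝ)).toLinearMap ∘ₗ B)
  have hQ : ∀ h k, Q h k = -(g x₀ (L h) c * g x₀ (L k) c) - g x₀ n₀ (Γ x₀ (L h) (L k)) :=
    fun h k => rfl
  obtain ⟨ψ, hψ, h0, h1, h2⟩ := exists_quadratic_surface x₀ n₀ L Q fun h k => by
    rw [hQ, hQ, hg.christoffel_symm hx, mul_comm]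
  refine ⟨ψ, hψ, h0, h1, fun h k => ?_⟩
  rw [covHess, h2, h1, h0, map_add, map_smul, hn₀, hQ, smul_eq_mul]
  ring

/-- A solution of a Pfaff equation satisfies the compatibility condition. -/
lemma compat_of_solution_pfaff {μ : E' → ℝ} {θ : E' × ℝ → E' →L[ℝ] ℝ} {u : E'}
    (hμ : ContDiffAt ℝ ∞ μ u) (hθ : ContDiffAt ℝ ∞ θ (u, μ u))
    (h : ∀ᶠ w in 𝓝 u, fderiv ℝ μ w = θ (w, μ w)) (a b : E') :
    fderiv ℝ θ (u, μ u) (a, θ (u, μ u) a) b = fderiv ℝ θ (u, μ u) (b, θ (u, μ u) b) a := by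
  have hμd := (hμ.differentiableAt (by simp)).hasFDerivAt
  have h1 : HasFDerivAt (fun w => θ (w, μ w)) _ u :=
    HasFDerivAt.comp (g := θ) (f := fun w => (w, μ w)) u (hθ.differentiableAt (by simp)).hasFDerivAt
      ((hasFDerivAt_id u).prodMk hμd)
  have h2 : fderiv ℝ μ =ᶠ[𝓝 u] fun w => θ (w, μ w) := h
  have h3 : ∀ a b, fderiv ℝ (fderiv ℝ μ) u a b = fderiv ℝ θ (u, μ u) (a, θ (u, μ u) a) b := by
    intro a b
    rw [h2.fderiv_eq, h1.fderiv, ← h.self_of_nhds]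
    rfl
  rw [← h3, ← h3, fderiv_fderiv_symm hμ]

/-- The relation at a point of a hypersurface whose second fundamental form is `c ⊗ c`. -/
lemma relation_of_compat (hg : IsMetricOn g Γ Ω) {ψ N : E' → E} {u : E'} {ν : ℝ} (hx : ψ u ∈ Ω)
    (hψ : ContDiffAt ℝ ∞ ψ u) (hN : ContDiffAt ℝ ∞ N u) (hν : ν ≠ 0)
    (hF : ContDiffAt ℝ ∞ F (ψ u, ν • N u)) (hN1 : ∀ᶠ y in 𝓝 u, g (ψ y) (N y) (N y) = 1)
    (hNt : ∀ᶠ y in 𝓝 u, ∀ k, g (ψ y) (N y) (fderiv ℝ ψ y k) = 0)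
    (hrange : ∀ a, g (ψ u) a (N u) = 0 → a ∈ range (fderiv ℝ ψ u)) {c : E}
    (hc : g (ψ u) c (N u) = 0)
    (hII : ∀ h k, g (ψ u) (N u) (covHess Γ ψ u h k) =
      -(g (ψ u) (fderiv ℝ ψ u h) c * g (ψ u) (fderiv ℝ ψ u k) c))
    (hcompat : ∀ h k, fderiv ℝ (pfaffForm g F ψ N) (u, ν) (h, pfaffForm g F ψ N (u, ν) h) k =
      fderiv ℝ (pfaffForm g F ψ N) (u, ν) (k, pfaffForm g F ψ N (u, ν) k) h) {a b : E}
    (ha : g (ψ u) a (N u) = 0) (hb : g (ψ u) b (N u) = 0) :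
    ν⁻¹ * symmForm g Γ F (ψ u) (ν • N u) a b
        - g (ψ u) a c * g (ψ u) b (velGradMap F (ψ u) (ν • N u) c) =
      ν⁻¹ * symmForm g Γ F (ψ u) (ν • N u) b a
        - g (ψ u) b c * g (ψ u) a (velGradMap F (ψ u) (ν • N u) c) := by
  obtain ⟨h, rfl⟩ := hrange a ha
  obtain ⟨k, rfl⟩ := hrange b hb
  have hNd := hN.differentiableAt (by simp)
  -- The difference is tangent to the surface because `N` is a unit field and `c` is tangent, and it
  -- is orthogonal to all tangent vectors by the Weingarten relation; so it has length zero.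
  have hC : ∀ h, covDeriv Γ ψ N u h = g (ψ u) (fderiv ℝ ψ u h) c • c := by
    intro h
    set d := covDeriv Γ ψ N u h - g (ψ u) (fderiv ℝ ψ u h) c • c with hd
    have hdN : g (ψ u) d (N u) = 0 := by
      rw [hd, map_sub, map_smul, sub_apply, smul_apply, hc,
        metric_covDeriv_unit hg hx (hψ.differentiableAt (by simp)) hNd hN1, smul_zero, sub_zero]
    have hdk : ∀ k, g (ψ u) d (fderiv ℝ ψ u k) = 0 := by
      intro k
      rw [hd, map_sub, map_smul, sub_apply, smul_apply,
        metric_covDeriv_tangent hg hx hψ hNd k (hNt.mono fun _ hy => hy k), hII,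
        hg.symm _ hx c, smul_eq_mul]
      ring
    by_contra hne
    obtain ⟨m, hm⟩ := hrange d hdN
    have h1 := hg.pos _ hx d (sub_ne_zero.2 hne)
    have h2 := hdk m
    rw [hm] at h2
    exact h1.ne' h2
  have hA : ∀ (s : ℝ) (a : E), velGradMap F (ψ u) (ν • N u) (s • a) =
      s • velGradMap F (ψ u) (ν • N u) a := by
    intro s a
    rw [velGradMap, velGradMap, ← map_smul]
    simp
  have h1 := hcompat h k
  rw [fderiv_pfaffForm hg hx hψ hN hν hF hN1.self_of_nhds,
    fderiv_pfaffForm hg hx hψ hN hν hF hN1.self_of_nhds, covHess_symm hg hx hψ h k, hC, hC, hA, hA,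
    map_smul, map_smul, smul_eq_mul, smul_eq_mul] at h1
  linarith

/-- The case `c = 0`: on a surface whose second fundamental form vanishes at the point, the velocity
gradient drops out. -/
lemma symmCondition_of_relation {x v : E} {ν : ℝ} (hν : ν ≠ 0)
    (H : ∀ c a b, g x c v = 0 → g x a v = 0 → g x b v = 0 →
      ν⁻¹ * symmForm g Γ F x v a b - g x a c * g x b (velGradMap F x v c) =
        ν⁻¹ * symmForm g Γ F x v b a - g x b c * g x a (velGradMap F x v c)) :
    SymmCondition g Γ F x v := by
  intro a b ha hb
  have h := H 0 a b (by simp) ha hb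
  simp only [map_zero, zero_mul, sub_zero] at h
  exact mul_left_cancel₀ (inv_ne_zero hν) h

/-- The hypothesis says that the projection of `A c` is proportional to `c` for every `c`
perpendicular to `v`. A linear operator for which every vector is an eigenvector is a scalar; the
scalar is read off from one nonzero `d`. -/
lemma scalarCondition_of_relation (hg : IsMetricOn g Γ Ω) {x v : E} (hx : x ∈ Ω)
    (H : ∀ c a b, g x c v = 0 → g x a v = 0 → g x b v = 0 →
      g x a c * g x b (velGradMap F x v c) = g x b c * g x a (velGradMap F x v c)) :
    ScalarCondition g F x v := by
  by_cases hd : ∃ d, g x d v = 0 ∧ d ≠ 0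
  swap
  · refine ⟨0, fun a b ha hb => ?_⟩
    have hb0 : b = 0 := by
      by_contra hb0
      exact hd ⟨b, hb, hb0⟩
    simp [hb0]
  obtain ⟨d, hdv, hd0⟩ := hd
  have hdd := (hg.pos x hx d hd0).ne'
  set A : E → E := velGradMap F x v with hA
  have hadd : ∀ a b, A (a + b) = A a + A b := fun a b => by
    simp only [hA, velGradMap, ← map_add]
    simp
  have hsmul : ∀ (s : ℝ) (a : E), A (s • a) = s • A a := fun s a => by
    simp only [hA, velGradMap, ← map_smul]
    simp
  set l : ℝ := g x d (A d) / g x d d with hl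
  have hAd : ∀ b, g x b v = 0 → g x b (A d) = l * g x b d := by
    intro b hb
    have h := H d d b hdv hdv hb
    rw [hl]
    field_simp
    linarith
  refine ⟨l, fun c b hc hb => ?_⟩
  set s : ℝ := g x c d / g x d d with hs
  -- The vector `c` is split into a multiple of `d` and a part `a` orthogonal to `d`. Testing on `a
  -- + d` shows that `a` and `d` have the same eigenvalue.
  set a : E := c - s • d with ha
  have hav : g x a v = 0 := by simp [ha, hc, hdv]
  have had : g x a d = 0 := by
    simp only [ha, map_sub, map_smul, sub_apply, smul_apply, smul_eq_mul, hs]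
    field_simp
    ring
  have hca : c = a + s • d := by simp [ha]
  have hAa : g x b (A a) = l * g x b a := by
    by_cases ha0 : a = 0
    · rw [ha0]
      have : A 0 = 0 := by simpa using hsmul 0 0
      simp [this]
    have haa := (hg.pos x hx a ha0).ne'
    have h1 := H (a + d) a d (by simp [hav, hdv]) hav hdv
    have h2 := H a a d hav hav hdv
    have h3 := H a a b hav hav hb
    have hda : g x d a = 0 := by rw [hg.symm x hx, had]
    rw [hadd] at h1
    simp only [map_add, had, hda, hAd a hav, hAd d hdv] at h1 h2
    have h4 : g x d (A a) = 0 := by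
      have : g x a a * g x d (A a) = 0 := by rw [h2]; ring
      exact (mul_eq_zero.1 this).resolve_left haa
    have h5 : g x d d * (g x a (A a) - l * g x a a) = 0 := by
      rw [h4] at h1
      linear_combination -h1
    have h6 := (mul_eq_zero.1 h5).resolve_left hdd
    have h7 : g x a a * (g x b (A a) - l * g x b a) = 0 := by
      linear_combination h3 + g x b a * h6
    linarith [(mul_eq_zero.1 h7).resolve_left haa]
  change g x b (A c) = l * g x b c
  rw [hca, hadd, hsmul]
  simp only [map_add, map_smul, smul_eq_mul, hAa, hAd b hb]
  ring

end TestSurface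

/-! ### Necessity of the normality equations -/

section Necessity

open Topology Filter Bundle Metric

lemma IsMetricOn.exists_perp_param {E E' : Type*} [NormedAddCommGroup E] [NormedSpace ℝ E]
    [NormedAddCommGroup E'] [NormedSpace ℝ E'] [FiniteDimensional ℝ E] [FiniteDimensional ℝ E']
    {g : E → E →L[ℝ] E →L[ℝ] ℝ} {x n₀ : E} (hn₀ : g x n₀ n₀ ≠ 0)
    (hdim : Module.finrank ℝ E = Module.finrank ℝ E' + 1) :
    ∃ L : E' →L[ℝ] E, Function.Injective L ∧ ∀ a, g x a n₀ = 0 ↔ a ∈ range L := by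
  set l : Module.Dual ℝ E := ((g x).flip n₀ : E →L[ℝ] ℝ).toLinearMap with hl
  have hl0 : l ≠ 0 := fun h => hn₀ (congrArg (fun T : Module.Dual ℝ E => T n₀) h)
  have h1 := Module.Dual.finrank_ker_add_one_of_ne_zero hl0
  let e : E' ≃ₗ[ℝ] LinearMap.ker l := LinearEquiv.ofFinrankEq _ _ (by omega)
  refine ⟨LinearMap.toContinuousLinearMap ((LinearMap.ker l).subtype ∘ₗ e.toLinearMap),
    fun a b h => e.injective (Subtype.ext h), fun a => ⟨fun h => ?_, ?_⟩⟩
  · exact ⟨e.symm ⟨a, h⟩, by simp⟩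
  · rintro ⟨u, rfl⟩
    exact (e u).2

variable {n : ℕ} {M : Type*} [TopologicalSpace M] [ChartedSpace (Coord n) M]
  [IsManifold (𝓡 n) ∞ M] {φ : OpenPartialHomeomorph M (Coord n)}

/-- A smooth left inverse `r` of `ψ` provides all the requirements: it forces the differential and
the map to be injective, and the image of `V` is cut out by the open condition that `r ∘ φ` lies in
`V`. -/
lemma isLocalParam_of_retraction (hφ : φ ∈ IsManifold.maximalAtlas (𝓡 n) ∞ M)
    {ψ : Coord (n - 1) → Coord n} {B : Set (Coord (n - 1))} (hB : IsOpen B)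
    (hψ : ContDiffOn ℝ ∞ ψ B) (hψφ : MapsTo ψ B φ.target) {W : Set (Coord n)} (hW : IsOpen W)
    {r : Coord n → Coord (n - 1)} (hr : ContDiffOn ℝ ∞ r W)
    (hrψ : ∀ u ∈ B, ψ u ∈ W ∧ r (ψ u) = u) :
    IsLocalParam (n := n) ((fun u => φ.symm (ψ u)) '' B) B (fun u => φ.symm (ψ u)) := by
  have hs : ∀ u ∈ B, φ.symm (ψ u) ∈ φ.source := fun u hu => φ.map_target (hψφ hu)
  have hσs : ContMDiffOn (𝓡 (n - 1)) (𝓡 n) ∞ (fun u => φ.symm (ψ u)) B :=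
    (contMDiffOn_symm_of_mem_maximalAtlas hφ).comp hψ.contMDiffOn hψφ
  refine ⟨hB, hσs, fun u hu => ?_, fun u hu w hw h => ?_, fun V hVB hV => ?_⟩
  · have h1 := HasFDerivAt.comp u
      (((hr.contDiffAt (hW.mem_nhds (hrψ u hu).1)).differentiableAt (by simp)).hasFDerivAt)
      ((hψ.contDiffAt (hB.mem_nhds hu)).differentiableAt (by simp)).hasFDerivAt
    have h2 : r ∘ ψ =ᶠ[𝓝 u] id := by
      filter_upwards [hB.mem_nhds hu] with w hw using (hrψ w hw).2
    have h3 := h1.unique ((hasFDerivAt_id u).congr_of_eventuallyEq h2)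
    have h4 : (fun w => φ (φ.symm (ψ w))) =ᶠ[𝓝 u] ψ := by
      filter_upwards [hB.mem_nhds hu] with w hw using φ.right_inv (hψφ hw)
    intro a b hab
    have h5 : ∀ c, compOf φ (φ.symm (ψ u))
        (mfderiv (𝓡 (n - 1)) (𝓡 n) (fun u => φ.symm (ψ u)) u c) = fderiv ℝ ψ u c := fun c => by
      rw [← h4.fderiv_eq]
      exact compOf_mfderiv hφ ((hσs.contMDiffAt (hB.mem_nhds hu)).mdifferentiableAt (by simp))
        (hs u hu) c
    have h6 : ∀ c, fderiv ℝ r (ψ u) (fderiv ℝ ψ u c) = c := fun c =>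
      congrArg (fun T : Coord (n - 1) →L[ℝ] Coord (n - 1) => T c) h3
    rw [← h6 a, ← h6 b, ← h5, ← h5]
    exact congrArg (fun c => fderiv ℝ r (ψ u) (compOf φ (φ.symm (ψ u)) c)) hab
  · have := φ.symm.injOn (hψφ hu) (hψφ hw) h
    rw [← (hrψ u hu).2, ← (hrψ w hw).2, this]
  · refine ⟨φ.source ∩ φ ⁻¹' (W ∩ r ⁻¹' V), φ.isOpen_inter_preimage
      (hr.continuousOn.isOpen_inter_preimage hW hV), Subset.antisymm ?_ ?_⟩
    · rintro _ ⟨u, hu, rfl⟩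
      have hu' := hVB hu
      refine ⟨mem_image_of_mem _ hu', hs u hu', ?_⟩
      simp only [mem_preimage, φ.right_inv (hψφ hu')]
      exact ⟨(hrψ u hu').1, by rw [mem_preimage, (hrψ u hu').2]; exact hu⟩
    · rintro _ ⟨⟨u, hu, rfl⟩, -, hw⟩
      simp only [mem_preimage, φ.right_inv (hψφ hu)] at hw
      have := hw.2
      rw [mem_preimage, (hrψ u hu).2] at this
      exact ⟨u, this, rfl⟩

lemma IsLocalParam.inter_open {S W : Set M} {U : Set (Coord (n - 1))} {σ : Coord (n - 1) → M}
    (h : IsLocalParam (n := n) S U σ) (hW : IsOpen W) :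
    IsLocalParam (n := n) (S ∩ W) (U ∩ σ ⁻¹' W) σ where
  isOpen := h.smooth.continuousOn.isOpen_inter_preimage h.isOpen hW
  smooth := h.smooth.mono inter_subset_left
  immersive u hu := h.immersive u hu.1
  injOn := h.injOn.mono inter_subset_left
  isOpenMap V hV hVo := by
    obtain ⟨W', hW', h'⟩ := h.isOpenMap V (hV.trans inter_subset_left) hVo
    refine ⟨W', hW', Subset.antisymm ?_ ?_⟩
    · rintro _ ⟨u, hu, rfl⟩
      have : σ u ∈ S ∩ W' := h' ▸ mem_image_of_mem σ hu
      exact ⟨⟨this.1, (hV hu).2⟩, this.2⟩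
    · rintro p ⟨⟨hp, -⟩, hp'⟩
      rw [h']
      exact ⟨hp, hp'⟩

/-- The initial speed of a normal shift solves the Pfaff equation. -/
lemma fderiv_initialSpeed {g : RiemMetric n M} {F : ForceField n M}
    (hφ : φ ∈ IsManifold.maximalAtlas (𝓡 n) ∞ M) {S : Set M} {N : (p : M) → TangentSpace (𝓡 n) p}
    (hN : ∀ p ∈ S, g.inner p (N p) (N p) = 1) {ν : M → ℝ} {ε : ℝ} (hε : 0 < ε) {f : ℝ → M → M}
    (hf : IsShift g F S N ν ε f) {U : Set (Coord (n - 1))} {σ : Coord (n - 1) → M}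
    (hσ : IsLocalParam (n := n) S U σ)
    (hdev : ∀ u ∈ U, ∀ k, HasDerivAt (deviation g f σ u k) 0 0) {u : Coord (n - 1)} (hu : u ∈ U)
    (huφ : σ u ∈ φ.source) (hν : ν (σ u) ≠ 0) (hνd : DifferentiableAt ℝ (fun w => ν (σ w)) u) :
    fderiv ℝ (fun w => ν (σ w)) u = pfaffForm (chartMetric g φ) (chartForce F φ)
      (fun w => φ (σ w)) (fun w => compOf φ (σ w) (N (σ w))) (u, ν (σ u)) := by
  ext a
  refine Coord.eq_of_isLinearMap (f₁ := fderiv ℝ (fun w => ν (σ w)) u)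
    (f₂ := pfaffForm (chartMetric g φ) (chartForce F φ)
      (fun w => φ (σ w)) (fun w => compOf φ (σ w) (N (σ w))) (u, ν (σ u)))
    ⟨map_add _, map_smul _⟩ ⟨map_add _, map_smul _⟩ (fun k => ?_) a
  have h := (hasDerivAt_deviation hφ hN hε hf hσ hu huφ hνd.hasFDerivAt k).unique (hdev u hu k)
  rw [pfaffForm_apply, chartMetric_symm]
  field_simp
  linarith

/-- Additional normality is applied to a test surface through `x₀` with normal `n₀` and second
fundamental form `c ⊗ c` there. The function `ν` that it supplies solves the Pfaff equation near the
point, so compatibility holds at the point and is evaluated by `relation_of_compat`. -/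
lemma relation_of_additionalNormality (hn : 1 ≤ n) {g : RiemMetric n M} {F : ForceField n M}
    (hF : SmoothForce F) (H : AdditionalNormality g F)
    (hφ : φ ∈ IsManifold.maximalAtlas (𝓡 n) ∞ M) {x₀ n₀ : Coord n} (hx₀ : x₀ ∈ φ.target)
    (hn₀ : chartMetric g φ x₀ n₀ n₀ = 1) {ν₀ : ℝ} (hν₀ : ν₀ ≠ 0) {c a b : Coord n}
    (hc : chartMetric g φ x₀ c n₀ = 0) (ha : chartMetric g φ x₀ a n₀ = 0)
    (hb : chartMetric g φ x₀ b n₀ = 0) :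
    ν₀⁻¹ * symmForm (chartMetric g φ) (chartGamma g φ) (chartForce F φ) x₀ (ν₀ • n₀) a b
        - chartMetric g φ x₀ a c *
          chartMetric g φ x₀ b (velGradMap (chartForce F φ) x₀ (ν₀ • n₀) c) =
      ν₀⁻¹ * symmForm (chartMetric g φ) (chartGamma g φ) (chartForce F φ) x₀ (ν₀ • n₀) b a
        - chartMetric g φ x₀ b c *
          chartMetric g φ x₀ a (velGradMap (chartForce F φ) x₀ (ν₀ • n₀) c) := by
  have hG := isMetricOn_chart g hφ
  have hdim : Module.finrank ℝ (Coord n) = Module.finrank ℝ (Coord (n - 1)) + 1 := by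
    simp only [finrank_euclideanSpace_fin]
    omega
  obtain ⟨L, hLinj, hLr⟩ := IsMetricOn.exists_perp_param (E' := Coord (n - 1))
    (g := chartMetric g φ) (x := x₀) (n₀ := n₀) (by rw [hn₀]; exact one_ne_zero) hdim
  obtain ⟨ψ, hψ, rfl, hψL, hII⟩ := exists_surface_of_second_form hG hx₀ hn₀ L c
  have hn₀r : n₀ ∉ range (fderiv ℝ ψ 0) := by
    rw [hψL, ← hLr, hn₀]
    exact one_ne_zero
  obtain ⟨W, hW, r, h, hr, -, -, V, hVU, hV, h0V, hrV⟩ := exists_adapted_coordinates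
    (φ.open_target.preimage hψ.continuous) hψ.contDiffOn (u₀ := 0) hx₀
    (by rw [hψL]; exact hLinj) hn₀r hdim
  set σ : Coord (n - 1) → M := fun u => φ.symm (ψ u) with hσd
  have hrV' : ∀ u ∈ V, ψ u ∈ W ∧ r (ψ u) = u := fun u hu => ⟨(hrV u hu).1, (hrV u hu).2.1⟩
  have hσ : IsLocalParam (n := n) (σ '' V) V σ :=
    isLocalParam_of_retraction hφ hV hψ.contDiffOn hVU hW hr hrV'
  have hs : ∀ u ∈ V, σ u ∈ φ.source := fun u hu => φ.map_target (hVU hu)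
  have hφσ : ∀ u ∈ V, φ (σ u) = ψ u := fun u hu => φ.right_inv (hVU hu)
  have hunit₀ : IsUnitNormal g (σ '' V) (σ 0) (ofComp φ (σ 0) n₀) := by
    constructor
    · rw [inner_eq_chartMetric g hφ (hs 0 h0V), compOf_ofComp hφ (hs 0 h0V), hφσ 0 h0V, hn₀]
    -- Tangent vectors are defined through arbitrary parametrizations. Each is a reparametrization
    -- of `σ`, hence its vectors lie in `range L`, the orthogonal complement of `n₀`.
    · rintro w ⟨U₂, σ₂, hσ₂, u, hu, d, hwd⟩
      obtain ⟨ρ, hρ, hρd⟩ := hσ₂.exists_reparam hφ hs hW hr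
        (fun u hu => by rw [hφσ u hu]; exact hrV' u hu)
      have hp : σ 0 = σ₂ u := congrArg (fun q => q.1) hwd
      have hρ0 : ρ u = 0 := hσ.injOn (hρ u hu).1 h0V ((hρ u hu).2.trans hp.symm)
      have hw := congrArg (fun q : TangentBundle (𝓡 n) M => compOf φ q.1 q.2) hwd
      have hw' : compOf φ (σ 0) w = fderiv ℝ (fun w => φ (σ₂ w)) u d :=
        hw.trans (compOf_mfderiv hφ ((hσ₂.contMDiffAt hu).mdifferentiableAt (by simp))
          (hp ▸ hs 0 h0V) d)
      have h1 := HasFDerivAt.comp (g := ψ) u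
        ((hψ.contDiffAt (x := ρ u)).differentiableAt (by simp)).hasFDerivAt (hρd u hu).hasFDerivAt
      have h2 : (fun w => φ (σ₂ w)) =ᶠ[𝓝 u] ψ ∘ ρ := by
        filter_upwards [hσ₂.isOpen.mem_nhds hu] with w hw
        rw [← (hρ w hw).2, hφσ _ (hρ w hw).1]
        rfl
      rw [h2.fderiv_eq, h1.fderiv, hρ0, hψL] at hw'
      rw [inner_eq_chartMetric g hφ (hs 0 h0V), compOf_ofComp hφ (hs 0 h0V), hw', hφσ 0 h0V,
        chartMetric_symm]
      exact (hLr _).2 ⟨_, rfl⟩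
  -- The condition returns an open piece of the surface; the parametrization is then restricted to
  -- it.
  obtain ⟨_, ⟨W', hW', rfl⟩, h0S, -, N, hN, hN0, ν, ⟨⟨S', -, hcl, hνs⟩, hν0⟩, hνν₀, ε, hε, f, hf,
    hdev⟩ := H (σ '' V) (fun p hp => ⟨V, σ, hσ, hp⟩) (σ 0) (mem_image_of_mem σ h0V) _ hunit₀ ν₀ hν₀
  have hσ' := hσ.inter_open hW'
  set V' := V ∩ σ ⁻¹' W' with hV'
  have h0 : (0 : Coord (n - 1)) ∈ V' := ⟨h0V, h0S.2⟩
  have hV'n : ∀ u ∈ V', V' ∈ 𝓝 u := fun u hu => hσ'.isOpen.mem_nhds hu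
  have hμs : ContDiffOn ℝ ∞ (fun w => ν (σ w)) V' :=
    contMDiffOn_iff_contDiffOn.1 (hνs.comp hσ'.smooth fun u hu => hcl (subset_closure (hσ'.mem hu)))
  have hμ0 : ∀ u ∈ V', ν (σ u) ≠ 0 := fun u hu => hν0 _ (subset_closure (hσ'.mem hu))
  set N' : Coord (n - 1) → Coord n := fun w => compOf φ (σ w) (N (σ w)) with hN'
  have hN's : ContDiffOn ℝ ∞ N' V' := by
    have h1 : ContMDiffOn (𝓡 (n - 1)) (𝓡 n).tangent ∞
        (fun w => (⟨σ w, N (σ w)⟩ : TangentBundle (𝓡 n) M)) V' :=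
      hN.smooth.comp hσ'.smooth fun u hu => hσ'.mem hu
    exact contMDiffOn_iff_contDiffOn.1 ((contMDiffOn_compOf hφ).comp h1 fun u hu => hs u hu.1)
  have hfd : ∀ u ∈ V', (fun w => φ (σ w)) =ᶠ[𝓝 u] ψ := fun u hu => by
    filter_upwards [hV'n u hu] with w hw using hφσ w hw.1
  have hN'1 : ∀ u ∈ V', chartMetric g φ (ψ u) (N' u) (N' u) = 1 := fun u hu => by
    rw [← (hN.normal _ (hσ'.mem hu)).1, inner_eq_chartMetric g hφ (hs u hu.1), hφσ u hu.1]
  have hN't : ∀ u ∈ V', ∀ k, chartMetric g φ (ψ u) (N' u) (fderiv ℝ ψ u k) = 0 := fun u hu k => by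
    rw [← (hfd u hu).fderiv_eq, ← compOf_mfderiv hφ
      ((hσ'.contMDiffAt hu).mdifferentiableAt (by simp)) (hs u hu.1), ← hφσ u hu.1,
      ← inner_eq_chartMetric g hφ (hs u hu.1)]
    exact (hN.normal _ (hσ'.mem hu)).2 _ ⟨V', σ, hσ', u, hu, k, rfl⟩
  have hN'0 : N' 0 = n₀ := by
    simp only [hN', hN0]
    exact compOf_ofComp hφ (hs 0 h0V) n₀
  have hpf : ∀ u ∈ V', fderiv ℝ (fun w => ν (σ w)) u =
      pfaffForm (chartMetric g φ) (chartForce F φ) ψ N' (u, ν (σ u)) := by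
    intro u hu
    rw [fderiv_initialSpeed hφ (fun p hp => (hN.normal p hp).1) hε hf hσ' (hdev V' σ hσ') hu
      (hs u hu.1) (hμ0 u hu) ((hμs.contDiffAt (hV'n u hu)).differentiableAt (by simp))]
    ext k
    rw [pfaffForm_apply, pfaffForm_apply, (hfd u hu).fderiv_eq]
    simp only [hφσ u hu.1, hN']
  have hn₀ne : n₀ ≠ 0 := by
    intro h
    rw [h, map_zero] at hn₀
    exact zero_ne_one hn₀
  have hN'at := hN's.contDiffAt (hV'n 0 h0)
  have hFat : ContDiffAt ℝ ∞ (chartForce F φ) (ψ 0, ν₀ • N' 0) := by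
    rw [hN'0]
    exact contDiffAt_chartForce hF hφ hx₀ (smul_ne_zero hν₀ hn₀ne)
  -- At the centre the speed has the prescribed value `ν₀` and the normal is `n₀`, so compatibility
  -- is obtained exactly at the required velocity `ν₀ • n₀`.
  have hcompat := compat_of_solution_pfaff (hμs.contDiffAt (hV'n 0 h0))
    (θ := pfaffForm (chartMetric g φ) (chartForce F φ) ψ N')
    (by
      rw [hνν₀]
      exact contDiffAt_pfaffForm hG hx₀ hψ.contDiffAt hN'at hν₀ hFat)
    (by filter_upwards [hV'n 0 h0] with u hu using hpf u hu)
  rw [hνν₀] at hcompat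
  have hrel := relation_of_compat hG hx₀ hψ.contDiffAt hN'at hν₀ hFat
    (by filter_upwards [hV'n 0 h0] with u hu using hN'1 u hu)
    (by filter_upwards [hV'n 0 h0] with u hu using hN't u hu)
    (fun d hd => by rw [hψL, ← hLr, ← hN'0]; exact hd) (c := c) (by rw [hN'0]; exact hc)
    (fun h k => by rw [hN'0, hII, hψL]) hcompat (a := a) (b := b) (by rw [hN'0]; exact ha)
    (by rw [hN'0]; exact hb)
  rwa [hN'0] at hrel

/-- Any nonzero velocity is its length times a unit vector, taken as initial speed and normal. Once
`symmForm` is known to be symmetric, it cancels from the relation and leaves the velocity gradient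
alone. -/
theorem conditions_of_additionalNormality (hn : 1 ≤ n) {g : RiemMetric n M} {F : ForceField n M}
    (hF : SmoothForce F) (H : AdditionalNormality g F)
    (hφ : φ ∈ IsManifold.maximalAtlas (𝓡 n) ∞ M) {x v : Coord n} (hx : x ∈ φ.target)
    (hv : v ≠ 0) : SymmCondition (chartMetric g φ) (chartGamma g φ) (chartForce F φ) x v ∧
      ScalarCondition (chartMetric g φ) (chartForce F φ) x v := by
  have hG := isMetricOn_chart g hφ
  have hpos := hG.pos x hx v hv
  set ν : ℝ := Real.sqrt (chartMetric g φ x v v) with hν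
  have hν0 : ν ≠ 0 := (Real.sqrt_pos.2 hpos).ne'
  set n₀ : Coord n := ν⁻¹ • v with hn₀d
  have hvn : ν • n₀ = v := by rw [hn₀d, smul_inv_smul₀ hν0]
  have hνν : ν * ν = chartMetric g φ x v v := Real.mul_self_sqrt hpos.le
  have hn₀ : chartMetric g φ x n₀ n₀ = 1 := by
    simp only [hn₀d, map_smul, smul_apply, smul_eq_mul, ← hνν]
    field_simp
  have hperp : ∀ a, chartMetric g φ x a v = 0 → chartMetric g φ x a n₀ = 0 := fun a h => by
    rw [hn₀d, map_smul, h, smul_zero]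
  have hrel : ∀ c a b, chartMetric g φ x c v = 0 → chartMetric g φ x a v = 0 →
      chartMetric g φ x b v = 0 → _ := fun c a b hc ha hb =>
    relation_of_additionalNormality hn hF H hφ hx hn₀ hν0 (hperp c hc) (hperp a ha) (hperp b hb)
  rw [hvn] at hrel
  have hS := symmCondition_of_relation hν0 hrel
  refine ⟨hS, scalarCondition_of_relation hG hx fun c a b hc ha hb => ?_⟩
  have h1 := hrel c a b hc ha hb
  rw [hS a b ha hb] at h1
  linarith

end Necessity

end NormalShift

end

theorem theorem9p5 {n : ℕ} (hn : 3 ≤ n) {M : Type*} [TopologicalSpace M] [T2Space M]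
    [ChartedSpace (NormalShift.Coord n) M] [IsManifold (𝓡 n) ∞ M]
    (g : NormalShift.RiemMetric n M) (F : NormalShift.ForceField n M)
    (hF : NormalShift.SmoothForce F) :
    NormalShift.AdditionalNormality g F ↔
      ∀ (p : M) (v : TangentSpace (𝓡 n) p), v ≠ 0 →
        ∀ φ ∈ IsManifold.maximalAtlas (𝓡 n) ∞ M, p ∈ φ.source →
          NormalShift.SymmEquation g F φ (φ p) (NormalShift.compOf φ p v) ∧
          NormalShift.ScalarEquation g F φ (φ p) (NormalShift.compOf φ p v) := by
  constructor
  · intro H p v hv φ hφ hp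
    have hx := φ.map_source hp
    have hw : NormalShift.compOf φ p v ≠ 0 := fun h =>
      hv ((NormalShift.mdifferentiable_chart hφ).mfderiv_injective hp
        (h.trans (map_zero (mfderiv (𝓡 n) (𝓡 n) φ p)).symm))
    rw [NormalShift.symmEquation_iff g hF hφ hx hw,
      NormalShift.scalarEquation_iff g (by omega) hF hφ hx hw]
    exact NormalShift.conditions_of_additionalNormality (by omega) hF H hφ hx hw
  · intro H
    refine NormalShift.additionalNormality_of_conditions (by omega) hF fun φ hφ x hx v hv => ?_
    -- Every coordinate pair `(x, v)` with `v ≠ 0` comes from a nonzero tangent vector, so the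
    -- hypothesis covers the whole chart.
    have h := H (φ.symm x) (NormalShift.vecOf φ x v) (NormalShift.vecOf_ne_zero hφ hx hv) φ hφ
      (φ.map_target hx)
    rw [NormalShift.compOf_vecOf hφ hx, φ.right_inv hx] at h
    rwa [NormalShift.symmEquation_iff g hF hφ hx hv,
      NormalShift.scalarEquation_iff g (by omega) hF hφ hx hv] at h
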